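/- Proposition (rational curves: rank $2d-2$, Halphen transform of degree $3d-2$). Work over $\mathbb C$ in $\mathbb P^3$. The *degree* of a curve $\mathcal C\subset\mathbb P^3$ is the number of points of $\mathcal C$ in a generic plane, and its *rank* is the number of tangent lines $\mathcal T_m\mathcal C$ ($m$ a nonsingular point of $\mathcal C$) that meet a generic line. For a quadric $\mathcal Q=V(Q)$ and $m=[m_0:\dots:m_3]$, the *polar* $\delta_m\mathcal Q$ is $V\bigl(\sum_i m_i\,\partial_iQ\bigr)$. The *Halphen transform* $\mathcal C^{\mathcal Q}$ is the Zariski closure of the set of the points $\Phi(m)$, where $m$ runs over the nonsingular points of $\mathcal C$ for which $\mathcal T_m\mathcal C\cap\delta_m\mathcal Q$ is a single point $\Phi(m)$. "Generic" means: on some nonempty Zariski-open subset of the space of coefficients. Let $\gamma=(\gamma_0,\dots,\gamma_3)$ denote a quadruple of binary forms of degree $d$ in $(u,v)$, and $\mathcal C$ the image of $[u:v]\mapsto[\gamma(u,v)]$. (1) Let $d\ge 1$. For generic $\gamma$, the forms $\gamma_i$ have no common zero in $\mathbb P^1$, $\mathcal C$ has degree $d$ and rank $2d-2$, and for a generic quadric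 $\mathcal Q$ the curve $\mathcal C^{\mathcal Q}$ has degree $3d-2$. (2) The same holds for every such curve, in particular for every smooth one, that satisfies an explicit condition: if $\gamma_0,\dots,\gamma_3$ have no common zero in $\mathbb P^1$ and the coordinates $\partial_u\gamma_i\,\partial_v\gamma_j-\partial_u\gamma_j\,\partial_v\gamma_i$ ($i<j$) of $\bigwedge^2(\gamma_u\ \gamma_v)$ have no common prime factor in $\mathbb C[u,v]$, then $d\ge 1$, $\mathcal C$ has degree $d$ and rank $2d-2$, and for a generic quadric $\mathcal Q$ the curve $\mathcal C^{\mathcal Q}$ has degree $3d-2$. -/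

import Mathlib

noncomputable section

namespace Halphen

open MvPolynomial

/-- Complex projective three-space, in coordinates. -/
abbrev P3 : Type := Projectivization ℂ (Fin 4 → ℂ)

/-- A property of points of the affine space `ι → ℂ` is generic if it holds on a nonempty
Zariski-open set, that is, outside the zero set of some nonzero polynomial. -/
def IsGeneric {ι : Type} (S : (ι → ℂ) → Prop) : Prop :=
  ∃ P : MvPolynomial ι ℂ, P ≠ 0 ∧ ∀ x : ι → ℂ, eval x P ≠ 0 → S x

/-- The form `F` is homogeneous and vanishes on `S`. -/
def VanishesOn (F : MvPolynomial (Fin 4) ℂ) (S : Set P3) : Prop :=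
  (∃ k : ℕ, F.IsHomogeneous k) ∧ ∀ p ∈ S, eval p.rep F = 0

/-- The Zariski closure of a subset of projective space. -/
def zariskiClosure (S : Set P3) : Set P3 :=
  {p | ∀ F : MvPolynomial (Fin 4) ℂ, VanishesOn F S → eval p.rep F = 0}

/-- The linear subspace cut out by the differentials at `m` of all forms vanishing on `S`.
When `m` is a nonsingular point of a curve `S` this is the (cone over the) tangent line. -/
def tangentLine (S : Set P3) (m : P3) : Submodule ℂ (Fin 4 → ℂ) where
  carrier := {w | ∀ F : MvPolynomial (Fin 4) ℂ, VanishesOn F S →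
    ∑ i, eval m.rep (pderiv i F) * w i = 0}
  zero_mem' := by
    intro F _
    simp
  add_mem' := by
    intro a b ha hb F hF
    simp only [Pi.add_apply, mul_add, Finset.sum_add_distrib, ha F hF, hb F hF, add_zero]
  smul_mem' := by
    intro c a ha F hF
    have h := ha F hF
    simp only [Pi.smul_apply, smul_eq_mul, mul_left_comm _ c, ← Finset.mul_sum, h, mul_zero]

/-- Nonsingular points of a space curve: the differentials of its equations span a space of
dimension 2, i.e. their common kernel has dimension `4 - 2 = 2`. -/
def IsNonsingularPoint (S : Set P3) (m : P3) : Prop :=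
  m ∈ S ∧ Module.finrank ℂ (tangentLine S m) = 2

/-- `S` has degree `n`: a generic plane meets `S` in exactly `n` points. -/
def HasDegree (S : Set P3) (n : ℕ) : Prop :=
  IsGeneric fun a : Fin 4 → ℂ => {p : P3 | p ∈ S ∧ ∑ i, a i * p.rep i = 0}.encard = n

/-- `S` has rank `n`: exactly `n` of its tangent lines meet a generic line.
The generic line is spanned by two generic points `x (0, ·)` and `x (1, ·)`. -/
def HasRank (S : Set P3) (n : ℕ) : Prop :=
  IsGeneric fun x : Fin 2 × Fin 4 → ℂ =>
    {L : Submodule ℂ (Fin 4 → ℂ) | (∃ m, IsNonsingularPoint S m ∧ L = tangentLine S m) ∧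
      L ⊓ Submodule.span ℂ {fun i => x (0, i), fun i => x (1, i)} ≠ ⊥}.encard = n

/-- The quadratic form with the ten coefficients `q`, the coefficient of `X i * X j` being
`q s(i, j)`. -/
def quadricForm (q : Sym2 (Fin 4) → ℂ) : MvPolynomial (Fin 4) ℂ :=
  ∑ s : Sym2 (Fin 4), C (q s) * (s.map (X : Fin 4 → MvPolynomial (Fin 4) ℂ)).mul

/-- The polar of the quadric `Q = 0` with respect to the point `m`. -/
def polar (Q : MvPolynomial (Fin 4) ℂ) (m : P3) : Set P3 :=
  {n | ∑ i, m.rep i * eval n.rep (pderiv i Q) = 0}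

/-- The Halphen map as a relation: `m` is a nonsingular point of `S` and `n` is the unique
intersection point of the tangent line at `m` with the polar of `m`. -/
def HalphenMap (S : Set P3) (Q : MvPolynomial (Fin 4) ℂ) (m n : P3) : Prop :=
  IsNonsingularPoint S m ∧ {p : P3 | p.rep ∈ tangentLine S m} ∩ polar Q m = {n}

/-- The Halphen transform: the Zariski closure of the image of the Halphen map. -/
def halphenTransform (S : Set P3) (Q : MvPolynomial (Fin 4) ℂ) : Set P3 :=
  zariskiClosure {n | ∃ m, HalphenMap S Q m n}

/-- The value at `s` of the quadruple `γ` of polynomials in the two variables `u = X 0`,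
`v = X 1`. -/
def paramEval (γ : Fin 4 → MvPolynomial (Fin 2) ℂ) (s : Fin 2 → ℂ) : Fin 4 → ℂ :=
  fun i => eval s (γ i)

/-- `γ` is given by four binary forms of degree `d` without common zero on the projective line,
so it is a morphism from the projective line to projective three-space. -/
def IsMorphismOfDegree (d : ℕ) (γ : Fin 4 → MvPolynomial (Fin 2) ℂ) : Prop :=
  (∀ i, (γ i).IsHomogeneous d) ∧ ∀ s : Fin 2 → ℂ, s ≠ 0 → paramEval γ s ≠ 0

/-- The image of the projective line under `γ`. -/
def curveImage (γ : Fin 4 → MvPolynomial (Fin 2) ℂ) : Set P3 :=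
  {p | ∃ s : Fin 2 → ℂ, s ≠ 0 ∧
    ∃ h : paramEval γ s ≠ 0, p = Projectivization.mk ℂ (paramEval γ s) h}

/-- The coordinates of `⋀² (γ_u γ_v)`. -/
def wedgeCoord (γ : Fin 4 → MvPolynomial (Fin 2) ℂ) (i j : Fin 4) : MvPolynomial (Fin 2) ℂ :=
  pderiv 0 (γ i) * pderiv 1 (γ j) - pderiv 0 (γ j) * pderiv 1 (γ i)

/-- The coordinates of `⋀² (γ_u γ_v)` have no common prime factor. -/
def WedgeCoprime (γ : Fin 4 → MvPolynomial (Fin 2) ℂ) : Prop :=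
  ¬ ∃ π : MvPolynomial (Fin 2) ℂ, Prime π ∧ ∀ i j : Fin 4, i < j → π ∣ wedgeCoord γ i j

/-- The quadruple of binary forms of degree `d` with coefficients `c`. -/
def paramOfCoeffs (d : ℕ) (c : Fin 4 × Fin (d + 1) → ℂ) : Fin 4 → MvPolynomial (Fin 2) ℂ :=
  fun i => ∑ k : Fin (d + 1), C (c (i, k)) * X 0 ^ (k : ℕ) * X 1 ^ (d - (k : ℕ))

end Halphen

end

/-!
# The Halphen transform of a rational space curve

Both parts of the theorem reduce to one statement about an *immersed* rational curve
(`Halphen.Immersion`): a quadruple `γ` of binary forms of degree `d ≥ 1` such that the bivector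
`γ_u ∧ γ_v` vanishes nowhere on the projective line. A form vanishing at a point of the projective
line is divisible by the corresponding linear form, which is prime, so forms satisfying the
coprimality condition are immersed (`immersion_of_wedgeCoprime`). Immersedness is implied by a
resultant condition on the coefficients which holds for the forms `(u + i v) ^ d`, so it is generic
(`isGeneric_immersion`).

*Counting.* A linear system of binary forms of degree `e` without base points has a generic member
with `e` distinct zeros (`IsGeneric.separableOfDegree_sum`): in a pencil, a multiple zero of a
member is a zero of the Wronskian. The degree is the case of the system spanned by the `γ i`, and
the rank is the case of the incidence conditions `γ_u ∧ γ_v ∧ x₀ ∧ x₁ = 0`, of degree `2d - 2`. One has to know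
that different parameters give different points, resp. different tangent lines, apart from finitely
many exceptions. For the points (`AffineImmersion.finite_multiple`), the divided differences of
`γ(s) ∧ γ(t)` have no common factor, because a common factor would vanish somewhere on the diagonal,
where they restrict to `γ ∧ γ'`. For the tangent lines (`AffineImmersion.finite_bitangent`),
differentiating along a curve of pairs `(s, t)` with the same tangent line shows that `γ(t)` lies in
the planes spanned by `γ(s), γ'(s)` and by `γ(s), γ''(s)`; these meet only in `γ(s)` unless `s` is
a flex.

*Geometry of the image.* Equations of the image are obtained as resultants (`implicitForm`): they
show that the image is Zariski closed (`Immersion.zariskiClosure_curveImage_subset`) and that at all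
but finitely many parameters the image is nonsingular with the expected tangent line
(`Immersion.tangentLine_le`).

*The Halphen transform.* The tangent line at `γ` is spanned by `γ_u` and `γ_v`, and it meets the
polar plane of `γ` with respect to a quadric with bilinear form `B` in the point
`Φ = B(γ, γ_v) γ_u - B(γ, γ_u) γ_v`, a quadruple of forms of degree `3d - 2` (`halphenParam`). In
an affine chart, `Φ` is up to a constant `ψ = B(γ, γ') γ - B(γ, γ) γ'`, and `ψ ∧ ψ'` does not vanish
if the quadric is not tangent to the curve, nor to a tangent line at a flex
(`exists_minor_bilin_ne_zero`). As there are only finitely many flexes (`d ≥ 2`), both hold for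
a generic quadric, and then `Φ` is again an immersion. Its image is the Halphen transform
(`Immersion.halphenTransform_eq`), which therefore has degree `3d - 2`.
-/

namespace Halphen

/-! ### Generic properties -/

namespace IsGeneric

variable {ι : Type} {S T : (ι → ℂ) → Prop}

theorem mono (hS : IsGeneric S) (h : ∀ x, S x → T x) : IsGeneric T := by
  obtain ⟨P, hP, hPS⟩ := hS
  exact ⟨P, hP, fun x hx => h x (hPS x hx)⟩

theorem and (hS : IsGeneric S) (hT : IsGeneric T) : IsGeneric fun x => S x ∧ T x := by
  obtain ⟨P, hP, hPS⟩ := hS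
  obtain ⟨R, hR, hRT⟩ := hT
  refine ⟨P * R, mul_ne_zero hP hR, fun x hx => ?_⟩
  rw [map_mul] at hx
  exact ⟨hPS x (left_ne_zero_of_mul hx), hRT x (right_ne_zero_of_mul hx)⟩

theorem of_forall (h : ∀ x, S x) : IsGeneric S :=
  ⟨1, one_ne_zero, fun x _ => h x⟩

theorem forall_mem_finite {α : Type*} {s : Set α} (hs : s.Finite) {S : α → (ι → ℂ) → Prop}
    (h : ∀ a ∈ s, IsGeneric (S a)) : IsGeneric fun x => ∀ a ∈ s, S a x := by
  induction s, hs using Set.Finite.induction_on with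
  | empty => exact of_forall (by simp)
  | @insert a s _ _ ih =>
    refine ((h a (Set.mem_insert _ _)).and
      (ih fun b hb => h b (Set.mem_insert_of_mem _ hb))).mono fun x hx => ?_
    rintro b (rfl | hb)
    exacts [hx.1, hx.2 b hb]

theorem exists_mem (hS : IsGeneric S) : ∃ x, S x := by
  obtain ⟨P, hP, hPS⟩ := hS
  by_contra! h
  exact hP (MvPolynomial.funext fun x => by
    by_contra hx
    exact h x (hPS x (by simpa using hx)))

/-- A polynomial condition that holds somewhere holds generically. -/
theorem of_eval_ne_zero (P : MvPolynomial ι ℂ) {x₀ : ι → ℂ} (h₀ : MvPolynomial.eval x₀ P ≠ 0)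
    (h : ∀ x, MvPolynomial.eval x P ≠ 0 → S x) : IsGeneric S :=
  ⟨P, fun hP => h₀ (by simp [hP]), h⟩

theorem sum_mul_ne_zero [Fintype ι] {v : ι → ℂ} (hv : v ≠ 0) :
    IsGeneric fun a : ι → ℂ => ∑ i, a i * v i ≠ 0 := by
  classical
  obtain ⟨i, hi⟩ := Function.ne_iff.mp hv
  refine of_eval_ne_zero (∑ j, MvPolynomial.X j * MvPolynomial.C (v j)) (x₀ := Pi.single i 1) ?_ ?_
  · simpa [Pi.single_apply] using hi
  · intro x hx
    simpa using hx

end IsGeneric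

/-! ### Separable members of linear systems -/

open Polynomial

/-- `f` is a separable polynomial of degree exactly `e`; as a binary form of degree `e` it has `e`
distinct zeros, none of them at infinity. -/
def SeparableOfDegree (f : ℂ[X]) (e : ℕ) : Prop :=
  f.natDegree ≤ e ∧ f.coeff e ≠ 0 ∧ f.Separable

namespace SeparableOfDegree

variable {f : ℂ[X]} {e : ℕ}

theorem natDegree_eq (h : SeparableOfDegree f e) : f.natDegree = e :=
  le_antisymm h.1 (le_natDegree_of_ne_zero h.2.1)

theorem ne_zero (h : SeparableOfDegree f e) : f ≠ 0 := by
  rintro rfl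
  exact h.2.1 (by simp)

theorem card_roots (h : SeparableOfDegree f e) : f.roots.toFinset.card = e := by
  rw [Multiset.toFinset_card_of_nodup (nodup_roots h.2.2),
    ← (IsAlgClosed.splits f).natDegree_eq_card_roots, h.natDegree_eq]

theorem eval_derivative_ne_zero (h : SeparableOfDegree f e) {z : ℂ} (hz : f.eval z = 0) :
    f.derivative.eval z ≠ 0 := by
  intro hz'
  obtain ⟨a, b, hab⟩ := h.2.2
  simpa [hz, hz'] using congr_arg (eval z) hab

end SeparableOfDegree

theorem separable_of_eval {f : ℂ[X]}
    (h : ∀ z, f.eval z = 0 → f.derivative.eval z ≠ 0) : f.Separable := by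
  rw [Polynomial.Separable, isCoprime_iff_aeval_ne_zero_of_isAlgClosed ℂ ℂ]
  intro z
  by_cases hz : f.eval z = 0
  · exact Or.inr (by simpa using h z hz)
  · exact Or.inl (by simpa using hz)

/-- A pencil of binary forms of degree `e` without base points has a separable member: a multiple
zero of a member is a zero of the Wronskian of the pencil, so only finitely many members
have one. -/
theorem exists_separableOfDegree_pencil {f g : ℂ[X]} {e : ℕ} (hf : f.natDegree ≤ e)
    (hg : g.natDegree ≤ e) (hge : g.coeff e ≠ 0) (hfg : ∀ z, g.eval z = 0 → f.eval z ≠ 0) :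
    ∃ t : ℂ, SeparableOfDegree (f + C t * g) e := by
  have hdeg : ∀ t : ℂ, (f + C t * g).natDegree ≤ e := fun t =>
    natDegree_add_le_of_degree_le hf ((natDegree_C_mul_le _ _).trans hg)
  have hg0 : g ≠ 0 := by rintro rfl; simp at hge
  rcases Nat.eq_zero_or_pos e with rfl | he
  · obtain ⟨t, ht⟩ := (Set.finite_singleton (-f.coeff 0 / g.coeff 0)).exists_notMem
    have hne : (f + C t * g).coeff 0 ≠ 0 := by
      intro h
      apply ht
      simp only [coeff_add, coeff_C_mul] at h
      rw [Set.mem_singleton_iff]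
      field_simp
      linear_combination h
    refine ⟨t, hdeg t, hne, separable_of_eval fun z hz => ?_⟩
    have hC := eq_C_of_natDegree_le_zero (hdeg t)
    rw [hC, eval_C] at hz
    exact absurd hz hne
  set W : ℂ[X] := f * derivative g - derivative f * g with hW
  have hW0 : W ≠ 0 := by
    intro h
    have hcop : IsCoprime g f := by
      rw [isCoprime_iff_aeval_ne_zero_of_isAlgClosed ℂ ℂ]
      intro z
      by_cases hz : g.eval z = 0
      · exact Or.inr (by simpa using hfg z hz)
      · exact Or.inl (by simpa using hz)
    have hdvd : g ∣ derivative g := by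
      refine hcop.dvd_of_dvd_mul_left ⟨derivative f, ?_⟩
      rw [hW] at h
      linear_combination h
    have hlt : (derivative g).degree < g.degree := degree_derivative_lt hg0
    have h0 := eq_zero_of_dvd_of_degree_lt hdvd hlt
    have hnd := derivative_eq_zero.mp h0
    exact absurd (le_natDegree_of_ne_zero hge) (by omega)
  obtain ⟨t, ht⟩ := ((W.roots.toFinset.image fun z => -f.eval z / g.eval z) ∪
    {-f.coeff e / g.coeff e}).finite_toSet.exists_notMem
  simp only [Finset.coe_union, Finset.coe_image, Finset.coe_singleton, Set.mem_union,
    Set.mem_image, Finset.mem_coe, Multiset.mem_toFinset, Set.mem_singleton_iff, not_or,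
    not_exists, not_and] at ht
  refine ⟨t, hdeg t, ?_, separable_of_eval fun z hz hz' => ?_⟩
  · intro h
    apply ht.2
    simp only [coeff_add, coeff_C_mul] at h
    field_simp
    linear_combination h
  · simp only [eval_add, eval_mul, eval_C, derivative_add, derivative_C_mul] at hz hz'
    have hgz : g.eval z ≠ 0 := fun h => hfg z h (by simpa [h] using hz)
    refine ht.1 z ((mem_roots hW0).mpr ?_) ?_
    · simp only [IsRoot.def, hW, eval_sub, eval_mul]
      linear_combination (derivative g).eval z * hz - g.eval z * hz'
    · field_simp
      linear_combination -hz

/-- A linear system of binary forms of degree `e` without base points has a separable member. -/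
theorem exists_separableOfDegree {ι : Type} [Fintype ι] {F : ι → ℂ[X]} {e : ℕ}
    (hdeg : ∀ i, (F i).natDegree ≤ e) (hF : ∀ z, ∃ i, (F i).eval z ≠ 0)
    (hinf : ∃ i, (F i).coeff e ≠ 0) :
    ∃ a : ι → ℂ, SeparableOfDegree (∑ i, C (a i) * F i) e := by
  classical
  obtain ⟨i₀, hi₀⟩ := hinf
  have hFi₀ : F i₀ ≠ 0 := fun h => hi₀ (by simp [h])
  obtain ⟨b, hb⟩ := (IsGeneric.forall_mem_finite (F i₀).roots.toFinset.finite_toSet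
    fun z _ => IsGeneric.sum_mul_ne_zero (v := fun i => (F i).eval z)
      (Function.ne_iff.mpr (hF z))).exists_mem
  obtain ⟨t, ht⟩ := exists_separableOfDegree_pencil (f := ∑ i, C (b i) * F i) (g := F i₀) (e := e)
    (natDegree_sum_le_of_forall_le _ _ fun i _ => (natDegree_C_mul_le _ _).trans (hdeg i))
    (hdeg i₀) hi₀ (fun z hz => by
      have := hb z (by simpa [hFi₀] using hz)
      simpa [eval_finsetSum] using this)
  refine ⟨b + Pi.single i₀ t, ?_⟩
  convert ht using 1
  simp only [Pi.add_apply, map_add, add_mul, Finset.sum_add_distrib]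
  congr 1
  rw [Finset.sum_eq_single i₀] <;> simp +contextual

/-- Having `e` distinct zeros, none at infinity, is an open condition in a polynomial family:
the discriminant and the leading coefficient are polynomials in the parameters. -/
theorem IsGeneric.separableOfDegree {ι : Type} {f : (MvPolynomial ι ℂ)[X]} {e : ℕ}
    (hf : f.natDegree ≤ e) {x₀ : ι → ℂ}
    (h₀ : SeparableOfDegree (f.map (MvPolynomial.eval x₀)) e) :
    IsGeneric fun x => SeparableOfDegree (f.map (MvPolynomial.eval x)) e := by
  have key : ∀ x : ι → ℂ, MvPolynomial.eval x (f.coeff e * resultant f (derivative f) e (e - 1)) =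
      (f.map (MvPolynomial.eval x)).coeff e * resultant (f.map (MvPolynomial.eval x))
        (derivative (f.map (MvPolynomial.eval x))) e (e - 1) := by
    intro x
    rw [map_mul, derivative_map, resultant_map_map, coeff_map]
  have key₂ : ∀ x : ι → ℂ, (f.map (MvPolynomial.eval x)).coeff e ≠ 0 →
      (resultant (f.map (MvPolynomial.eval x)) (derivative (f.map (MvPolynomial.eval x))) e (e - 1)
        ≠ 0 ↔ (f.map (MvPolynomial.eval x)).Separable) := by
    intro x hx
    have hd : (f.map (MvPolynomial.eval x)).natDegree = e :=
      le_antisymm (natDegree_map_le.trans hf) (le_natDegree_of_ne_zero hx)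
    have hd' : (derivative (f.map (MvPolynomial.eval x))).natDegree = e - 1 := by
      rw [natDegree_derivative, hd]
    have h0 : f.map (MvPolynomial.eval x) ≠ 0 := fun h => hx (by simp [h])
    have hr := resultant_eq_zero_iff (f := f.map (MvPolynomial.eval x))
      (g := derivative (f.map (MvPolynomial.eval x)))
    rw [hd', hd] at hr
    rw [Polynomial.Separable, Ne, hr]
    simp [h0]
  refine IsGeneric.of_eval_ne_zero (f.coeff e * resultant f (derivative f) e (e - 1)) (x₀ := x₀)
    ?_ fun x hx => ?_
  · rw [key]
    exact mul_ne_zero h₀.2.1 ((key₂ x₀ h₀.2.1).mpr h₀.2.2)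
  · rw [key] at hx
    have h1 := left_ne_zero_of_mul hx
    exact ⟨natDegree_map_le.trans hf, h1, (key₂ x h1).mp (right_ne_zero_of_mul hx)⟩

/-- The generic member of a linear system of binary forms of degree `e` without base points has
`e` distinct zeros, none at infinity. -/
theorem IsGeneric.separableOfDegree_sum {ι : Type} [Fintype ι] {F : ι → ℂ[X]} {e : ℕ}
    (hdeg : ∀ i, (F i).natDegree ≤ e) (hF : ∀ z, ∃ i, (F i).eval z ≠ 0)
    (hinf : ∃ i, (F i).coeff e ≠ 0) :
    IsGeneric fun a : ι → ℂ => SeparableOfDegree (∑ i, C (a i) * F i) e := by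
  have hmap : ∀ a : ι → ℂ, (∑ i, C (MvPolynomial.X i) * (F i).map MvPolynomial.C :
      (MvPolynomial ι ℂ)[X]).map (MvPolynomial.eval a) = ∑ i, C (a i) * F i := by
    intro a
    have hid : (MvPolynomial.eval a).comp (MvPolynomial.C : ℂ →+* MvPolynomial ι ℂ) =
        RingHom.id ℂ := by
      ext; simp
    simp [Polynomial.map_sum, Polynomial.map_map, hid]
  obtain ⟨a₀, ha₀⟩ := exists_separableOfDegree hdeg hF hinf
  have := IsGeneric.separableOfDegree
    (f := (∑ i, C (MvPolynomial.X i) * (F i).map MvPolynomial.C : (MvPolynomial ι ℂ)[X]))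
    (e := e) (x₀ := a₀)
    (natDegree_sum_le_of_forall_le _ _ fun i _ =>
      (natDegree_C_mul_le _ _).trans (natDegree_map_le.trans (hdeg i)))
    (by rwa [hmap])
  exact this.mono fun a ha => by rwa [hmap] at ha

end Halphen

namespace Halphen

open Polynomial

/-! ### Elimination in two variables -/

section Elimination

variable {R : Type*} [CommRing R] [IsDomain R] [NormalizedGCDMonoid R]

/-- An ideal of `R[X]` has a greatest common divisor `G` up to a nonzero constant `r`: over the
fraction field the ideal is principal, and by Gauss's lemma the primitive part of a generator
divides all members. -/
theorem exists_C_mul_mem_and_dvd (I : Ideal R[X]) :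
    ∃ (G : R[X]) (r : R), r ≠ 0 ∧ C r * G ∈ I ∧ ∀ h ∈ I, G ∣ h := by
  let K := FractionRing R
  let _ : Algebra R[X] K[X] := Polynomial.algebra R K
  have : IsLocalization (Submonoid.map C (nonZeroDivisors R)) K[X] :=
    Polynomial.isLocalization (nonZeroDivisors R) K
  obtain ⟨g, hg⟩ := IsPrincipalIdealRing.principal (Ideal.map (algebraMap R[X] K[X]) I)
  have hmem : ∀ h ∈ I, g ∣ h.map (algebraMap R K) := by
    intro h hh
    have h1 := Ideal.mem_map_of_mem (algebraMap R[X] K[X]) hh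
    rw [hg] at h1
    exact Ideal.mem_span_singleton.mp h1
  by_cases hg0 : g = 0
  · refine ⟨0, 1, one_ne_zero, by simp, fun h hh => ?_⟩
    have h1 := hmem h hh
    rw [hg0, zero_dvd_iff, Polynomial.map_eq_zero_iff (IsFractionRing.injective R K)] at h1
    rw [h1]
  obtain ⟨b, hb, hbg⟩ := IsLocalization.integerNormalization_spec (nonZeroDivisors R) g
  set P := IsLocalization.integerNormalization (nonZeroDivisors R) g with hP
  have hb0 : algebraMap R K b ≠ 0 := by
    simpa using nonZeroDivisors.ne_zero hb
  have hbg' : P.map (algebraMap R K) = C (algebraMap R K b) * g := by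
    rw [hbg, Algebra.smul_def]
    rfl
  have hP0 : P ≠ 0 := by
    intro h
    rw [h, Polynomial.map_zero] at hbg'
    exact mul_ne_zero (C_ne_zero.mpr hb0) hg0 hbg'.symm
  have hc0 : algebraMap R K P.content ≠ 0 := by
    simpa using content_eq_zero_iff.not.mpr hP0
  have hPP : P.map (algebraMap R K) =
      C (algebraMap R K P.content) * P.primPart.map (algebraMap R K) := by
    conv_lhs => rw [P.eq_C_content_mul_primPart]
    rw [Polynomial.map_mul, map_C]
  have hassoc : P.primPart.map (algebraMap R K) =
      C ((algebraMap R K P.content)⁻¹ * algebraMap R K b) * g := by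
    rw [C_mul, mul_assoc, ← hbg', hPP, ← mul_assoc, ← C_mul, inv_mul_cancel₀ hc0, C_1, one_mul]
  have hunit : IsUnit (C ((algebraMap R K P.content)⁻¹ * algebraMap R K b)) :=
    isUnit_C.mpr (mul_ne_zero (inv_ne_zero hc0) hb0).isUnit
  have hG : P.primPart.map (algebraMap R K) ∈ Ideal.map (algebraMap R[X] K[X]) I := by
    rw [hg, hassoc]
    exact Ideal.mul_mem_left _ _ (Ideal.mem_span_singleton_self g)
  obtain ⟨⟨⟨a, ha⟩, ⟨s, hs⟩⟩, has⟩ := (IsLocalization.mem_map_algebraMap_iff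
    (Submonoid.map C (nonZeroDivisors R)) K[X]).mp hG
  obtain ⟨r, hr, rfl⟩ := hs
  refine ⟨P.primPart, r, nonZeroDivisors.ne_zero hr, ?_, fun h hh => ?_⟩
  · have : C r * P.primPart = a := by
      apply Polynomial.map_injective _ (IsFractionRing.injective R K)
      rw [mul_comm, Polynomial.map_mul]
      exact has
    rwa [this]
  · refine P.isPrimitive_primPart.dvd_of_fraction_map_dvd_fraction_map (K := K) ?_
    rw [hassoc]
    exact hunit.mul_left_dvd.mpr (hmem h hh)

end Elimination

open Bivariate

theorem coeff_coeff_swap (p : ℂ[X][Y]) (m n : ℕ) :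
    ((swap p).coeff m).coeff n = (p.coeff n).coeff m := by
  induction p using Polynomial.induction_on' with
  | add p q hp hq => simp [hp, hq]
  | monomial k f =>
    induction f using Polynomial.induction_on' with
    | add p q hp hq => simp only [map_add, coeff_add, hp, hq]
    | monomial l r =>
      rw [swap_monomial_monomial]
      simp only [coeff_monomial]
      split_ifs <;> simp [coeff_monomial, *]

theorem natDegree_coeff_le_swap (p : ℂ[X][Y]) (n : ℕ) :
    (p.coeff n).natDegree ≤ (swap p).natDegree := by
  rw [natDegree_le_iff_coeff_eq_zero]
  intro m hm
  rw [← coeff_coeff_swap, coeff_eq_zero_of_natDegree_lt hm, coeff_zero]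

/-- The restriction to the diagonal of a polynomial of bidegree at most `(a, b)` has the
coefficient of bidegree `(a, b)` as its coefficient of degree `a + b`. -/
theorem coeff_eval_X {p : ℂ[X][Y]} {a b : ℕ} (hb : p.natDegree ≤ b)
    (ha : ∀ n, (p.coeff n).natDegree ≤ a) :
    (p.eval X).coeff (a + b) = (p.coeff b).coeff a := by
  rw [eval_eq_sum_range' (Nat.lt_succ_of_le hb), finsetSum_coeff, Finset.sum_eq_single b]
  · rw [coeff_mul_X_pow]
  · intro k hk hkb
    have hk' : k < b := lt_of_le_of_ne (Nat.lt_succ_iff.mp (Finset.mem_range.mp hk)) hkb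
    rw [coeff_mul_X_pow', if_pos (by omega)]
    exact coeff_eq_zero_of_natDegree_lt (lt_of_le_of_lt (ha k) (by omega))
  · intro h
    exact absurd (Finset.self_mem_range_succ b) h

theorem eval_eval_X (p : ℂ[X][Y]) (z : ℂ) : (p.eval X).eval z = p.evalEval z z := by
  induction p using Polynomial.induction_on' with
  | add p q hp hq => simp [hp, hq]
  | monomial k f => simp [evalEval]

theorem natDegree_swap_mul {p q : ℂ[X][Y]} (hp : p ≠ 0) (hq : q ≠ 0) :
    (swap (p * q)).natDegree = (swap p).natDegree + (swap q).natDegree := by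
  rw [map_mul, natDegree_mul] <;> simpa

/-- Let `h` be a polynomial of bidegree at most `(m, n)` whose coefficient of bidegree `(m, n)` is
not zero. A factor of `h` that vanishes nowhere on the affine diagonal is constant: the diagonal of
the product of two projective lines meets every curve of bidegree `(a, b)` with `a + b > 0`, and it
does so at infinity only if the coefficient of bidegree `(a, b)` vanishes. -/
theorem isUnit_of_dvd_of_diagonal {G h : ℂ[X][Y]} {m n : ℕ} (hn : h.natDegree ≤ n)
    (hm : (swap h).natDegree ≤ m) (hmn : (h.coeff n).coeff m ≠ 0) (hG : G ∣ h)
    (hdiag : ∀ z, G.evalEval z z ≠ 0) : IsUnit G := by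
  obtain ⟨K, rfl⟩ := hG
  have hGK : G * K ≠ 0 := fun h0 => hmn (by simp [h0])
  have hG0 := left_ne_zero_of_mul hGK
  have hK0 := right_ne_zero_of_mul hGK
  rw [natDegree_mul hG0 hK0] at hn
  rw [natDegree_swap_mul hG0 hK0] at hm
  set a := (swap G).natDegree with ha
  set b := G.natDegree with hb
  have h1 : (G * K).coeff n = G.coeff b * K.coeff (n - b) := by
    have := coeff_mul_add_eq_of_natDegree_le (f := G) (g := K) (df := b) (dg := n - b) le_rfl
      (by omega)
    rwa [Nat.add_sub_cancel' (by omega)] at this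
  have h2 : ((G * K).coeff n).coeff m = (G.coeff b).coeff a * (K.coeff (n - b)).coeff (m - a) := by
    have := coeff_mul_add_eq_of_natDegree_le (f := G.coeff b) (g := K.coeff (n - b)) (df := a)
      (dg := m - a) (natDegree_coeff_le_swap _ _)
      ((natDegree_coeff_le_swap _ _).trans (by omega))
    rwa [Nat.add_sub_cancel' (by omega), ← h1] at this
  have h3 : (G.coeff b).coeff a ≠ 0 := by
    intro h0
    rw [h0, zero_mul] at h2
    exact hmn h2
  have h4 : (G.eval X).coeff (a + b) ≠ 0 := by
    rwa [coeff_eval_X hb.ge fun k => natDegree_coeff_le_swap _ _]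
  have h5 : (G.eval X).degree = 0 := by
    by_contra hdeg
    obtain ⟨z, hz⟩ := IsAlgClosed.exists_root _ hdeg
    exact hdiag z (by rw [← eval_eval_X]; exact hz)
  have h6 : a + b = 0 := by
    have := le_natDegree_of_ne_zero h4
    rw [natDegree_eq_zero_iff_degree_le_zero.mpr h5.le] at this
    omega
  have hb0 : G.natDegree ≤ 0 := by omega
  have ha0 : (G.coeff 0).natDegree ≤ 0 := (natDegree_coeff_le_swap _ _).trans (by omega)
  rw [show a = 0 by omega, show b = 0 by omega] at h3
  rw [eq_C_of_natDegree_le_zero hb0, eq_C_of_natDegree_le_zero ha0]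
  exact isUnit_C.mpr (isUnit_C.mpr h3.isUnit)

end Halphen

namespace Halphen

open Polynomial Bivariate

/-! ### Minors of vectors -/

section Minors

variable {R S : Type*} [CommRing R] [CommRing S]

/-- The coordinates of the bivector `a ∧ b`. -/
def minor (a b : Fin 4 → R) (i j : Fin 4) : R := a i * b j - a j * b i

/-- The coordinates of the trivector `a ∧ b ∧ c`. -/
def minor₃ (a b c : Fin 4 → R) (i j k : Fin 4) : R :=
  minor a b i j * c k + minor a b j k * c i + minor a b k i * c j

theorem map_minor (f : R →+* S) (a b : Fin 4 → R) (i j : Fin 4) :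
    f (minor a b i j) = minor (fun l => f (a l)) (fun l => f (b l)) i j := by
  simp [minor]

theorem map_minor₃ (f : R →+* S) (a b c : Fin 4 → R) (i j k : Fin 4) :
    f (minor₃ a b c i j k) =
      minor₃ (fun l => f (a l)) (fun l => f (b l)) (fun l => f (c l)) i j k := by
  simp [minor₃, map_minor]

variable {a b c : Fin 4 → ℂ}

theorem exists_eq_of_minor₃_eq_zero (hab : ∃ i j, minor a b i j ≠ 0)
    (h : ∀ i j k, minor₃ a b c i j k = 0) : ∃ x y : ℂ, ∀ k, c k = x * a k + y * b k := by
  obtain ⟨i, j, hij⟩ := hab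
  refine ⟨minor c b i j / minor a b i j, minor a c i j / minor a b i j, fun k => ?_⟩
  field_simp
  have := h i j k
  simp only [minor₃, minor] at this ⊢
  linear_combination this

theorem minor₃_eq_zero_of_mem_span (hc : c ∈ Submodule.span ℂ {a, b}) (i j k : Fin 4) :
    minor₃ a b c i j k = 0 := by
  obtain ⟨x, y, rfl⟩ := Submodule.mem_span_pair.mp hc
  simp only [minor₃, minor, Pi.add_apply, Pi.smul_apply, smul_eq_mul]
  ring

theorem exists_minor_ne_zero_iff :
    (∃ i j, minor a b i j ≠ 0) ↔ LinearIndependent ℂ ![a, b] := by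
  rw [LinearIndependent.pair_iff]
  constructor
  · rintro ⟨i, j, hij⟩ x y hxy
    have hi := congr_fun hxy i
    have hj := congr_fun hxy j
    simp only [Pi.add_apply, Pi.smul_apply, smul_eq_mul, Pi.zero_apply] at hi hj
    constructor
    · refine (mul_eq_zero.mp (?_ : x * minor a b i j = 0)).resolve_right hij
      simp only [minor]
      linear_combination b j * hi - b i * hj
    · refine (mul_eq_zero.mp (?_ : y * minor a b i j = 0)).resolve_right hij
      simp only [minor]
      linear_combination a i * hj - a j * hi
  · intro h
    by_contra! h0
    have ha : a = 0 := by
      funext i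
      by_contra hi
      refine hi (neg_eq_zero.mp (h (b i) (-a i) ?_).2)
      funext j
      have := h0 i j
      simp only [minor] at this
      simp only [Pi.add_apply, Pi.smul_apply, smul_eq_mul, Pi.zero_apply]
      linear_combination -this
    exact one_ne_zero (h 1 0 (by simp [ha])).1

/-- The Plücker coordinates of a plane do not depend on the basis, up to a common factor. -/
theorem minor_mul_minor_comm_of_span_eq {a' b' : Fin 4 → ℂ}
    (h : Submodule.span ℂ {a, b} = Submodule.span ℂ {a', b'}) (i j k l : Fin 4) :
    minor a b i j * minor a' b' k l = minor a b k l * minor a' b' i j := by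
  have ha : a ∈ Submodule.span ℂ {a', b'} := h ▸ Submodule.subset_span (by simp)
  have hb : b ∈ Submodule.span ℂ {a', b'} := h ▸ Submodule.subset_span (by simp)
  obtain ⟨x, y, rfl⟩ := Submodule.mem_span_pair.mp ha
  obtain ⟨z, w, rfl⟩ := Submodule.mem_span_pair.mp hb
  simp only [minor, Pi.add_apply, Pi.smul_apply, smul_eq_mul]
  ring

end Minors

theorem finite_of_polynomials {S : Set ℂ} {ι : Sort*} (P : ι → ℂ[X]) (hP : ∃ i, P i ≠ 0)
    (hS : ∀ z ∈ S, ∀ i, (P i).eval z = 0) : S.Finite := by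
  obtain ⟨i, hi⟩ := hP
  refine (P i).roots.toFinset.finite_toSet.subset fun z hz => ?_
  simpa [hi] using hS z hz i

/-! ### Immersed rational curves in an affine chart -/

/-- A quadruple `g` of polynomials of degree at most `d ≥ 1` which, as a quadruple of binary forms
of degree `d`, defines an immersion of the projective line: `g` and `g'` are linearly
independent at every point of the affine line, and so are the two leading coefficient vectors,
which is the same condition at infinity. -/
structure AffineImmersion (d : ℕ) (g : Fin 4 → ℂ[X]) : Prop where
  one_le : 1 ≤ d
  natDegree_le : ∀ i, (g i).natDegree ≤ d
  exists_minor : ∀ z, ∃ i j,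
    minor (fun l => (g l).eval z) (fun l => (derivative (g l)).eval z) i j ≠ 0
  exists_minor_infty : ∃ i j,
    minor (fun l => (g l).coeff d) (fun l => (g l).coeff (d - 1)) i j ≠ 0

namespace AffineImmersion

variable {d : ℕ} {g : Fin 4 → ℂ[X]}

theorem exists_coeff_ne_zero (hg : AffineImmersion d g) : ∃ i, (g i).coeff d ≠ 0 := by
  obtain ⟨i, j, hij⟩ := hg.exists_minor_infty
  by_contra! h
  exact hij (by simp [minor, h])

theorem exists_eval_ne_zero (hg : AffineImmersion d g) (z : ℂ) : ∃ i, (g i).eval z ≠ 0 := by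
  obtain ⟨i, j, hij⟩ := hg.exists_minor z
  by_contra! h
  exact hij (by simp [minor, h])

/-- The divided differences `(g i (s) g j (t) - g j (s) g i (t)) / (t - s)`, where `s = C X` and
`t = Y`. -/
theorem exists_divided_difference (hg : AffineImmersion d g) (i j : Fin 4) :
    ∃ h : ℂ[X][Y], C (g i) * (g j).map C - C (g j) * (g i).map C = (Y - C X) * h ∧
      h.natDegree ≤ d - 1 ∧ (Bivariate.swap h).natDegree ≤ d - 1 ∧
      (h.coeff (d - 1)).coeff (d - 1) =
        - minor (fun l => (g l).coeff d) (fun l => (g l).coeff (d - 1)) i j ∧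
      h.eval X = minor g (fun l => derivative (g l)) i j := by
  have hev : ∀ f : ℂ[X], (f.map C).eval X = f := fun f => by rw [eval_map, eval₂_C_X]
  have hroot : (C (g i) * (g j).map C - C (g j) * (g i).map C : ℂ[X][Y]).IsRoot X := by
    simp only [IsRoot.def, eval_sub, eval_mul, eval_C, hev]
    ring
  obtain ⟨h, hh⟩ := dvd_iff_isRoot.mpr hroot
  set P : ℂ[X][Y] := C (g i) * (g j).map C - C (g j) * (g i).map C with hP
  have hPd : P.natDegree ≤ d := by
    refine (natDegree_sub_le _ _).trans (max_le ?_ ?_) <;>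
    exact (natDegree_C_mul_le _ _).trans (natDegree_map_le.trans (hg.natDegree_le _))
  have hswap : Bivariate.swap P = -P := by
    simp only [hP, map_sub, map_mul, Bivariate.swap_C, Bivariate.swap_map_C]
    ring
  have hd := hg.one_le
  have hYX : (Y - C X : ℂ[X][Y]) ≠ 0 := X_sub_C_ne_zero _
  have hYX' : Bivariate.swap (Y - C X : ℂ[X][Y]) = -(Y - C X) := by
    rw [map_sub, Bivariate.swap_X, Bivariate.swap_Y]
    ring
  have hdeg : h.natDegree ≤ d - 1 := by
    by_cases h0 : h = 0
    · simp [h0]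
    · rw [hh, natDegree_mul hYX h0, natDegree_X_sub_C] at hPd
      omega
  refine ⟨h, hh, hdeg, ?_, ?_, ?_⟩
  · by_cases h0 : h = 0
    · simp [h0]
    · have h1 : (Bivariate.swap P).natDegree ≤ d := by rwa [hswap, natDegree_neg]
      rw [hh, natDegree_swap_mul hYX h0, hYX', natDegree_neg, natDegree_X_sub_C] at h1
      omega
  · have h1 : P.coeff d = h.coeff (d - 1) := by
      obtain ⟨e, rfl⟩ := Nat.exists_eq_add_of_le' hd
      rw [hh, sub_mul, coeff_sub, coeff_X_mul, coeff_C_mul,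
        coeff_eq_zero_of_natDegree_lt (p := h) (n := e + 1) (by omega)]
      simp
    rw [← h1, hP, minor]
    simp only [coeff_sub, coeff_C_mul, coeff_map, coeff_mul_C]
    ring
  · have h1 := congr_arg (fun p => (derivative p).eval X) hh
    simp only [hP, derivative_sub, derivative_mul, derivative_C, derivative_map, eval_sub,
      eval_add, eval_mul, eval_C, hev, derivative_X, eval_X, eval_zero, eval_one] at h1
    rw [minor]
    linear_combination -h1

/-- Only finitely many points of the affine line have the same image as another one. The divided
differences have no common factor, since they do not vanish simultaneously on the diagonal. -/
theorem finite_multiple (hg : AffineImmersion d g) :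
    {z : ℂ | ∃ t, t ≠ z ∧ ∀ i j,
      minor (fun l => (g l).eval z) (fun l => (g l).eval t) i j = 0}.Finite := by
  choose h hh hdeg hdeg' hcoeff hdiag using hg.exists_divided_difference
  obtain ⟨G, r, hr, hGr, hG⟩ := exists_C_mul_mem_and_dvd
    (Ideal.span (Set.range fun p : Fin 4 × Fin 4 => h p.1 p.2))
  have hGh : ∀ i j, G ∣ h i j := fun i j => hG _ (Ideal.subset_span ⟨(i, j), rfl⟩)
  have hhz : ∀ z i j, (h i j).evalEval z z =
      minor (fun l => (g l).eval z) (fun l => (derivative (g l)).eval z) i j := by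
    intro z i j
    rw [← eval_eval_X, hdiag]
    exact map_minor (evalRingHom z) _ _ i j
  obtain ⟨i, j, hij⟩ := hg.exists_minor_infty
  have hunit : IsUnit G := by
    refine isUnit_of_dvd_of_diagonal (hdeg i j) (hdeg' i j) ?_ (hGh i j) fun z hz => ?_
    · rw [hcoeff]
      exact neg_ne_zero.mpr hij
    · obtain ⟨k, l, hkl⟩ := hg.exists_minor z
      rw [← hhz] at hkl
      have := evalEval_dvd z z (hGh k l)
      rw [hz, zero_dvd_iff] at this
      exact hkl this
  refine finite_of_polynomials (fun _ : Unit => r) ⟨(), hr⟩ ?_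
  rintro z ⟨t, htz, ht⟩ -
  have hz : ∀ p ∈ Ideal.span (Set.range fun p : Fin 4 × Fin 4 => h p.1 p.2),
      evalEvalRingHom z t p = 0 := by
    intro p hp
    have : Ideal.span (Set.range fun p : Fin 4 × Fin 4 => h p.1 p.2) ≤
        RingHom.ker (evalEvalRingHom z t) := by
      rw [Ideal.span_le]
      rintro _ ⟨⟨k, l⟩, rfl⟩
      have h1 := congr_arg (evalEval z t) (hh k l)
      simp only [evalEval_sub, evalEval_mul, evalEval_C, evalEval_map_C, evalEval_X, eval_X] at h1
      have h2 := ht k l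
      rw [minor] at h2
      rw [h2, eq_comm] at h1
      exact (mul_eq_zero.mp h1).resolve_left (sub_ne_zero.mpr htz)
    exact this hp
  have h1 := hz _ hGr
  rw [map_mul] at h1
  have h2 := (hunit.map (evalEvalRingHom z t)).ne_zero
  simpa using (mul_eq_zero.mp h1).resolve_right h2

theorem finite_multiple_infty (hg : AffineImmersion d g) :
    {z : ℂ | ∀ i j,
      minor (fun l => (g l).eval z) (fun l => (g l).coeff d) i j = 0}.Finite := by
  obtain ⟨i, j, hij⟩ := hg.exists_minor_infty
  refine finite_of_polynomials
    (fun _ : Unit => g i * C ((g j).coeff d) - g j * C ((g i).coeff d)) ⟨(), fun h => hij ?_⟩ ?_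
  · have := congr_arg (fun p => p.coeff (d - 1)) h
    simp only [coeff_sub, coeff_mul_C, coeff_zero] at this
    rw [minor]
    linear_combination -this
  · intro z hz _
    simpa [minor] using hz i j

/-! ### Flexes and bitangents -/

/-- The coordinates of `g ∧ g'`, as binary forms of degree `2d - 2`, have values at infinity given
by the bivector of the two leading coefficient vectors. -/
theorem coeff_minor (hg : AffineImmersion d g) (i j : Fin 4) :
    (minor g (fun l => derivative (g l)) i j).coeff (2 * d - 2) =
      - minor (fun l => (g l).coeff d) (fun l => (g l).coeff (d - 1)) i j := by
  obtain ⟨h, -, h1, h2, h3, h4⟩ := hg.exists_divided_difference i j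
  rw [← h4, ← h3, ← coeff_eval_X h1 fun n => (natDegree_coeff_le_swap _ _).trans h2]
  congr 1
  have := hg.one_le
  omega

/-- A Plücker coordinate of the tangent lines that does not vanish at infinity has degree
`2d - 2 > 0`, so it vanishes at some other point. -/
theorem exists_root_minor (hg : AffineImmersion d g) (hd : 2 ≤ d) :
    ∃ k l z, minor (fun l => (g l).coeff d) (fun l => (g l).coeff (d - 1)) k l ≠ 0 ∧
      (minor g (fun l => derivative (g l)) k l).IsRoot z := by
  obtain ⟨k, l, hkl⟩ := hg.exists_minor_infty
  have h1 : (minor g (fun l => derivative (g l)) k l).coeff (2 * d - 2) ≠ 0 := by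
    rw [hg.coeff_minor]
    exact neg_ne_zero.mpr hkl
  have h2 : (minor g (fun l => derivative (g l)) k l).degree ≠ 0 := by
    intro h
    have := le_natDegree_of_ne_zero h1
    rw [natDegree_eq_zero_iff_degree_le_zero.mpr h.le] at this
    omega
  obtain ⟨z, hz⟩ := IsAlgClosed.exists_root _ h2
  exact ⟨k, l, z, hkl, hz⟩

/-- Only finitely many points are flexes, for otherwise the tangent line would be constant. -/
theorem finite_flexes (hg : AffineImmersion d g) (hd : 2 ≤ d) :
    {z : ℂ | ∀ i j k, minor₃ (fun l => (g l).eval z) (fun l => (derivative (g l)).eval z)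
      (fun l => (derivative (derivative (g l))).eval z) i j k = 0}.Finite := by
  refine finite_of_polynomials (fun p : Fin 4 × Fin 4 × Fin 4 => minor₃ g
    (fun l => derivative (g l)) (fun l => derivative (derivative (g l))) p.1 p.2.1 p.2.2) ?_ ?_
  swap
  · intro z hz p
    exact (map_minor₃ (evalRingHom z) _ _ _ _ _ _).trans (hz _ _ _)
  by_contra! h0
  obtain ⟨k, l, z, hkl, hz⟩ := hg.exists_root_minor hd
  obtain ⟨i, j, hij⟩ := hg.exists_minor z
  set w := minor g (fun l => derivative (g l)) with hw
  have hwz : ∀ i j y, (w i j).eval y =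
      minor (fun l => (g l).eval y) (fun l => (derivative (g l)).eval y) i j := fun i j y =>
    map_minor (evalRingHom y) _ _ _ _
  -- If all points were flexes, the bivector `w = g ∧ g'` would be proportional to its derivative.
  have hwronsk : derivative (w i j) * w k l = derivative (w k l) * w i j := by
    refine Polynomial.funext fun y => ?_
    obtain ⟨a, b, hab⟩ := exists_eq_of_minor₃_eq_zero (hg.exists_minor y)
      (c := fun l => (derivative (derivative (g l))).eval y) (fun i j k => by
        have h1 := congr_arg (eval y) (h0 (i, j, k))
        rw [eval_zero] at h1
        exact (map_minor₃ (evalRingHom y) _ _ _ _ _ _).symm.trans h1)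
    simp only [hw, minor, derivative_sub, derivative_mul, eval_mul, eval_sub, eval_add, hab]
    ring
  have hwkl : w k l ≠ 0 := by
    intro h
    have := hg.coeff_minor k l
    rw [← hw, h, coeff_zero, eq_comm, neg_eq_zero] at this
    exact hkl this
  have hij' : (w i j).eval z ≠ 0 := by rwa [hwz]
  have hwij : w i j ≠ 0 := fun h => hij' (by simp [h])
  have hwkl' : derivative (w k l) ≠ 0 := by
    intro h
    have h1 := eq_C_of_natDegree_le_zero (derivative_eq_zero.mp h).le
    rw [h1, IsRoot.def, eval_C] at hz
    exact hwkl (by rw [h1, hz, C_0])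
  have hne : derivative (w k l) * w i j ≠ 0 := mul_ne_zero hwkl' hwij
  -- Comparing multiplicities at a zero `z` of `w k l` at which `w` does not vanish.
  have h1 := rootMultiplicity_mul (x := z) hne
  rw [← hwronsk, rootMultiplicity_mul (by rwa [hwronsk]), derivative_rootMultiplicity_of_root hz,
    rootMultiplicity_eq_zero (p := w i j) hij'] at h1
  have h2 := (rootMultiplicity_pos hwkl).mpr hz
  omega

theorem exists_not_flex (hg : AffineImmersion d g) (hd : 2 ≤ d) :
    ∃ z i j k, minor₃ (fun l => (g l).eval z) (fun l => (derivative (g l)).eval z)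
      (fun l => (derivative (derivative (g l))).eval z) i j k ≠ 0 := by
  obtain ⟨z, hz⟩ := (hg.finite_flexes hd).exists_notMem
  simp only [Set.mem_ofPred_eq, not_forall] at hz
  exact ⟨z, hz⟩

theorem finite_bitangent_infty (hg : AffineImmersion d g) (hd : 2 ≤ d) :
    {z : ℂ | ∀ i j k l,
      minor (fun l => (g l).eval z) (fun l => (derivative (g l)).eval z) i j *
        minor (fun l => (g l).coeff d) (fun l => (g l).coeff (d - 1)) k l =
      minor (fun l => (g l).eval z) (fun l => (derivative (g l)).eval z) k l *
        minor (fun l => (g l).coeff d) (fun l => (g l).coeff (d - 1)) i j}.Finite := by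
  obtain ⟨k, l, z, hkl, hz⟩ := hg.exists_root_minor hd
  obtain ⟨i, j, hij⟩ := hg.exists_minor z
  set w := minor g (fun l => derivative (g l)) with hw
  have hwz : ∀ i j y, (w i j).eval y =
      minor (fun l => (g l).eval y) (fun l => (derivative (g l)).eval y) i j := fun i j y =>
    map_minor (evalRingHom y) _ _ _ _
  refine finite_of_polynomials (fun _ : Unit =>
    w i j * C (minor (fun l => (g l).coeff d) (fun l => (g l).coeff (d - 1)) k l) -
    w k l * C (minor (fun l => (g l).coeff d) (fun l => (g l).coeff (d - 1)) i j)) ⟨(), ?_⟩ ?_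
  · intro h
    have h1 := congr_arg (eval z) h
    rw [eval_sub, eval_mul, eval_mul, eval_C, eval_C, hz.eq_zero, zero_mul, sub_zero, hwz,
      eval_zero] at h1
    exact mul_ne_zero hij hkl h1
  · intro y hy _
    simp only [eval_sub, eval_mul, eval_C, hwz, hy i j k l, sub_self]

end AffineImmersion
end Halphen

namespace Halphen

open Polynomial Bivariate

namespace AffineImmersion

variable {d : ℕ} {g : Fin 4 → ℂ[X]}

/-- The partial derivative with respect to the inner variable. -/
noncomputable def derivativeInner (p : ℂ[X][Y]) : ℂ[X][Y] := swap (derivative (swap p))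

theorem derivativeInner_mul (p q : ℂ[X][Y]) :
    derivativeInner (p * q) = derivativeInner p * q + p * derivativeInner q := by
  simp only [derivativeInner, map_mul, derivative_mul, map_add, swap_swap_apply]

theorem derivativeInner_add (p q : ℂ[X][Y]) :
    derivativeInner (p + q) = derivativeInner p + derivativeInner q := by
  simp only [derivativeInner, map_add]

theorem derivativeInner_sub (p q : ℂ[X][Y]) :
    derivativeInner (p - q) = derivativeInner p - derivativeInner q := by
  simp only [derivativeInner, map_sub]

theorem derivativeInner_C (f : ℂ[X]) : derivativeInner (C f) = C (derivative f) := by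
  rw [derivativeInner, swap_C, derivative_map, swap_map_C]

theorem derivativeInner_map_C (f : ℂ[X]) : derivativeInner (f.map C) = 0 := by
  rw [derivativeInner, swap_map_C, derivative_C, map_zero]

/-- Let `G` be an irreducible factor of all the equations saying that `g(t)` and `g'(t)` lie in the
tangent line at `s`. Along the curve `G = 0` the tangent line at `s` contains `g(t)`;
differentiating this along the curve shows that `g(t)` also lies in the plane spanned by `g(s)` and
`g''(s)`. -/
theorem dvd_minor₃_of_irreducible {G : ℂ[X][Y]} (hG : Irreducible G) (hdeg : G.natDegree ≠ 0)
    (h₁ : ∀ i j k, G ∣ minor₃ (fun l => C (g l)) (fun l => C (derivative (g l)))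
      (fun l => (g l).map C) i j k)
    (h₂ : ∀ i j k, G ∣ minor₃ (fun l => C (g l)) (fun l => C (derivative (g l)))
      (fun l => (derivative (g l)).map C) i j k) (i j k : Fin 4) :
    G ∣ minor₃ (fun l => C (g l)) (fun l => C (derivative (derivative (g l))))
      (fun l => (g l).map C) i j k := by
  obtain ⟨K, hK⟩ := h₁ i j k
  have hGt : ¬ G ∣ derivative G := by
    intro h
    have h0 := eq_zero_of_dvd_of_degree_lt h (degree_derivative_lt hG.ne_zero)
    exact hdeg (derivative_eq_zero.mp h0)
  have hM₂ : derivative G * K + G * derivative K =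
      minor₃ (fun l => C (g l)) (fun l => C (derivative (g l)))
        (fun l => (derivative (g l)).map C) i j k := by
    rw [← derivative_mul, ← hK]
    simp only [minor₃, minor, derivative_add, derivative_sub, derivative_mul, derivative_C,
      derivative_map]
    ring
  have hN : derivativeInner G * K + G * derivativeInner K =
      minor₃ (fun l => C (g l)) (fun l => C (derivative (derivative (g l))))
        (fun l => (g l).map C) i j k := by
    rw [← derivativeInner_mul, ← hK]
    simp only [minor₃, minor, derivativeInner_add, derivativeInner_sub, derivativeInner_mul,
      derivativeInner_C, derivativeInner_map_C]
    ring
  have hGK : G ∣ K := by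
    have h3 : G ∣ derivative G * K := by
      have := h₂ i j k
      rw [← hM₂] at this
      exact (dvd_add_left (dvd_mul_right _ _)).mp this
    exact (hG.prime.dvd_or_dvd h3).resolve_left hGt
  rw [← hN]
  exact dvd_add (hGK.mul_left _) (dvd_mul_right _ _)

/-- Only finitely many tangent lines touch the curve at a second point. -/
theorem finite_bitangent (hg : AffineImmersion d g) (hd : 2 ≤ d) :
    {z : ℂ | ∃ t, t ≠ z ∧ ∀ i j k,
      minor₃ (fun l => (g l).eval z) (fun l => (derivative (g l)).eval z)
        (fun l => (g l).eval t) i j k = 0 ∧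
      minor₃ (fun l => (g l).eval z) (fun l => (derivative (g l)).eval z)
        (fun l => (derivative (g l)).eval t) i j k = 0}.Finite := by
  set M₁ : Fin 4 × Fin 4 × Fin 4 → ℂ[X][Y] := fun p => minor₃ (fun l => C (g l))
    (fun l => C (derivative (g l))) (fun l => (g l).map C) p.1 p.2.1 p.2.2 with hM₁
  set M₂ : Fin 4 × Fin 4 × Fin 4 → ℂ[X][Y] := fun p => minor₃ (fun l => C (g l))
    (fun l => C (derivative (g l))) (fun l => (derivative (g l)).map C) p.1 p.2.1 p.2.2 with hM₂
  obtain ⟨G, r, hr, hGr, hG⟩ := exists_C_mul_mem_and_dvd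
    (Ideal.span (Set.range M₁ ∪ Set.range M₂))
  have hG₁ : ∀ p, G ∣ M₁ p := fun p => hG _ (Ideal.subset_span (Or.inl ⟨p, rfl⟩))
  have hG₂ : ∀ p, G ∣ M₂ p := fun p => hG _ (Ideal.subset_span (Or.inr ⟨p, rfl⟩))
  have hev : ∀ z t, ∀ a b c : Fin 4 → ℂ[X], ∀ i j k,
      (minor₃ (fun l => C (a l)) (fun l => C (b l)) (fun l => (c l).map C) i j k).evalEval z t =
        minor₃ (fun l => (a l).eval z) (fun l => (b l).eval z) (fun l => (c l).eval t) i j k := by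
    intro z t a b c i j k
    refine (map_minor₃ (evalEvalRingHom z t) _ _ _ i j k).trans ?_
    simp only [coe_evalEvalRingHom, evalEval_C, evalEval_map_C]
  have hG0 : G ≠ 0 := by
    rintro rfl
    obtain ⟨z, i, j, k, hz⟩ := hg.exists_not_flex hd
    have h0 : M₁ (i, j, k) = 0 := zero_dvd_iff.mp (hG₁ _)
    have h1 : (derivative (derivative (M₁ (i, j, k)))).evalEval z z = minor₃
        (fun l => (g l).eval z) (fun l => (derivative (g l)).eval z)
        (fun l => (derivative (derivative (g l))).eval z) i j k := by
      rw [← hev]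
      congr 1
      simp only [hM₁, minor₃, minor, derivative_add, derivative_sub, derivative_mul, derivative_C,
        derivative_map, derivative_zero]
      ring
    rw [h0] at h1
    simp only [derivative_zero, evalEval_zero] at h1
    exact hz h1.symm
  -- The points of the correspondence on an irreducible component of its one-dimensional part.
  have hcomp : ∀ P : ℂ[X][Y], Irreducible P → P ∣ G →
      {z : ℂ | ∃ t, t ≠ z ∧ (∀ p, (M₁ p).evalEval z t = 0) ∧ P.evalEval z t = 0}.Finite := by
    intro P hP hPG
    by_cases hdeg : P.natDegree = 0
    · refine finite_of_polynomials (fun _ : Unit => P.coeff 0) ⟨(), fun h => hP.ne_zero ?_⟩ ?_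
      · rw [eq_C_of_natDegree_eq_zero hdeg, h, C_0]
      · rintro z ⟨t, -, -, ht⟩ -
        rwa [eq_C_of_natDegree_eq_zero hdeg, evalEval_C] at ht
    · refine (hg.finite_multiple.union (hg.finite_flexes hd)).subset ?_
      rintro z ⟨t, htz, ht, hPt⟩
      by_contra hz
      simp only [Set.mem_union, Set.mem_ofPred_eq, not_or, not_exists, not_and] at hz
      apply hz.1 t htz
      obtain ⟨a, b, hab⟩ := exists_eq_of_minor₃_eq_zero (hg.exists_minor z) (fun i j k => by
        rw [← hev]
        exact ht (i, j, k))
      have hb : b = 0 := by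
        by_contra hb
        apply hz.2
        intro i j k
        have h1 := dvd_minor₃_of_irreducible hP hdeg
          (fun i j k => hPG.trans (hG₁ (i, j, k))) (fun i j k => hPG.trans (hG₂ (i, j, k))) i j k
        have h2 := evalEval_dvd z t h1
        rw [hPt, zero_dvd_iff, hev] at h2
        refine (mul_eq_zero.mp (?_ : b * _ = 0)).resolve_left hb
        simp only [minor₃, minor, hab] at h2 ⊢
        linear_combination -h2
      intro i j
      simp only [minor, hab, hb]
      ring
  obtain hfac := UniqueFactorizationMonoid.factors_prod hG0
  refine ((finite_of_polynomials (S := {z | r.eval z = 0}) (fun _ : Unit => r) ⟨(), hr⟩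
    fun z hz _ => hz).union ((UniqueFactorizationMonoid.factors G).toFinset.finite_toSet.biUnion
      fun P hP => hcomp P (UniqueFactorizationMonoid.irreducible_of_factor P (by simpa using hP))
        (UniqueFactorizationMonoid.dvd_of_mem_factors (by simpa using hP)))).subset ?_
  rintro z ⟨t, htz, ht⟩
  have hker : Ideal.span (Set.range M₁ ∪ Set.range M₂) ≤ RingHom.ker (evalEvalRingHom z t) := by
    rw [Ideal.span_le]
    rintro _ (⟨p, rfl⟩ | ⟨p, rfl⟩)
    · exact (hev _ _ _ _ _ _ _ _).trans (ht _ _ _).1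
    · exact (hev _ _ _ _ _ _ _ _).trans (ht _ _ _).2
  have hz := hker hGr
  rw [RingHom.mem_ker, map_mul] at hz
  rcases mul_eq_zero.mp hz with hz | hz
  · exact Or.inl (by simpa using hz)
  · obtain ⟨u, hu⟩ := hfac
    rw [← hu, map_mul, map_multiset_prod] at hz
    have h3 := (mul_eq_zero.mp hz).resolve_right ((u.isUnit.map (evalEvalRingHom z t)).ne_zero)
    obtain ⟨P, hP, hPz⟩ := Multiset.mem_map.mp (Multiset.prod_eq_zero_iff.mp h3)
    refine Or.inr (Set.mem_biUnion (x := P) (by simpa using hP) ⟨t, htz, fun p => ?_, hPz⟩)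
    exact (hev _ _ _ _ _ _ _ _).trans (ht _ _ _).1

end AffineImmersion
end Halphen

namespace Halphen

open Polynomial

/-! ### Binary forms and the affine chart -/

theorem sum_eq_of_mem_support {σ : Type} [Fintype σ] {F : MvPolynomial σ ℂ} {n : ℕ}
    (hF : F.IsHomogeneous n) {m : σ →₀ ℕ} (hm : m ∈ F.support) : ∑ i, m i = n := by
  rw [hF.degree_eq_sum_deg_support hm]
  exact (Finset.sum_subset (Finset.subset_univ _) (by simp)).symm

theorem eval_smul_of_isHomogeneous {σ : Type} [Fintype σ] {F : MvPolynomial σ ℂ} {n : ℕ}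
    (hF : F.IsHomogeneous n) (c : ℂ) (s : σ → ℂ) :
    MvPolynomial.eval (c • s) F = c ^ n * MvPolynomial.eval s F := by
  rw [MvPolynomial.eval_eq', MvPolynomial.eval_eq', Finset.mul_sum]
  refine Finset.sum_congr rfl fun m hm => ?_
  have hn := sum_eq_of_mem_support hF hm
  simp only [Pi.smul_apply, smul_eq_mul, mul_pow, Finset.prod_mul_distrib,
    Finset.prod_pow_eq_pow_sum, hn]
  ring

/-- Dehomogenization of binary forms, in the chart `v = 1`. -/
noncomputable def dehom : MvPolynomial (Fin 2) ℂ →ₐ[ℂ] ℂ[X] := MvPolynomial.aeval ![X, 1]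

theorem eval_dehom (F : MvPolynomial (Fin 2) ℂ) (z : ℂ) :
    (dehom F).eval z = MvPolynomial.eval ![z, 1] F := by
  induction F using MvPolynomial.induction_on with
  | C a => simp [dehom]
  | add p q hp hq => simp [hp, hq]
  | mul_X p i hp =>
    rw [map_mul, eval_mul, hp, map_mul, MvPolynomial.eval_X]
    fin_cases i <;> simp [dehom]

theorem derivative_dehom (F : MvPolynomial (Fin 2) ℂ) :
    derivative (dehom F) = dehom (MvPolynomial.pderiv 0 F) := by
  induction F using MvPolynomial.induction_on with
  | C a => simp [dehom]
  | add p q hp hq => simp [hp, hq]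
  | mul_X p i hp =>
    rw [map_mul, derivative_mul, hp, MvPolynomial.pderiv_mul, map_add, map_mul, map_mul]
    fin_cases i <;> simp [dehom, MvPolynomial.pderiv_X]

section Homogeneous

variable {F : MvPolynomial (Fin 2) ℂ} {d : ℕ}

theorem dehom_eq_sum (F : MvPolynomial (Fin 2) ℂ) :
    dehom F = ∑ m ∈ F.support, C (F.coeff m) * X ^ m 0 := by
  rw [dehom, MvPolynomial.aeval_def, MvPolynomial.eval₂_eq']
  simp [Fin.prod_univ_two]

theorem natDegree_dehom_le (hF : F.IsHomogeneous d) : (dehom F).natDegree ≤ d := by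
  rw [dehom_eq_sum]
  refine natDegree_sum_le_of_forall_le _ _ fun m hm => (natDegree_C_mul_X_pow_le _ _).trans ?_
  have h := sum_eq_of_mem_support hF hm
  rw [Fin.sum_univ_two] at h
  omega

/-- The coefficient of degree `d` is the value at infinity. -/
theorem coeff_dehom (hF : F.IsHomogeneous d) :
    (dehom F).coeff d = MvPolynomial.eval ![1, 0] F := by
  rw [dehom_eq_sum, finsetSum_coeff, MvPolynomial.eval_eq']
  refine Finset.sum_congr rfl fun m hm => ?_
  have h := sum_eq_of_mem_support hF hm
  rw [Fin.sum_univ_two] at h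
  rw [coeff_C_mul_X_pow]
  by_cases h1 : m 1 = 0
  · simp [Fin.prod_univ_two, h1, show d = m 0 by omega]
  · simp [Fin.prod_univ_two, h1, show d ≠ m 0 by omega]

theorem euler_eval (hF : F.IsHomogeneous d) (s : Fin 2 → ℂ) :
    s 0 * MvPolynomial.eval s (MvPolynomial.pderiv 0 F) +
      s 1 * MvPolynomial.eval s (MvPolynomial.pderiv 1 F) = d * MvPolynomial.eval s F := by
  have h := congr_arg (MvPolynomial.eval s) hF.sum_X_mul_pderiv
  simpa [Fin.sum_univ_two] using h

theorem dehom_pderiv_one (hF : F.IsHomogeneous d) :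
    dehom (MvPolynomial.pderiv 1 F) = C (d : ℂ) * dehom F - X * derivative (dehom F) := by
  refine Polynomial.funext fun z => ?_
  have h := euler_eval hF ![z, 1]
  simp only [eval_sub, eval_mul, eval_C, eval_X, derivative_dehom, eval_dehom]
  simp only [Matrix.cons_val_zero, Matrix.cons_val_one] at h
  linear_combination h

theorem eval_pderiv_zero_infty (hF : F.IsHomogeneous d) :
    MvPolynomial.eval ![1, 0] (MvPolynomial.pderiv 0 F) = d * (dehom F).coeff d := by
  have h := euler_eval hF ![1, 0]
  rw [coeff_dehom hF]
  simpa using h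

theorem eval_pderiv_one_infty (hF : F.IsHomogeneous d) (hd : 1 ≤ d) :
    MvPolynomial.eval ![1, 0] (MvPolynomial.pderiv 1 F) = (dehom F).coeff (d - 1) := by
  rw [← coeff_dehom hF.pderiv, dehom_pderiv_one hF]
  obtain ⟨e, rfl⟩ := Nat.exists_eq_add_of_le' hd
  rw [Nat.add_sub_cancel, coeff_sub, coeff_C_mul]
  rcases e with _ | e
  · simp
  · rw [coeff_X_mul, coeff_derivative]
    push_cast
    ring

end Homogeneous

/-- Every point of the projective line is in the affine chart or is the point at infinity. -/
theorem exists_smul_chart {s : Fin 2 → ℂ} (hs : s ≠ 0) :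
    ∃ c : ℂ, c ≠ 0 ∧ ((∃ z : ℂ, s = c • ![z, 1]) ∨ s = c • ![1, 0]) := by
  by_cases h1 : s 1 = 0
  · have h0 : s 0 ≠ 0 := by
      intro h0
      apply hs
      funext i
      fin_cases i <;> simpa
    refine ⟨s 0, h0, Or.inr ?_⟩
    funext i
    fin_cases i <;> simp [h1]
  · refine ⟨s 1, h1, Or.inl ⟨s 0 / s 1, ?_⟩⟩
    funext i
    fin_cases i
    · simp [mul_div_cancel₀ _ h1]
    · simp

theorem chart_ne_zero (z : ℂ) : (![z, 1] : Fin 2 → ℂ) ≠ 0 := fun h => by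
  simpa using congr_fun h 1

theorem infty_ne_zero : (![1, 0] : Fin 2 → ℂ) ≠ 0 := fun h => by
  simpa using congr_fun h 0

/-! ### Immersed rational curves -/

/-- The partial derivative of `γ` with respect to the `k`-th variable, at `s`. -/
noncomputable def paramDeriv (γ : Fin 4 → MvPolynomial (Fin 2) ℂ) (k : Fin 2) (s : Fin 2 → ℂ) :
    Fin 4 → ℂ :=
  fun i => MvPolynomial.eval s (MvPolynomial.pderiv k (γ i))

/-- The (cone over the) tangent line of the parametrized curve `γ` at `s`. -/
noncomputable def tangentSpan (γ : Fin 4 → MvPolynomial (Fin 2) ℂ) (s : Fin 2 → ℂ) :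
    Submodule ℂ (Fin 4 → ℂ) :=
  Submodule.span ℂ {paramDeriv γ 0 s, paramDeriv γ 1 s}

/-- `γ` is a quadruple of binary forms of degree `d ≥ 1` and the bivector of its partial derivatives
vanishes nowhere, so that `γ` is an immersion of the projective line into projective space. -/
structure Immersion (d : ℕ) (γ : Fin 4 → MvPolynomial (Fin 2) ℂ) : Prop where
  one_le : 1 ≤ d
  isHomogeneous : ∀ i, (γ i).IsHomogeneous d
  exists_minor : ∀ s : Fin 2 → ℂ, s ≠ 0 → ∃ i j, minor (paramDeriv γ 0 s) (paramDeriv γ 1 s) i j ≠ 0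

namespace Immersion

variable {d : ℕ} {γ : Fin 4 → MvPolynomial (Fin 2) ℂ}

theorem cast_ne_zero (hγ : Immersion d γ) : (d : ℂ) ≠ 0 := by
  have := hγ.one_le
  exact_mod_cast (by omega : d ≠ 0)

theorem euler (hγ : Immersion d γ) (s : Fin 2 → ℂ) (i : Fin 4) :
    s 0 * paramDeriv γ 0 s i + s 1 * paramDeriv γ 1 s i = d * paramEval γ s i :=
  euler_eval (hγ.isHomogeneous i) s

theorem paramEval_ne_zero (hγ : Immersion d γ) {s : Fin 2 → ℂ} (hs : s ≠ 0) :
    paramEval γ s ≠ 0 := by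
  intro h
  obtain ⟨i, j, hij⟩ := hγ.exists_minor s hs
  have hi := hγ.euler s i
  have hj := hγ.euler s j
  rw [h, Pi.zero_apply, mul_zero] at hi hj
  obtain ⟨k, hk⟩ := Function.ne_iff.mp hs
  refine mul_ne_zero hk hij ?_
  rw [minor]
  fin_cases k
  · simp only [Fin.zero_eta, Fin.isValue]
    linear_combination paramDeriv γ 1 s j * hi - paramDeriv γ 1 s i * hj
  · simp only [Fin.mk_one, Fin.isValue]
    linear_combination paramDeriv γ 0 s i * hj - paramDeriv γ 0 s j * hi

theorem isMorphismOfDegree (hγ : Immersion d γ) : IsMorphismOfDegree d γ :=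
  ⟨hγ.isHomogeneous, fun _ => hγ.paramEval_ne_zero⟩

theorem paramEval_smul (hγ : Immersion d γ) (c : ℂ) (s : Fin 2 → ℂ) :
    paramEval γ (c • s) = c ^ d • paramEval γ s := by
  funext i
  exact eval_smul_of_isHomogeneous (hγ.isHomogeneous i) c s

theorem paramDeriv_smul (hγ : Immersion d γ) (k : Fin 2) (c : ℂ) (s : Fin 2 → ℂ) :
    paramDeriv γ k (c • s) = c ^ (d - 1) • paramDeriv γ k s := by
  funext i
  exact eval_smul_of_isHomogeneous (hγ.isHomogeneous i).pderiv c s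

theorem tangentSpan_smul (hγ : Immersion d γ) {c : ℂ} (hc : c ≠ 0) (s : Fin 2 → ℂ) :
    tangentSpan γ (c • s) = tangentSpan γ s := by
  have hu : IsUnit (c ^ (d - 1)) := (pow_ne_zero _ hc).isUnit
  rw [tangentSpan, hγ.paramDeriv_smul, hγ.paramDeriv_smul, tangentSpan,
    Submodule.span_insert, Submodule.span_insert, Submodule.span_singleton_smul_eq hu,
    Submodule.span_singleton_smul_eq hu]

theorem finrank_tangentSpan (hγ : Immersion d γ) {s : Fin 2 → ℂ} (hs : s ≠ 0) :
    Module.finrank ℂ (tangentSpan γ s) = 2 := by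
  have h := exists_minor_ne_zero_iff.mp (hγ.exists_minor s hs)
  have h2 := finrank_span_eq_card h
  rwa [Fintype.card_fin, Matrix.range_cons_cons_empty] at h2

theorem paramEval_mem_tangentSpan (hγ : Immersion d γ) (s : Fin 2 → ℂ) :
    paramEval γ s ∈ tangentSpan γ s := by
  refine Submodule.mem_span_pair.mpr ⟨s 0 / d, s 1 / d, ?_⟩
  funext i
  have h := hγ.euler s i
  have := hγ.cast_ne_zero
  simp only [Pi.add_apply, Pi.smul_apply, smul_eq_mul]
  field_simp
  linear_combination h

theorem paramEval_chart (z : ℂ) :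
    paramEval γ ![z, 1] = fun l => (dehom (γ l)).eval z := by
  funext i
  exact (eval_dehom _ _).symm

theorem paramEval_infty (hγ : Immersion d γ) :
    paramEval γ ![1, 0] = fun l => (dehom (γ l)).coeff d := by
  funext i
  exact (coeff_dehom (hγ.isHomogeneous i)).symm

theorem paramDeriv_zero_chart (z : ℂ) :
    paramDeriv γ 0 ![z, 1] = fun l => (derivative (dehom (γ l))).eval z := by
  funext i
  rw [derivative_dehom, eval_dehom, paramDeriv]

theorem affineImmersion (hγ : Immersion d γ) : AffineImmersion d fun i => dehom (γ i) where
  one_le := hγ.one_le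
  natDegree_le i := natDegree_dehom_le (hγ.isHomogeneous i)
  exists_minor z := by
    obtain ⟨i, j, hij⟩ := hγ.exists_minor _ (chart_ne_zero z)
    refine ⟨i, j, fun h => hij ?_⟩
    rw [← paramEval_chart, ← paramDeriv_zero_chart] at h
    have hi := hγ.euler ![z, 1] i
    have hj := hγ.euler ![z, 1] j
    simp only [Matrix.cons_val_zero, Matrix.cons_val_one, one_mul] at hi hj
    simp only [minor] at h ⊢
    linear_combination -(d : ℂ) * h + paramDeriv γ 0 ![z, 1] i * hj -
      paramDeriv γ 0 ![z, 1] j * hi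
  exists_minor_infty := by
    obtain ⟨i, j, hij⟩ := hγ.exists_minor _ infty_ne_zero
    refine ⟨i, j, fun h => hij ?_⟩
    simp only [minor, paramDeriv, eval_pderiv_zero_infty (hγ.isHomogeneous _),
      eval_pderiv_one_infty (hγ.isHomogeneous _) hγ.one_le] at h ⊢
    linear_combination (d : ℂ) * h

theorem paramDeriv_zero_mem (s : Fin 2 → ℂ) : paramDeriv γ 0 s ∈ tangentSpan γ s :=
  Submodule.subset_span (by simp)

/-- In the affine chart, the tangent line is spanned by the point and the derivative. -/
theorem tangentSpan_chart (hγ : Immersion d γ) (z : ℂ) :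
    tangentSpan γ ![z, 1] = Submodule.span ℂ {paramEval γ ![z, 1], paramDeriv γ 0 ![z, 1]} := by
  apply le_antisymm
  · rw [tangentSpan, Submodule.span_le]
    rintro _ (rfl | rfl)
    · exact Submodule.subset_span (by simp)
    · refine Submodule.mem_span_pair.mpr ⟨d, -z, ?_⟩
      funext i
      have h := hγ.euler ![z, 1] i
      simp only [Matrix.cons_val_zero, Matrix.cons_val_one, one_mul] at h
      simp only [Pi.add_apply, Pi.smul_apply, smul_eq_mul]
      linear_combination -h
  · rw [Submodule.span_le]
    rintro _ (rfl | rfl)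
    · exact hγ.paramEval_mem_tangentSpan _
    · exact paramDeriv_zero_mem _

end Immersion

/-- Membership in the image curve, in terms of the chosen representative vector. -/
theorem mem_curveImage_iff {γ : Fin 4 → MvPolynomial (Fin 2) ℂ} {p : P3} :
    p ∈ curveImage γ ↔ ∃ s : Fin 2 → ℂ, s ≠ 0 ∧ ∃ c : ℂ, c ≠ 0 ∧ p.rep = c • paramEval γ s := by
  constructor
  · rintro ⟨s, hs, h, rfl⟩
    obtain ⟨a, ha⟩ := Projectivization.exists_smul_eq_mk_rep ℂ (paramEval γ s) h
    exact ⟨s, hs, a, a.ne_zero, ha.symm⟩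
  · rintro ⟨s, hs, c, hc, h⟩
    have h0 : paramEval γ s ≠ 0 := fun h0 => p.rep_nonzero (by rw [h, h0, smul_zero])
    refine ⟨s, hs, h0, ?_⟩
    rw [← p.mk_rep, Projectivization.mk_eq_mk_iff']
    exact ⟨c, h.symm⟩

end Halphen

namespace Halphen

open Polynomial

/-! ### Implicit equations from resultants -/

/-- Linear forms vanishing on `V` but at no point of a finite set outside of `V`. -/
theorem exists_dual_forall_ne_zero (V : Submodule ℂ (Fin 4 → ℂ)) {S : Set (Fin 4 → ℂ)}
    (hS : S.Finite) (h : ∀ y ∈ S, y ∉ V) :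
    ∃ a : (Fin 4 → ℂ) →ₗ[ℂ] ℂ, (∀ v ∈ V, a v = 0) ∧ ∀ y ∈ S, a y ≠ 0 := by
  induction S, hS using Set.Finite.induction_on with
  | empty => exact ⟨0, by simp, by simp⟩
  | @insert y S _ hS ih =>
    obtain ⟨a, haV, haS⟩ := ih fun y hy => h y (Set.mem_insert_of_mem _ hy)
    obtain ⟨f, hfy, hfV⟩ := Submodule.exists_le_ker_of_notMem (h y (Set.mem_insert _ _))
    obtain ⟨t, ht⟩ := ((hS.insert y).image fun x => -a x / f x).exists_notMem
    simp only [Set.mem_image, not_exists, not_and] at ht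
    refine ⟨a + t • f, fun v hv => ?_, fun x hx h0 => ?_⟩
    · have h1 : f v = 0 := hfV hv
      simp [haV v hv, h1]
    · simp only [LinearMap.add_apply, LinearMap.smul_apply, smul_eq_mul] at h0
      by_cases hfx : f x = 0
      · rcases hx with rfl | hx
        · exact hfy hfx
        · rw [hfx, mul_zero, add_zero] at h0
          exact haS x hx h0
      · refine ht x hx ?_
        field_simp
        linear_combination -h0

/-- A linear form as a polynomial. -/
noncomputable def linearForm (a : (Fin 4 → ℂ) →ₗ[ℂ] ℂ) : MvPolynomial (Fin 4) ℂ :=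
  ∑ i, MvPolynomial.C (a (Pi.single i 1)) * MvPolynomial.X i

/-- The composition of a linear form with a quadruple of polynomials. -/
noncomputable def pullback (a : (Fin 4 → ℂ) →ₗ[ℂ] ℂ) (g : Fin 4 → ℂ[X]) : ℂ[X] :=
  ∑ i, C (a (Pi.single i 1)) * g i

theorem dual_apply (a : (Fin 4 → ℂ) →ₗ[ℂ] ℂ) (v : Fin 4 → ℂ) :
    ∑ i, a (Pi.single i 1) * v i = a v := by
  conv_rhs => rw [a.pi_apply_eq_sum_univ v]
  refine Finset.sum_congr rfl fun i _ => ?_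
  rw [smul_eq_mul, mul_comm]
  congr 2
  funext j
  simp [Pi.single_apply, eq_comm]

theorem eval_linearForm (a : (Fin 4 → ℂ) →ₗ[ℂ] ℂ) (v : Fin 4 → ℂ) :
    MvPolynomial.eval v (linearForm a) = a v := by
  simp [linearForm, dual_apply]

theorem isHomogeneous_linearForm (a : (Fin 4 → ℂ) →ₗ[ℂ] ℂ) : (linearForm a).IsHomogeneous 1 :=
  MvPolynomial.IsHomogeneous.sum _ _ _ fun i _ => MvPolynomial.isHomogeneous_C_mul_X _ i

section Pullback

variable (a : (Fin 4 → ℂ) →ₗ[ℂ] ℂ) (g : Fin 4 → ℂ[X])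

theorem eval_pullback (z : ℂ) : (pullback a g).eval z = a fun l => (g l).eval z := by
  simp [pullback, eval_finsetSum, dual_apply a fun l => (g l).eval z]

theorem coeff_pullback (n : ℕ) : (pullback a g).coeff n = a fun l => (g l).coeff n := by
  simp [pullback, dual_apply a fun l => (g l).coeff n]

theorem derivative_pullback : derivative (pullback a g) = pullback a fun l => derivative (g l) := by
  simp [pullback]

theorem natDegree_pullback_le {g : Fin 4 → ℂ[X]} {d : ℕ} (hg : ∀ i, (g i).natDegree ≤ d) :
    (pullback a g).natDegree ≤ d :=
  natDegree_sum_le_of_forall_le _ _ fun i _ => (natDegree_C_mul_le _ _).trans (hg i)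

end Pullback

theorem isHomogeneous_det {n : ℕ} (M : Matrix (Fin n) (Fin n) (MvPolynomial (Fin 4) ℂ))
    (hM : ∀ i j, (M i j).IsHomogeneous 1) : M.det.IsHomogeneous n := by
  rw [Matrix.det_apply]
  refine MvPolynomial.IsHomogeneous.sum _ _ _ fun σ _ => ?_
  have h : (∏ i, M (σ i) i).IsHomogeneous n := by
    have := MvPolynomial.IsHomogeneous.prod Finset.univ (fun i => M (σ i) i) (fun _ => 1)
      fun i _ => hM _ _
    simpa using this
  rcases Int.units_eq_one_or (Equiv.Perm.sign σ) with h1 | h1 <;> rw [h1]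
  · simpa using h
  · simpa using h.neg

/-- The equation, in the unknown `x`, saying that the binary forms `a(x) b(g) - b(x) a(g)` and
`a(x) c(g) - c(x) a(g)` of degree `d` have a common zero. -/
noncomputable def implicitForm (d : ℕ) (g : Fin 4 → ℂ[X]) (a b c : (Fin 4 → ℂ) →ₗ[ℂ] ℂ) :
    MvPolynomial (Fin 4) ℂ :=
  resultant
    (C (linearForm a) * (pullback b g).map MvPolynomial.C -
      C (linearForm b) * (pullback a g).map MvPolynomial.C)
    (C (linearForm a) * (pullback c g).map MvPolynomial.C -
      C (linearForm c) * (pullback a g).map MvPolynomial.C) d d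

section ImplicitForm

variable {d : ℕ} {g : Fin 4 → ℂ[X]} (a b c : (Fin 4 → ℂ) →ₗ[ℂ] ℂ)

theorem isHomogeneous_implicitForm : (implicitForm d g a b c).IsHomogeneous (d + d) := by
  have hcoeff : ∀ (b : (Fin 4 → ℂ) →ₗ[ℂ] ℂ) (n : ℕ),
      ((C (linearForm a) * (pullback b g).map MvPolynomial.C -
        C (linearForm b) * (pullback a g).map MvPolynomial.C :
        (MvPolynomial (Fin 4) ℂ)[X]).coeff n).IsHomogeneous 1 := by
    intro b n
    rw [coeff_sub, coeff_C_mul, coeff_C_mul, coeff_map, coeff_map]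
    exact ((isHomogeneous_linearForm a).mul (MvPolynomial.isHomogeneous_C _ _)).sub
      ((isHomogeneous_linearForm b).mul (MvPolynomial.isHomogeneous_C _ _))
  refine isHomogeneous_det _ fun i j => ?_
  rw [sylvester, Matrix.of_apply]
  refine Fin.addCases (fun j => ?_) (fun j => ?_) j
  · rw [Fin.addCases_left]
    split_ifs
    exacts [hcoeff c _, MvPolynomial.isHomogeneous_zero _ _ _]
  · rw [Fin.addCases_right]
    split_ifs
    exacts [hcoeff b _, MvPolynomial.isHomogeneous_zero _ _ _]

theorem eval_implicitForm (x : Fin 4 → ℂ) :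
    MvPolynomial.eval x (implicitForm d g a b c) =
      resultant (C (a x) * pullback b g - C (b x) * pullback a g)
        (C (a x) * pullback c g - C (c x) * pullback a g) d d := by
  have hid : (MvPolynomial.eval x).comp (MvPolynomial.C : ℂ →+* MvPolynomial (Fin 4) ℂ) =
      RingHom.id ℂ := by
    ext; simp
  have hmap : ∀ b : (Fin 4 → ℂ) →ₗ[ℂ] ℂ, (C (linearForm a) * (pullback b g).map MvPolynomial.C -
      C (linearForm b) * (pullback a g).map MvPolynomial.C :
        (MvPolynomial (Fin 4) ℂ)[X]).map (MvPolynomial.eval x) =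
      C (a x) * pullback b g - C (b x) * pullback a g := by
    intro b
    simp only [Polynomial.map_sub, Polynomial.map_mul, map_C, Polynomial.map_map, hid,
      Polynomial.map_id, eval_linearForm]
  rw [implicitForm, ← resultant_map_map, hmap, hmap]

theorem natDegree_combination_le (hg : ∀ i, (g i).natDegree ≤ d) (x y : ℂ) :
    (C x * pullback b g - C y * pullback a g).natDegree ≤ d :=
  (natDegree_sub_le _ _).trans (max_le
    ((natDegree_C_mul_le _ _).trans (natDegree_pullback_le _ hg))
    ((natDegree_C_mul_le _ _).trans (natDegree_pullback_le _ hg)))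

variable {γ : Fin 4 → MvPolynomial (Fin 2) ℂ}

theorem Immersion.vanishesOn_implicitForm (hγ : Immersion d γ) :
    VanishesOn (implicitForm d (fun i => dehom (γ i)) a b c) (curveImage γ) := by
  refine ⟨⟨_, isHomogeneous_implicitForm a b c⟩, fun p hp => ?_⟩
  obtain ⟨s, hs, k, -, hk⟩ := mem_curveImage_iff.mp hp
  have hdeg := hγ.affineImmersion.natDegree_le
  have hd := hγ.one_le
  obtain ⟨l, -, ⟨z, rfl⟩ | rfl⟩ := exists_smul_chart hs
  · rw [hγ.paramEval_smul, Immersion.paramEval_chart] at hk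
    rw [eval_implicitForm]
    obtain ⟨P, Q, -, -, hPQ⟩ := exists_mul_add_mul_eq_C_resultant _ _
      (natDegree_combination_le a b hdeg (a p.rep) (b p.rep))
      (natDegree_combination_le a c hdeg (a p.rep) (c p.rep)) (Or.inl (by omega))
    have h := congr_arg (eval z) hPQ
    rw [eval_C] at h
    rw [← h]
    simp only [eval_add, eval_mul, eval_sub, eval_C, eval_pullback, hk, map_smul, smul_eq_mul]
    ring
  · rw [hγ.paramEval_smul, hγ.paramEval_infty] at hk
    rw [eval_implicitForm]
    have h : ∀ b : (Fin 4 → ℂ) →ₗ[ℂ] ℂ, (C (a p.rep) * pullback b (fun i => dehom (γ i)) -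
        C (b p.rep) * pullback a (fun i => dehom (γ i))).natDegree < d := by
      intro b
      refine lt_of_le_of_ne (natDegree_combination_le a b hdeg _ _) fun h => ?_
      have h0 : (C (a p.rep) * pullback b (fun i => dehom (γ i)) -
          C (b p.rep) * pullback a (fun i => dehom (γ i))).coeff d = 0 := by
        simp only [coeff_sub, coeff_C_mul, coeff_pullback, hk, map_smul, smul_eq_mul]
        ring
      have h1 := leadingCoeff_eq_zero.mp ((congr_arg _ h).trans h0)
      rw [h1, natDegree_zero] at h
      omega
    exact resultant_eq_zero_of_lt_lt _ _ _ _ (h b) (h c)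

/-- On a line `x + ε w` such that `b` vanishes at `x` and `w`, `a` at `w` and `c` at `x`, the
implicit equation splits into linear factors indexed by the zeros of `b ∘ g`. -/
theorem eval_implicitForm_line (hg : ∀ i, (g i).natDegree ≤ d)
    (hb : b (fun l => (g l).coeff d) ≠ 0) {x w : Fin 4 → ℂ} (hax : a x ≠ 0) (haw : a w = 0)
    (hbx : b x = 0) (hbw : b w = 0) (hcx : c x = 0) (ε : ℂ) :
    MvPolynomial.eval (x + ε • w) (implicitForm d g a b c) =
      (a x * (pullback b g).leadingCoeff) ^ d * ((pullback b g).roots.map fun r =>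
        a x * c (fun l => (g l).eval r) - ε * (c w * a fun l => (g l).eval r)).prod := by
  have hne : (pullback b g).coeff d ≠ 0 := by rwa [coeff_pullback]
  have hd : (C (a x) * pullback b g).natDegree = d := by
    rw [natDegree_C_mul hax]
    exact le_antisymm (natDegree_pullback_le b hg) (le_natDegree_of_ne_zero hne)
  have h := resultant_eq_prod_eval (C (a x) * pullback b g)
    (C (a x) * pullback c g - C (ε * c w) * pullback a g) d
    (natDegree_combination_le a c hg _ _) (IsAlgClosed.splits _)
  rw [hd, leadingCoeff_mul, leadingCoeff_C, roots_C_mul _ hax] at h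
  have ha' : a (x + ε • w) = a x := by simp [haw]
  have hb' : b (x + ε • w) = 0 := by simp [hbx, hbw]
  have hc' : c (x + ε • w) = ε * c w := by simp [hcx]
  rw [eval_implicitForm, ha', hb', hc', C_0, zero_mul, sub_zero, h]
  congr 3
  funext r
  simp only [eval_sub, eval_mul, eval_C, eval_pullback]
  ring

/-- The image of the projective line is Zariski closed. -/
theorem Immersion.zariskiClosure_curveImage_subset (hγ : Immersion d γ) :
    zariskiClosure (curveImage γ) ⊆ curveImage γ := by
  intro p hp
  by_contra hpC
  set g : Fin 4 → ℂ[X] := fun i => dehom (γ i) with hg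
  have hnot : ∀ s : Fin 2 → ℂ, s ≠ 0 → paramEval γ s ∉ Submodule.span ℂ {p.rep} := by
    intro s hs h
    obtain ⟨k, hk⟩ := Submodule.mem_span_singleton.mp h
    have hk0 : k ≠ 0 := by
      rintro rfl
      exact hγ.paramEval_ne_zero hs (by rw [← hk, zero_smul])
    refine hpC (mem_curveImage_iff.mpr ⟨s, hs, k⁻¹, inv_ne_zero hk0, ?_⟩)
    rw [← hk, smul_smul, inv_mul_cancel₀ hk0, one_smul]
  obtain ⟨a, -, ha⟩ := exists_dual_forall_ne_zero ⊥ (Set.finite_singleton p.rep)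
    (by simp [p.rep_nonzero])
  obtain ⟨b, hbp, hb⟩ := exists_dual_forall_ne_zero (Submodule.span ℂ {p.rep})
    (Set.finite_singleton (paramEval γ ![1, 0])) (by
      rintro _ rfl
      exact hnot _ infty_ne_zero)
  obtain ⟨c, hcp, hc⟩ := exists_dual_forall_ne_zero (Submodule.span ℂ {p.rep})
    ((pullback b g).roots.toFinset.finite_toSet.image fun r => paramEval γ ![r, 1]) (by
      rintro _ ⟨r, -, rfl⟩
      exact hnot _ (chart_ne_zero r))
  have hb' := hb _ rfl
  rw [hγ.paramEval_infty] at hb'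
  have h := eval_implicitForm_line a b c (g := g) hγ.affineImmersion.natDegree_le hb'
    (x := p.rep) (w := 0) (ha _ rfl) (map_zero a) (hbp _ (Submodule.mem_span_singleton_self _))
    (map_zero b) (hcp _ (Submodule.mem_span_singleton_self _)) 0
  rw [smul_zero, add_zero, hp _ (hγ.vanishesOn_implicitForm a b c), eq_comm, mul_eq_zero] at h
  have hb0 : (pullback b g).leadingCoeff ≠ 0 := by
    rw [leadingCoeff_ne_zero]
    intro h0
    rw [← coeff_pullback b g d, h0, coeff_zero] at hb'
    exact hb' rfl
  rcases h with h | h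
  · exact pow_ne_zero _ (mul_ne_zero (ha _ rfl) hb0) h
  · obtain ⟨r, hr, hr0⟩ := Multiset.mem_map.mp (Multiset.prod_eq_zero_iff.mp h)
    rw [zero_mul, sub_zero] at hr0
    refine mul_ne_zero (ha _ rfl) (hc _ ⟨r, by simpa using hr, rfl⟩) ?_
    rw [← hr0]
    congr 2
    exact Immersion.paramEval_chart r

end ImplicitForm

end Halphen

namespace Halphen

open Polynomial

/-! ### Tangent lines and nonsingular points -/

/-- The derivative of a polynomial along a line. -/
theorem derivative_aeval_line (F : MvPolynomial (Fin 4) ℂ) (x w : Fin 4 → ℂ) :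
    (derivative (MvPolynomial.aeval (fun i => C (x i) + C (w i) * X) F)).eval 0 =
      ∑ i, MvPolynomial.eval x (MvPolynomial.pderiv i F) * w i := by
  have h0 : ∀ F : MvPolynomial (Fin 4) ℂ,
      (MvPolynomial.aeval (fun i => C (x i) + C (w i) * X) F).eval 0 = MvPolynomial.eval x F := by
    intro F
    induction F using MvPolynomial.induction_on with
    | C a => simp
    | add p q hp hq => simp [hp, hq]
    | mul_X p i hp => simp [hp]
  induction F using MvPolynomial.induction_on with
  | C a => simp
  | add p q hp hq => simp only [map_add, eval_add, hp, hq, add_mul,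
      Finset.sum_add_distrib]
  | mul_X p i hp =>
    rw [map_mul, MvPolynomial.aeval_X, derivative_mul, eval_add, eval_mul, hp, eval_mul, h0]
    simp only [MvPolynomial.pderiv_mul, map_add, map_mul, add_mul, Finset.sum_add_distrib,
      MvPolynomial.pderiv_X, MvPolynomial.eval_X, Finset.sum_mul]
    congr 1
    · refine Finset.sum_congr rfl fun j _ => ?_
      simp
      ring
    · rw [Finset.sum_eq_single i]
      · simp
      · intro j _ hj
        simp [hj.symm]
      · simp

theorem eval_aeval_line (F : MvPolynomial (Fin 4) ℂ) (x w : Fin 4 → ℂ) (ε : ℂ) :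
    (MvPolynomial.aeval (fun i => C (x i) + C (w i) * X) F).eval ε =
      MvPolynomial.eval (x + ε • w) F := by
  induction F using MvPolynomial.induction_on with
  | C a => simp
  | add p q hp hq => simp [hp, hq]
  | mul_X p i hp =>
    rw [map_mul, MvPolynomial.aeval_X, eval_mul, hp, map_mul, MvPolynomial.eval_X]
    simp only [eval_add, eval_mul, eval_C, eval_X, Pi.add_apply, Pi.smul_apply, smul_eq_mul]
    rw [mul_comm ε]

/-- The chain rule. -/
theorem pderiv_aeval (F : MvPolynomial (Fin 4) ℂ) (γ : Fin 4 → MvPolynomial (Fin 2) ℂ)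
    (k : Fin 2) :
    MvPolynomial.pderiv k (MvPolynomial.aeval γ F) =
      ∑ i, MvPolynomial.aeval γ (MvPolynomial.pderiv i F) * MvPolynomial.pderiv k (γ i) := by
  induction F using MvPolynomial.induction_on with
  | C a => simp
  | add p q hp hq => simp only [map_add, hp, hq, add_mul, Finset.sum_add_distrib]
  | mul_X p i hp =>
    rw [map_mul, MvPolynomial.aeval_X, MvPolynomial.pderiv_mul, hp]
    simp only [MvPolynomial.pderiv_mul, map_add, map_mul, add_mul, Finset.sum_add_distrib,
      MvPolynomial.pderiv_X, MvPolynomial.aeval_X, Finset.sum_mul]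
    refine congr_arg₂ (· + ·) (Finset.sum_congr rfl fun j _ => by ring) ?_
    rw [Finset.sum_eq_single i]
    · simp
    · intro j _ hj
      simp [hj.symm]
    · simp

theorem eval_aeval_param (F : MvPolynomial (Fin 4) ℂ) (γ : Fin 4 → MvPolynomial (Fin 2) ℂ)
    (s : Fin 2 → ℂ) :
    MvPolynomial.eval s (MvPolynomial.aeval γ F) = MvPolynomial.eval (paramEval γ s) F := by
  induction F using MvPolynomial.induction_on with
  | C a => simp
  | add p q hp hq => rw [map_add, map_add, map_add, hp, hq]
  | mul_X p i hp =>
    rw [map_mul, map_mul, map_mul, hp, MvPolynomial.aeval_X, MvPolynomial.eval_X, paramEval]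

variable {d : ℕ} {γ : Fin 4 → MvPolynomial (Fin 2) ℂ}

/-- A binary polynomial vanishing away from the origin is zero. -/
theorem eq_zero_of_forall_eval {G : MvPolynomial (Fin 2) ℂ}
    (hG : ∀ s : Fin 2 → ℂ, s ≠ 0 → MvPolynomial.eval s G = 0) : G = 0 := by
  have h : MvPolynomial.X 0 * G = 0 := by
    refine MvPolynomial.funext fun s => ?_
    by_cases hs : s = 0
    · simp [hs]
    · simp [hG s hs]
  exact (mul_eq_zero.mp h).resolve_left (MvPolynomial.X_ne_zero 0)

theorem mem_curveImage_mk {s : Fin 2 → ℂ} (hs : s ≠ 0) (h : paramEval γ s ≠ 0) :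
    Projectivization.mk ℂ (paramEval γ s) h ∈ curveImage γ :=
  ⟨s, hs, h, rfl⟩

theorem eval_paramEval_eq_zero {F : MvPolynomial (Fin 4) ℂ} {S : Set P3} (hF : VanishesOn F S)
    {s : Fin 2 → ℂ} (h : paramEval γ s ≠ 0) (hS : Projectivization.mk ℂ (paramEval γ s) h ∈ S) :
    MvPolynomial.eval (paramEval γ s) F = 0 := by
  obtain ⟨⟨k, hk⟩, hF⟩ := hF
  obtain ⟨c, hc⟩ := Projectivization.exists_smul_eq_mk_rep ℂ (paramEval γ s) h
  have h1 := hF _ hS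
  rw [← hc, Units.smul_def, eval_smul_of_isHomogeneous hk] at h1
  exact (mul_eq_zero.mp h1).resolve_left (pow_ne_zero _ c.ne_zero)

namespace Immersion

theorem aeval_eq_zero (hγ : Immersion d γ) {F : MvPolynomial (Fin 4) ℂ}
    (hF : VanishesOn F (curveImage γ)) : MvPolynomial.aeval γ F = 0 := by
  refine eq_zero_of_forall_eval fun s hs => ?_
  rw [eval_aeval_param]
  exact eval_paramEval_eq_zero hF (hγ.paramEval_ne_zero hs) (mem_curveImage_mk hs _)

/-- The tangent line of the parametrization is contained in the linear space defined by the
differentials of the equations of the curve. -/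
theorem tangentSpan_le (hγ : Immersion d γ) {m : P3} {s : Fin 2 → ℂ} {c : ℂ}
    (hm : m.rep = c • paramEval γ s) : tangentSpan γ s ≤ tangentLine (curveImage γ) m := by
  rw [tangentSpan, Submodule.span_le]
  have key : ∀ k, paramDeriv γ k s ∈ tangentLine (curveImage γ) m := by
    intro k F hF
    have h := congr_arg (MvPolynomial.eval s) (pderiv_aeval F γ k)
    rw [hγ.aeval_eq_zero hF, map_zero, map_zero, map_sum] at h
    obtain ⟨⟨n, hn⟩, -⟩ := hF
    simp only [hm, eval_smul_of_isHomogeneous hn.pderiv, mul_assoc, ← Finset.mul_sum]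
    simp only [map_mul, eval_aeval_param] at h
    simp only [paramDeriv, ← h, mul_zero]
  rintro _ (rfl | rfl)
  exacts [key 0, key 1]

theorem tangentLine_eq_of_isNonsingularPoint (hγ : Immersion d γ) {m : P3} {s : Fin 2 → ℂ}
    (hs : s ≠ 0) {c : ℂ} (hm : m.rep = c • paramEval γ s)
    (h : IsNonsingularPoint (curveImage γ) m) : tangentLine (curveImage γ) m = tangentSpan γ s :=
  (Submodule.eq_of_le_of_finrank_eq (hγ.tangentSpan_le hm)
    (by rw [hγ.finrank_tangentSpan hs, h.2])).symm

/-- The parameters in the affine chart whose image is also the image of another point of the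
projective line. -/
def multiplePoints (γ : Fin 4 → MvPolynomial (Fin 2) ℂ) : Set ℂ :=
  {z | ∃ s : Fin 2 → ℂ, s ≠ 0 ∧ (∀ c : ℂ, s ≠ c • ![z, 1]) ∧
    ∃ c : ℂ, c ≠ 0 ∧ paramEval γ ![z, 1] = c • paramEval γ s}

theorem finite_multiplePoints (hγ : Immersion d γ) : (multiplePoints γ).Finite := by
  refine (hγ.affineImmersion.finite_multiple.union
    hγ.affineImmersion.finite_multiple_infty).subset ?_
  rintro z ⟨s, hs, hsz, c, -, hc⟩
  obtain ⟨l, -, ⟨t, rfl⟩ | rfl⟩ := exists_smul_chart hs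
  · refine Or.inl ⟨t, fun htz => hsz l (by rw [htz]), fun i j => ?_⟩
    rw [← paramEval_chart, ← paramEval_chart, hc, hγ.paramEval_smul]
    simp only [minor, Pi.smul_apply, smul_eq_mul]
    ring
  · refine Or.inr fun i j => ?_
    rw [← paramEval_chart, ← hγ.paramEval_infty, hc, hγ.paramEval_smul]
    simp only [minor, Pi.smul_apply, smul_eq_mul]
    ring

theorem paramEval_notMem_span (hγ : Immersion d γ) {z : ℂ} (hz : z ∉ multiplePoints γ)
    {s : Fin 2 → ℂ} (hs : s ≠ 0) (hsz : ∀ c : ℂ, s ≠ c • ![z, 1]) :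
    paramEval γ s ∉ Submodule.span ℂ {paramEval γ ![z, 1]} := by
  intro h
  obtain ⟨k, hk⟩ := Submodule.mem_span_singleton.mp h
  have hk0 : k ≠ 0 := by
    rintro rfl
    exact hγ.paramEval_ne_zero hs (by rw [← hk, zero_smul])
  refine hz ⟨s, hs, hsz, k⁻¹, inv_ne_zero hk0, ?_⟩
  rw [← hk, smul_smul, inv_mul_cancel₀ hk0, one_smul]

theorem infty_ne_smul (z c : ℂ) : (![1, 0] : Fin 2 → ℂ) ≠ c • ![z, 1] := by
  intro h
  have h1 : c = 0 := by simpa [eq_comm] using congr_fun h 1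
  simpa [h1] using congr_fun h 0

theorem chart_ne_smul {r z : ℂ} (hrz : r ≠ z) (c : ℂ) :
    (![r, 1] : Fin 2 → ℂ) ≠ c • ![z, 1] := by
  intro h
  have h1 : c = 1 := by simpa [eq_comm] using congr_fun h 1
  exact hrz (by simpa [h1] using congr_fun h 0)

/-- A simple point of the parametrized curve is a nonsingular point of its image. Any vector outside
of the tangent line at `z` is, up to a tangent vector, a vector `w` for which the projection from
`w` separates the point at infinity from `z`; a suitable implicit equation then has a nonzero
derivative along `w`, since only one of its linear factors vanishes. -/
theorem tangentLine_le (hγ : Immersion d γ) {z : ℂ} (hz : z ∉ multiplePoints γ) {m : P3} {k : ℂ}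
    (hm : m.rep = k • paramEval γ ![z, 1]) :
    tangentLine (curveImage γ) m ≤ tangentSpan γ ![z, 1] := by
  intro w₀ hw₀
  by_contra hw₀'
  set x := paramEval γ ![z, 1] with hx
  set y := paramDeriv γ 0 ![z, 1] with hy
  set e := paramEval γ ![1, 0] with he
  have hyT : y ∈ tangentSpan γ ![z, 1] := paramDeriv_zero_mem _
  have hxT : x ∈ tangentSpan γ ![z, 1] := hγ.paramEval_mem_tangentSpan _
  have hk : k ≠ 0 := by
    rintro rfl
    exact m.rep_nonzero (by rw [hm, zero_smul])
  have hind : ∀ p q : ℂ, p • x + q • y = 0 → p = 0 ∧ q = 0 := by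
    have h := exists_minor_ne_zero_iff.mp (hγ.affineImmersion.exists_minor z)
    rw [← paramEval_chart, ← paramDeriv_zero_chart] at h
    exact LinearIndependent.pair_iff.mp h
  have heT : e ∉ Submodule.span ℂ {x} :=
    hγ.paramEval_notMem_span hz infty_ne_zero (infty_ne_smul z)
  obtain ⟨t, ht⟩ : ∃ t : ℂ, e ∉ Submodule.span ℂ {x, w₀ + t • y} := by
    by_contra! h
    obtain ⟨p₀, q₀, h0⟩ := Submodule.mem_span_pair.mp (h 0)
    obtain ⟨p₁, q₁, h1⟩ := Submodule.mem_span_pair.mp (h 1)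
    have hq : q₀ = q₁ := by
      by_contra hq
      apply hw₀'
      have h2 : (q₀ - q₁) • w₀ = (p₁ - p₀) • x + q₁ • y := by
        linear_combination (norm := module) h0 - h1
      have h3 : w₀ = (q₀ - q₁)⁻¹ • ((p₁ - p₀) • x + q₁ • y) := by
        rw [← h2, smul_smul, inv_mul_cancel₀ (sub_ne_zero.mpr hq), one_smul]
      rw [h3]
      exact Submodule.smul_mem _ _ (Submodule.add_mem _ (Submodule.smul_mem _ _ hxT)
        (Submodule.smul_mem _ _ hyT))
    subst hq
    have h2 : (p₁ - p₀) • x + q₀ • y = 0 := by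
      linear_combination (norm := module) h1 - h0
    have hq0 := (hind _ _ h2).2
    apply heT
    rw [← h0, hq0, zero_smul, add_zero]
    exact Submodule.smul_mem _ _ (Submodule.mem_span_singleton_self x)
  set w := w₀ + t • y with hw
  have hwT : w ∉ tangentSpan γ ![z, 1] := by
    intro h
    apply hw₀'
    have : w₀ = w - t • y := by rw [hw]; abel
    rw [this]
    exact Submodule.sub_mem _ h (Submodule.smul_mem _ _ hyT)
  have hwL : w ∈ tangentLine (curveImage γ) m :=
    Submodule.add_mem _ hw₀ (Submodule.smul_mem _ _ (hγ.tangentSpan_le hm hyT))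
  have hne_smul : ∀ q : ℂ, q • w ∈ tangentSpan γ ![z, 1] → q = 0 := by
    intro q hq
    by_contra hq0
    apply hwT
    have h := Submodule.smul_mem _ q⁻¹ hq
    rwa [smul_smul, inv_mul_cancel₀ hq0, one_smul] at h
  obtain ⟨a, haw, hax⟩ := exists_dual_forall_ne_zero (Submodule.span ℂ {w})
    (Set.finite_singleton x) (by
      rintro _ rfl h
      obtain ⟨q, hq⟩ := Submodule.mem_span_singleton.mp h
      have hq0 := hne_smul q (hq ▸ hxT)
      rw [hq0, zero_smul] at hq
      exact hγ.paramEval_ne_zero (chart_ne_zero z) hq.symm)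
  obtain ⟨b, hb0, hb⟩ := exists_dual_forall_ne_zero (Submodule.span ℂ {x, w})
    (Set.toFinite {e, y}) (by
      rintro _ (rfl | rfl)
      · exact ht
      · intro h
        obtain ⟨p, q, hpq⟩ := Submodule.mem_span_pair.mp h
        have hq0 : q = 0 := by
          apply hne_smul
          have : q • w = y - p • x := by rw [← hpq]; abel
          rw [this]
          exact Submodule.sub_mem _ hyT (Submodule.smul_mem _ _ hxT)
        rw [hq0, zero_smul, add_zero] at hpq
        refine one_ne_zero (neg_eq_zero.mp (hind p (-1) ?_).2)
        rw [hpq]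
        module)
  set g : Fin 4 → ℂ[X] := fun i => dehom (γ i) with hg
  have hgx : ∀ r, (fun l => (g l).eval r) = paramEval γ ![r, 1] := fun r =>
    (paramEval_chart r).symm
  have hgy : (fun l => (derivative (g l)).eval z) = y := (paramDeriv_zero_chart z).symm
  have hge : (fun l => (g l).coeff d) = e := hγ.paramEval_infty.symm
  obtain ⟨c, hc0, hc⟩ := exists_dual_forall_ne_zero (Submodule.span ℂ {x})
    ((((pullback b g).roots.toFinset.finite_toSet.sdiff (t := {z})).image fun r =>
      paramEval γ ![r, 1]).insert w) (by
      rintro _ (rfl | ⟨r, ⟨-, hr⟩, rfl⟩)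
      · intro h
        obtain ⟨q, hq⟩ := Submodule.mem_span_singleton.mp h
        exact hwT (hq ▸ Submodule.smul_mem _ _ hxT)
      · exact hγ.paramEval_notMem_span hz (chart_ne_zero r) (chart_ne_smul hr))
  have hax' : a x ≠ 0 := hax _ rfl
  have haw' : a w = 0 := haw _ (Submodule.mem_span_singleton_self w)
  have hbx : b x = 0 := hb0 _ (Submodule.subset_span (by simp))
  have hbw : b w = 0 := hb0 _ (Submodule.subset_span (by simp))
  have hcx : c x = 0 := hc0 _ (Submodule.mem_span_singleton_self x)
  have hcw : c w ≠ 0 := hc _ (Set.mem_insert _ _)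
  have hbe : b (fun l => (g l).coeff d) ≠ 0 := by
    rw [hge]
    exact hb _ (by simp)
  have hB0 : pullback b g ≠ 0 := by
    intro h0
    rw [← coeff_pullback b g d, h0, coeff_zero] at hbe
    exact hbe rfl
  have hBz : (pullback b g).IsRoot z := by
    rw [IsRoot.def, eval_pullback, hgx]
    exact hbx
  have hBz' : (derivative (pullback b g)).eval z ≠ 0 := by
    rw [derivative_pullback, eval_pullback, hgy]
    exact hb _ (by simp)
  -- `z` is a simple zero of `b ∘ g`, so only one factor of the implicit equation vanishes at `x`.
  obtain ⟨R, hR⟩ := Multiset.exists_cons_of_mem ((mem_roots hB0).mpr hBz)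
  have hzR : z ∉ R := by
    intro hzR
    have h1 : 1 < (pullback b g).rootMultiplicity z := by
      rw [← count_roots, hR, Multiset.count_cons_self]
      have := Multiset.count_pos.mpr hzR
      omega
    exact hBz' ((one_lt_rootMultiplicity_iff_isRoot hB0).mp h1).2
  set F := implicitForm d g a b c with hF
  have hFline : MvPolynomial.aeval (fun i => C (x i) + C (w i) * X) F =
      C ((a x * (pullback b g).leadingCoeff) ^ d) *
        (-(X * C (c w * a x)) * (R.map fun r =>
          C (a x * c (paramEval γ ![r, 1])) - X * C (c w * a (paramEval γ ![r, 1]))).prod) := by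
    refine Polynomial.funext fun ε => ?_
    rw [eval_aeval_line, hF, eval_implicitForm_line a b c (g := g)
      hγ.affineImmersion.natDegree_le hbe hax' haw' hbx hbw hcx,
      hR, Multiset.map_cons, Multiset.prod_cons, hgx z, ← hx, hcx]
    simp only [hgx, eval_mul, eval_neg, eval_C, eval_X, eval_multiset_prod, Multiset.map_map,
      Function.comp_def, eval_sub]
    ring
  have hder := derivative_aeval_line F x w
  have hzero : ∑ i, MvPolynomial.eval x (MvPolynomial.pderiv i F) * w i = 0 := by
    have h1 := hwL F (hγ.vanishesOn_implicitForm a b c)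
    have hhom : F.IsHomogeneous (d + d) := isHomogeneous_implicitForm a b c
    simp only [hm, eval_smul_of_isHomogeneous hhom.pderiv, mul_assoc, ← Finset.mul_sum] at h1
    exact (mul_eq_zero.mp h1).resolve_left (pow_ne_zero _ hk)
  rw [hzero, hFline] at hder
  simp only [derivative_mul, derivative_C, derivative_neg, derivative_X, eval_add, eval_mul,
    eval_neg, eval_C, eval_X, zero_mul, zero_add, mul_zero, add_zero, neg_zero, one_mul,
    eval_multiset_prod, Multiset.map_map, Function.comp_def, eval_sub, sub_zero] at hder
  rcases mul_eq_zero.mp hder with h | h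
  · exact pow_ne_zero _ (mul_ne_zero hax' (leadingCoeff_ne_zero.mpr hB0)) h
  rcases mul_eq_zero.mp h with h | h
  · exact neg_ne_zero.mpr (mul_ne_zero hcw hax') h
  · obtain ⟨r, hr, hr0⟩ := Multiset.mem_map.mp (Multiset.prod_eq_zero_iff.mp h)
    refine mul_ne_zero hax' (hc _ (Set.mem_insert_of_mem _ ⟨r, ⟨?_, ?_⟩, rfl⟩)) hr0
    · have : r ∈ (pullback b g).roots := hR ▸ Multiset.mem_cons_of_mem hr
      simpa using this
    · rintro rfl
      exact hzR hr

theorem isNonsingularPoint (hγ : Immersion d γ) {z : ℂ} (hz : z ∉ multiplePoints γ) {m : P3}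
    {k : ℂ} (hk : k ≠ 0) (hm : m.rep = k • paramEval γ ![z, 1]) :
    IsNonsingularPoint (curveImage γ) m := by
  refine ⟨mem_curveImage_iff.mpr ⟨_, chart_ne_zero z, k, hk, hm⟩, ?_⟩
  rw [le_antisymm (hγ.tangentLine_le hz hm) (hγ.tangentSpan_le hm),
    hγ.finrank_tangentSpan (chart_ne_zero z)]

end Immersion

end Halphen

namespace Halphen

open Polynomial

variable {d : ℕ} {γ : Fin 4 → MvPolynomial (Fin 2) ℂ}

/-! ### The degree -/

theorem eq_mk_of_rep_eq {p : P3} {v : Fin 4 → ℂ} {k : ℂ} (hv : v ≠ 0) (h : p.rep = k • v) :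
    p = Projectivization.mk ℂ v hv := by
  rw [← p.mk_rep, Projectivization.mk_eq_mk_iff']
  exact ⟨k, h.symm⟩

theorem exists_rep_mk {v : Fin 4 → ℂ} (hv : v ≠ 0) :
    ∃ k : ℂ, k ≠ 0 ∧ (Projectivization.mk ℂ v hv).rep = k • v := by
  obtain ⟨a, ha⟩ := Projectivization.exists_smul_eq_mk_rep ℂ v hv
  exact ⟨a, a.ne_zero, ha.symm⟩

namespace Immersion

theorem exists_rep_of_mem (hγ : Immersion d γ) {p : P3} (hp : p ∈ curveImage γ) :
    ∃ k : ℂ, k ≠ 0 ∧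
      ((∃ z : ℂ, p.rep = k • paramEval γ ![z, 1]) ∨ p.rep = k • paramEval γ ![1, 0]) := by
  obtain ⟨s, hs, k, hk, h⟩ := mem_curveImage_iff.mp hp
  obtain ⟨c, hc, ⟨z, rfl⟩ | rfl⟩ := exists_smul_chart hs <;>
  rw [hγ.paramEval_smul, smul_smul] at h
  · exact ⟨_, mul_ne_zero hk (pow_ne_zero d hc), Or.inl ⟨z, h⟩⟩
  · exact ⟨_, mul_ne_zero hk (pow_ne_zero d hc), Or.inr h⟩

/-- The point with parameter `z` of the affine chart. -/
noncomputable def point (hγ : Immersion d γ) (z : ℂ) : P3 :=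
  Projectivization.mk ℂ (paramEval γ ![z, 1]) (hγ.paramEval_ne_zero (chart_ne_zero z))

theorem exists_rep_point (hγ : Immersion d γ) (z : ℂ) :
    ∃ k : ℂ, k ≠ 0 ∧ (hγ.point z).rep = k • paramEval γ ![z, 1] :=
  exists_rep_mk _

theorem point_injOn (hγ : Immersion d γ) {S : Set ℂ} (hS : ∀ z ∈ S, z ∉ multiplePoints γ) :
    Set.InjOn hγ.point S := by
  intro z hz t _ h
  by_contra hzt
  refine hγ.paramEval_notMem_span (hS z hz) (chart_ne_zero t) (chart_ne_smul (Ne.symm hzt)) ?_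
  obtain ⟨k, hk⟩ := (Projectivization.mk_eq_mk_iff' ℂ _ _ _ _).mp h.symm
  exact Submodule.mem_span_singleton.mpr ⟨k, hk⟩

theorem sum_mul_rep_eq_zero_iff {a v : Fin 4 → ℂ} {p : P3} {k : ℂ} (hk : k ≠ 0)
    (h : p.rep = k • v) : ∑ i, a i * p.rep i = 0 ↔ ∑ i, a i * v i = 0 := by
  have : ∑ i, a i * p.rep i = k * ∑ i, a i * v i := by
    rw [Finset.mul_sum]
    refine Finset.sum_congr rfl fun i _ => ?_
    rw [h, Pi.smul_apply, smul_eq_mul]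
    ring
  rw [this, mul_eq_zero, or_iff_right hk]

/-- A generic plane section of the image is the set of the zeros of a generic member of the linear
system spanned by the components, and the parametrization is injective on it. -/
theorem hasDegree (hγ : Immersion d γ) : HasDegree (curveImage γ) d := by
  have hg := hγ.affineImmersion
  refine ((IsGeneric.separableOfDegree_sum hg.natDegree_le hg.exists_eval_ne_zero
    hg.exists_coeff_ne_zero).and (IsGeneric.forall_mem_finite hγ.finite_multiplePoints
      fun z _ => IsGeneric.sum_mul_ne_zero (hγ.paramEval_ne_zero (chart_ne_zero z)))).mono ?_
  rintro a ⟨ha, haE⟩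
  set f : ℂ[X] := ∑ i, C (a i) * dehom (γ i) with hf
  have hfz : ∀ z, f.eval z = ∑ i, a i * paramEval γ ![z, 1] i := fun z => by
    simp [hf, eval_finsetSum, paramEval_chart]
  have hfd : f.coeff d = ∑ i, a i * paramEval γ ![1, 0] i := by
    simp [hf, hγ.paramEval_infty]
  have himage : {p : P3 | p ∈ curveImage γ ∧ ∑ i, a i * p.rep i = 0} =
      hγ.point '' f.roots.toFinset := by
    ext p
    simp only [Set.mem_ofPred_eq, Set.mem_image, Finset.mem_coe, Multiset.mem_toFinset,
      mem_roots ha.ne_zero, IsRoot.def, hfz]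
    constructor
    · rintro ⟨hp, hap⟩
      obtain ⟨k, hk, ⟨z, hz⟩ | hz⟩ := hγ.exists_rep_of_mem hp
      · exact ⟨z, (sum_mul_rep_eq_zero_iff hk hz).mp hap, (eq_mk_of_rep_eq _ hz).symm⟩
      · rw [sum_mul_rep_eq_zero_iff hk hz, ← hfd] at hap
        exact absurd hap ha.2.1
    · rintro ⟨z, hz, rfl⟩
      obtain ⟨k, hk, hkz⟩ := hγ.exists_rep_point z
      exact ⟨mem_curveImage_mk (chart_ne_zero z) _, (sum_mul_rep_eq_zero_iff hk hkz).mpr hz⟩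
  rw [himage, Set.InjOn.encard_image, Set.encard_coe_eq_coe_finsetCard, ha.card_roots]
  refine hγ.point_injOn fun z hz hzE => haE z hzE ?_
  rw [← hfz]
  simpa [ha.ne_zero] using hz

end Immersion

/-! ### Incidence of lines -/

/-- The incidence form of the lines `a b` and `c e`, in terms of Plücker coordinates. -/
def incidence {R : Type*} [CommRing R] (a b c e : Fin 4 → R) : R :=
  minor a b 0 1 * minor c e 2 3 - minor a b 0 2 * minor c e 1 3 + minor a b 0 3 * minor c e 1 2 +
  minor a b 1 2 * minor c e 0 3 - minor a b 1 3 * minor c e 0 2 + minor a b 2 3 * minor c e 0 1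

section Incidence

theorem map_incidence {R S : Type*} [CommRing R] [CommRing S] (f : R →+* S)
    (a b c e : Fin 4 → R) : f (incidence a b c e) =
      incidence (fun l => f (a l)) (fun l => f (b l)) (fun l => f (c l)) (fun l => f (e l)) := by
  simp [incidence, map_minor]

variable {a b c e : Fin 4 → ℂ}

theorem incidence_eq_det (a b c e : Fin 4 → ℂ) :
    incidence a b c e = Matrix.det (Matrix.of ![c, e, a, b]) := by
  simp [incidence, minor, Matrix.det_succ_row_zero, Fin.sum_univ_succ, Fin.succAbove]
  ring

theorem incidence_ne_zero_iff : incidence a b c e ≠ 0 ↔ LinearIndependent ℂ ![c, e, a, b] := by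
  rw [incidence_eq_det, ← isUnit_iff_ne_zero, ← Matrix.isUnit_iff_isUnit_det,
    ← Matrix.linearIndependent_rows_iff_isUnit]
  rfl

theorem incidence_ne_zero (hab : ∃ i j, minor a b i j ≠ 0) (he : e ∉ Submodule.span ℂ {a, b})
    (hc : c ∉ Submodule.span ℂ {e, a, b}) : incidence a b c e ≠ 0 := by
  rw [incidence_ne_zero_iff]
  refine linearIndependent_finCons.mpr ⟨linearIndependent_finCons.mpr
    ⟨exists_minor_ne_zero_iff.mp hab, ?_⟩, ?_⟩
  · rwa [Matrix.range_cons_cons_empty]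
  · rwa [Matrix.range_cons, Matrix.range_cons_cons_empty, Set.singleton_union]

theorem inf_span_eq_bot (h : incidence a b c e ≠ 0) :
    Submodule.span ℂ {a, b} ⊓ Submodule.span ℂ {c, e} = ⊥ := by
  rw [incidence_ne_zero_iff, Fintype.linearIndependent_iff] at h
  rw [Submodule.eq_bot_iff]
  rintro v ⟨hv, hv'⟩
  obtain ⟨x, y, rfl⟩ := Submodule.mem_span_pair.mp hv
  obtain ⟨z, w, hzw⟩ := Submodule.mem_span_pair.mp hv'
  have h1 := h ![z, w, -x, -y] (by
    simp only [Fin.sum_univ_four, Matrix.cons_val_zero, Matrix.cons_val_one, Matrix.cons_val]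
    linear_combination (norm := module) hzw)
  have hx : x = 0 := by simpa using h1 2
  have hy : y = 0 := by simpa using h1 3
  simp [hx, hy]

theorem inf_span_ne_bot (h : incidence a b c e = 0) (hab : ∃ i j, minor a b i j ≠ 0)
    (hce : ∃ i j, minor c e i j ≠ 0) :
    Submodule.span ℂ {a, b} ⊓ Submodule.span ℂ {c, e} ≠ ⊥ := by
  intro hbot
  refine incidence_ne_zero_iff.mpr ?_ h
  rw [exists_minor_ne_zero_iff, LinearIndependent.pair_iff] at hab hce
  rw [Fintype.linearIndependent_iff]
  intro g hg
  simp only [Fin.sum_univ_four, Matrix.cons_val_zero, Matrix.cons_val_one, Matrix.cons_val] at hg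
  have h1 : g 0 • c + g 1 • e = (-g 2) • a + (-g 3) • b := by
    linear_combination (norm := module) hg
  have h2 : g 0 • c + g 1 • e = 0 := by
    have : g 0 • c + g 1 • e ∈ Submodule.span ℂ {a, b} ⊓ Submodule.span ℂ {c, e} :=
      ⟨h1 ▸ Submodule.mem_span_pair.mpr ⟨_, _, rfl⟩, Submodule.mem_span_pair.mpr ⟨_, _, rfl⟩⟩
    rwa [hbot, Submodule.mem_bot] at this
  have h3 := hce _ _ h2
  have h4 := hab _ _ (h1.symm.trans h2)
  intro i
  fin_cases i
  exacts [h3.1, h3.2, neg_eq_zero.mp h4.1, neg_eq_zero.mp h4.2]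

end Incidence

end Halphen

namespace Halphen

open Polynomial

variable {d : ℕ} {γ : Fin 4 → MvPolynomial (Fin 2) ℂ}

/-! ### The rank -/

theorem IsGeneric.notMem {V : Submodule ℂ (Fin 4 → ℂ)} (hV : V ≠ ⊤) :
    IsGeneric fun y : Fin 4 → ℂ => y ∉ V := by
  obtain ⟨w, hw⟩ : ∃ w, w ∉ V := by
    by_contra! h
    exact hV (Submodule.eq_top_iff'.mpr h)
  obtain ⟨a, haV, ha⟩ := exists_dual_forall_ne_zero V (Set.finite_singleton w)
    (by rintro _ rfl; exact hw)
  have ha0 : (fun i => a (Pi.single i 1)) ≠ 0 := by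
    intro h
    apply ha w rfl
    rw [← dual_apply]
    simp [fun i => congr_fun h i]
  refine (IsGeneric.sum_mul_ne_zero ha0).mono fun y hy hyV => hy ?_
  rw [← haV y hyV, ← dual_apply]
  exact Finset.sum_congr rfl fun i _ => mul_comm _ _

theorem span_ne_top (S : Finset (Fin 4 → ℂ)) (hS : S.card ≤ 3) :
    Submodule.span ℂ (S : Set (Fin 4 → ℂ)) ≠ ⊤ := by
  intro h
  have h1 := finrank_span_finset_le_card (R := ℂ) S
  rw [Set.finrank, h, finrank_top, Module.finrank_fin_fun] at h1
  omega

theorem span_pair_ne_top (a b : Fin 4 → ℂ) : Submodule.span ℂ {a, b} ≠ ⊤ := by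
  classical
  have := span_ne_top {a, b} (Finset.card_le_two.trans (by norm_num))
  simpa using this

theorem span_triple_ne_top (a b c : Fin 4 → ℂ) : Submodule.span ℂ {a, b, c} ≠ ⊤ := by
  classical
  have := span_ne_top {a, b, c} Finset.card_le_three
  simpa using this

namespace Immersion

/-- The parameters in the affine chart whose tangent line is also the tangent line at another point
of the projective line. -/
def bitangentPoints (γ : Fin 4 → MvPolynomial (Fin 2) ℂ) : Set ℂ :=
  {z | ∃ s : Fin 2 → ℂ, s ≠ 0 ∧ (∀ c : ℂ, s ≠ c • ![z, 1]) ∧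
    tangentSpan γ ![z, 1] = tangentSpan γ s}

theorem finite_bitangentPoints (hγ : Immersion d γ) (hd : 2 ≤ d) :
    (bitangentPoints γ).Finite := by
  refine ((hγ.affineImmersion.finite_bitangent hd).union
    (hγ.affineImmersion.finite_bitangent_infty hd)).subset ?_
  rintro z ⟨s, hs, hsz, h⟩
  obtain ⟨l, hl, ⟨t, rfl⟩ | rfl⟩ := exists_smul_chart hs
  · rw [hγ.tangentSpan_smul hl, hγ.tangentSpan_chart] at h
    refine Or.inl ⟨t, fun htz => hsz l (by rw [htz]), fun i j k => ?_⟩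
    rw [← paramEval_chart, ← paramDeriv_zero_chart, ← paramEval_chart, ← paramDeriv_zero_chart]
    exact ⟨minor₃_eq_zero_of_mem_span (h ▸ hγ.paramEval_mem_tangentSpan _) i j k,
      minor₃_eq_zero_of_mem_span (h ▸ paramDeriv_zero_mem _) i j k⟩
  · rw [hγ.tangentSpan_smul hl, hγ.tangentSpan_chart] at h
    refine Or.inr fun i j k l => ?_
    rw [← paramEval_chart, ← paramDeriv_zero_chart]
    have h1 := minor_mul_minor_comm_of_span_eq h i j k l
    have h2 : ∀ i j, minor (paramDeriv γ 0 ![1, 0]) (paramDeriv γ 1 ![1, 0]) i j =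
        d * minor (fun l => (dehom (γ l)).coeff d) (fun l => (dehom (γ l)).coeff (d - 1)) i j := by
      intro i j
      simp only [minor, paramDeriv, eval_pderiv_zero_infty (hγ.isHomogeneous _),
        eval_pderiv_one_infty (hγ.isHomogeneous _) hγ.one_le]
      ring
    rw [h2, h2] at h1
    refine mul_left_cancel₀ hγ.cast_ne_zero ?_
    linear_combination h1

end Immersion

theorem isHomogeneous_wedgeCoord (hγ : ∀ i, (γ i).IsHomogeneous d) (i j : Fin 4) :
    (wedgeCoord γ i j).IsHomogeneous (2 * d - 2) := by
  have h := ((hγ i).pderiv (i := 0)).mul ((hγ j).pderiv (i := 1))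
  have h' := ((hγ j).pderiv (i := 0)).mul ((hγ i).pderiv (i := 1))
  rw [show d - 1 + (d - 1) = 2 * d - 2 by omega] at h h'
  exact h.sub h'

theorem eval_wedgeCoord (γ : Fin 4 → MvPolynomial (Fin 2) ℂ) (i j : Fin 4) (s : Fin 2 → ℂ) :
    MvPolynomial.eval s (wedgeCoord γ i j) = minor (paramDeriv γ 0 s) (paramDeriv γ 1 s) i j := by
  simp [wedgeCoord, minor, paramDeriv]

/-- The two partial derivatives of `γ` in the affine chart. -/
noncomputable def chartDeriv (γ : Fin 4 → MvPolynomial (Fin 2) ℂ) (k : Fin 2) : Fin 4 → ℂ[X] :=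
  fun l => dehom (MvPolynomial.pderiv k (γ l))

/-- The condition on a point of the affine chart that the tangent line at it meets the line through
`c` and `e`. -/
noncomputable def incidencePoly (γ : Fin 4 → MvPolynomial (Fin 2) ℂ) (c e : Fin 4 → ℂ) : ℂ[X] :=
  incidence (chartDeriv γ 0) (chartDeriv γ 1) (fun l => C (c l)) (fun l => C (e l))

theorem minor_chartDeriv (γ : Fin 4 → MvPolynomial (Fin 2) ℂ) (i j : Fin 4) :
    minor (chartDeriv γ 0) (chartDeriv γ 1) i j = dehom (wedgeCoord γ i j) := by
  simp only [minor, chartDeriv, wedgeCoord, map_sub, map_mul]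

theorem minor_C {R : Type*} [CommRing R] (c e : Fin 4 → R) (i j : Fin 4) :
    minor (fun l => C (c l)) (fun l => C (e l)) i j = C (minor c e i j) :=
  (map_minor C c e i j).symm

theorem natDegree_incidence_le {R : Type*} [CommRing R] {P Q : Fin 4 → R[X]} {n : ℕ}
    (h : ∀ i j, (minor P Q i j).natDegree ≤ n) (c e : Fin 4 → R) :
    (incidence P Q (fun l => C (c l)) (fun l => C (e l))).natDegree ≤ n := by
  have h' : ∀ i j (x : R), (minor P Q i j * C x).natDegree ≤ n := fun i j x =>
    (natDegree_mul_C_le _ _).trans (h i j)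
  simp only [incidence, minor_C]
  refine natDegree_add_le_of_degree_le ((natDegree_sub_le _ _).trans (max_le
    (natDegree_add_le_of_degree_le (natDegree_add_le_of_degree_le ((natDegree_sub_le _ _).trans
      (max_le ?_ ?_)) ?_) ?_) ?_)) ?_ <;> exact h' _ _ _

theorem eval_incidencePoly (γ : Fin 4 → MvPolynomial (Fin 2) ℂ) (c e : Fin 4 → ℂ) (z : ℂ) :
    (incidencePoly γ c e).eval z =
      incidence (paramDeriv γ 0 ![z, 1]) (paramDeriv γ 1 ![z, 1]) c e := by
  refine (map_incidence (evalRingHom z) _ _ _ _).trans ?_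
  simp only [coe_evalRingHom, chartDeriv, eval_dehom, eval_C]
  rfl

namespace Immersion

theorem coeff_incidencePoly (hγ : Immersion d γ) (c e : Fin 4 → ℂ) :
    (incidencePoly γ c e).coeff (2 * d - 2) =
      incidence (paramDeriv γ 0 ![1, 0]) (paramDeriv γ 1 ![1, 0]) c e := by
  simp only [incidencePoly, incidence, minor_chartDeriv, minor_C, coeff_add, coeff_sub,
    coeff_mul_C, coeff_dehom (isHomogeneous_wedgeCoord hγ.isHomogeneous _ _), eval_wedgeCoord]

theorem natDegree_minor_chartDeriv_le (hγ : Immersion d γ) (i j : Fin 4) :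
    (minor (chartDeriv γ 0) (chartDeriv γ 1) i j).natDegree ≤ 2 * d - 2 := by
  rw [minor_chartDeriv]
  exact natDegree_dehom_le (isHomogeneous_wedgeCoord hγ.isHomogeneous i j)

theorem natDegree_incidencePoly_le (hγ : Immersion d γ) (c e : Fin 4 → ℂ) :
    (incidencePoly γ c e).natDegree ≤ 2 * d - 2 :=
  natDegree_incidence_le hγ.natDegree_minor_chartDeriv_le c e

theorem finite_incidence {c e : Fin 4 → ℂ} {z₀ : ℂ}
    (h : incidence (paramDeriv γ 0 ![z₀, 1]) (paramDeriv γ 1 ![z₀, 1]) c e ≠ 0) :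
    {z : ℂ | incidence (paramDeriv γ 0 ![z, 1]) (paramDeriv γ 1 ![z, 1]) c e = 0}.Finite := by
  refine finite_of_polynomials (fun _ : Unit => incidencePoly γ c e) ⟨(), fun h0 => h ?_⟩ ?_
  · rw [← eval_incidencePoly, h0, eval_zero]
  · intro z hz _
    rwa [eval_incidencePoly]

theorem finite_mem_tangentSpan (hγ : Immersion d γ) {e : Fin 4 → ℂ} {z₀ : ℂ}
    (h : e ∉ tangentSpan γ ![z₀, 1]) : {z : ℂ | e ∈ tangentSpan γ ![z, 1]}.Finite := by
  obtain ⟨c, hc⟩ := (IsGeneric.notMem (span_triple_ne_top e (paramDeriv γ 0 ![z₀, 1])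
    (paramDeriv γ 1 ![z₀, 1]))).exists_mem
  refine (finite_incidence (incidence_ne_zero (hγ.exists_minor _ (chart_ne_zero z₀)) h
    hc)).subset fun z hz => ?_
  rw [Set.mem_ofPred_eq]
  by_contra h0
  have h1 := inf_span_eq_bot h0
  have h2 : e ∈ (⊥ : Submodule ℂ (Fin 4 → ℂ)) := by
    rw [← h1]
    exact ⟨hz, Submodule.subset_span (by simp)⟩
  rw [Submodule.mem_bot] at h2
  exact h (h2 ▸ Submodule.zero_mem _)

/-- Some point lies on no tangent line: the tangent developable is a surface. The point is found
on a line meeting only finitely many tangent lines, none of which contains it. -/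
theorem exists_notMem_tangentSpan (hγ : Immersion d γ) :
    ∃ e : Fin 4 → ℂ, (∀ z : ℂ, e ∉ tangentSpan γ ![z, 1]) ∧ e ∉ tangentSpan γ ![1, 0] := by
  obtain ⟨y₁, h0, hinf⟩ := ((IsGeneric.notMem (span_pair_ne_top _ _)).and
    (IsGeneric.notMem (span_pair_ne_top _ _))).exists_mem
    (S := fun y => y ∉ tangentSpan γ ![0, 1] ∧ y ∉ tangentSpan γ ![1, 0])
  have hZ₁ := hγ.finite_mem_tangentSpan h0
  obtain ⟨y₂, h₂, h₂'⟩ := ((IsGeneric.notMem (span_triple_ne_top y₁ (paramDeriv γ 0 ![0, 1])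
    (paramDeriv γ 1 ![0, 1]))).and (IsGeneric.forall_mem_finite hZ₁ fun z _ =>
      IsGeneric.notMem (span_pair_ne_top (paramDeriv γ 0 ![z, 1])
        (paramDeriv γ 1 ![z, 1])))).exists_mem
  have hinc := incidence_ne_zero (hγ.exists_minor _ (chart_ne_zero 0)) h0 h₂
  have hZ₂ := finite_incidence hinc
  have hsub : ∀ V : Submodule ℂ (Fin 4 → ℂ), (y₁ ∈ V → y₂ ∉ V) →
      {t : ℂ | y₁ + t • y₂ ∈ V}.Finite := by
    intro V hV
    refine Set.Subsingleton.finite fun t ht u hu => ?_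
    by_contra htu
    have h : (t - u) • y₂ ∈ V := by
      have h' := Submodule.sub_mem V ht hu
      convert h' using 1
      module
    have h' : y₂ ∈ V := by
      have := Submodule.smul_mem V (t - u)⁻¹ h
      rwa [smul_smul, inv_mul_cancel₀ (sub_ne_zero.mpr htu), one_smul] at this
    refine hV ?_ h'
    have := Submodule.sub_mem V ht (Submodule.smul_mem V t h')
    rwa [add_sub_cancel_right] at this
  obtain ⟨t, ht⟩ := ((hZ₂.biUnion (t := fun z => {t : ℂ | y₁ + t • y₂ ∈ tangentSpan γ ![z, 1]})
    fun z _ => hsub _ fun hz => h₂' z hz).union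
    (hsub (tangentSpan γ ![1, 0]) fun h => absurd h hinf)).exists_notMem
  simp only [Set.mem_union, Set.mem_iUnion, Set.mem_ofPred_eq, not_or, not_exists] at ht
  refine ⟨y₁ + t • y₂, fun z hz => ?_, ht.2⟩
  by_cases hz₂ : incidence (paramDeriv γ 0 ![z, 1]) (paramDeriv γ 1 ![z, 1]) y₂ y₁ = 0
  · exact ht.1 z hz₂ hz
  · have h1 := inf_span_eq_bot hz₂
    have h2 : y₁ + t • y₂ ∈ (⊥ : Submodule ℂ (Fin 4 → ℂ)) := by
      rw [← h1]
      exact ⟨hz, Submodule.mem_span_pair.mpr ⟨t, 1, by module⟩⟩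
    rw [Submodule.mem_bot] at h2
    apply h₂
    by_cases ht0 : t = 0
    · rw [ht0, zero_smul, add_zero] at h2
      exact absurd (h2 ▸ Submodule.zero_mem _) h0
    · have h3 : y₂ = (-t⁻¹) • y₁ := by
        have : t⁻¹ • (y₁ + t • y₂) = 0 := by rw [h2, smul_zero]
        rw [smul_add, smul_smul, inv_mul_cancel₀ ht0, one_smul] at this
        linear_combination (norm := module) this
      rw [h3]
      exact Submodule.smul_mem _ _ (Submodule.subset_span (by simp))

/-- The tangent lines meeting a generic line correspond to `2d - 2` distinct parameters. -/
theorem isGeneric_incidencePoly (hγ : Immersion d γ) :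
    IsGeneric fun x : Fin 2 × Fin 4 → ℂ =>
      SeparableOfDegree (incidencePoly γ (fun i => x (0, i)) (fun i => x (1, i))) (2 * d - 2) := by
  classical
  obtain ⟨e, he, he'⟩ := hγ.exists_notMem_tangentSpan
  have hlin : ∀ a b c : Fin 4 → ℂ, incidence a b c e =
      ∑ l, c l * incidence a b (Pi.single l 1) e := by
    intro a b c
    simp only [incidence, minor, Fin.sum_univ_four]
    simp
    ring
  have hex : ∀ a b : Fin 4 → ℂ, (∃ i j, minor a b i j ≠ 0) → e ∉ Submodule.span ℂ {a, b} →
      ∃ l, incidence a b (Pi.single l 1) e ≠ 0 := by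
    intro a b hab heab
    obtain ⟨c, hc⟩ := (IsGeneric.notMem (span_triple_ne_top e a b)).exists_mem
    have h := incidence_ne_zero hab heab hc
    by_contra! h0
    apply h
    rw [hlin]
    simp [h0]
  obtain ⟨c, hc⟩ := exists_separableOfDegree
    (F := fun l : Fin 4 => incidencePoly γ (Pi.single l 1) e) (e := 2 * d - 2)
    (fun l => hγ.natDegree_incidencePoly_le _ _)
    (fun z => by
      obtain ⟨l, hl⟩ := hex _ _ (hγ.exists_minor _ (chart_ne_zero z)) (he z)
      exact ⟨l, by rwa [eval_incidencePoly]⟩)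
    (by
      obtain ⟨l, hl⟩ := hex _ _ (hγ.exists_minor _ infty_ne_zero) he'
      exact ⟨l, by rwa [hγ.coeff_incidencePoly]⟩)
  have hsum : ∑ l, C (c l) * incidencePoly γ (Pi.single l 1) e = incidencePoly γ c e := by
    refine Polynomial.funext fun z => ?_
    rw [eval_incidencePoly, hlin, eval_finsetSum]
    simp only [eval_mul, eval_C, eval_incidencePoly]
  rw [hsum] at hc
  set f : (MvPolynomial (Fin 2 × Fin 4) ℂ)[X] :=
    incidence (fun l => (chartDeriv γ 0 l).map MvPolynomial.C)
      (fun l => (chartDeriv γ 1 l).map MvPolynomial.C)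
      (fun l => C (MvPolynomial.X (0, l))) (fun l => C (MvPolynomial.X (1, l))) with hf
  have hmap : ∀ x : Fin 2 × Fin 4 → ℂ, f.map (MvPolynomial.eval x) =
      incidencePoly γ (fun i => x (0, i)) (fun i => x (1, i)) := by
    intro x
    have hid : (MvPolynomial.eval x).comp (MvPolynomial.C : ℂ →+* MvPolynomial _ ℂ) =
        RingHom.id ℂ := by
      ext; simp
    refine (map_incidence (mapRingHom (MvPolynomial.eval x)) _ _ _ _).trans ?_
    simp only [coe_mapRingHom, Polynomial.map_map, hid, Polynomial.map_id, map_C,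
      MvPolynomial.eval_X]
    rfl
  have hfdeg : f.natDegree ≤ 2 * d - 2 := by
    refine natDegree_incidence_le (fun i j => ?_) _ _
    have h1 : minor (fun l => (chartDeriv γ 0 l).map MvPolynomial.C)
        (fun l => (chartDeriv γ 1 l).map MvPolynomial.C) i j =
        (minor (chartDeriv γ 0) (chartDeriv γ 1) i j).map
          (MvPolynomial.C : ℂ →+* MvPolynomial (Fin 2 × Fin 4) ℂ) := by
      simp only [minor, Polynomial.map_sub, Polynomial.map_mul]
    rw [h1]
    exact natDegree_map_le.trans (hγ.natDegree_minor_chartDeriv_le i j)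
  have h := IsGeneric.separableOfDegree hfdeg (x₀ := fun p => if p.1 = 0 then c p.2 else e p.2)
    (by rw [hmap]; simpa using hc)
  simpa only [hmap] using h

/-- The tangent lines meeting a generic line are those at the zeros of `incidencePoly`, and these
zeros have nonsingular images and distinct tangent lines since they avoid a given finite set. -/
theorem hasRank (hγ : Immersion d γ) : HasRank (curveImage γ) (2 * d - 2) := by
  obtain ⟨E, hE, hE₁, hE₂⟩ : ∃ E : Set ℂ, E.Finite ∧ multiplePoints γ ⊆ E ∧
      (2 ≤ d → bitangentPoints γ ⊆ E) := by
    by_cases hd : 2 ≤ d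
    · exact ⟨_, hγ.finite_multiplePoints.union (hγ.finite_bitangentPoints hd),
        Set.subset_union_left, fun _ => Set.subset_union_right⟩
    · exact ⟨_, hγ.finite_multiplePoints, subset_rfl, fun h => absurd h hd⟩
  have hEgen : ∀ z ∈ E, IsGeneric fun x : Fin 2 × Fin 4 → ℂ =>
      (incidencePoly γ (fun i => x (0, i)) (fun i => x (1, i))).eval z ≠ 0 := by
    intro z _
    obtain ⟨e, he⟩ := (IsGeneric.notMem (span_pair_ne_top (paramDeriv γ 0 ![z, 1])
      (paramDeriv γ 1 ![z, 1]))).exists_mem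
    obtain ⟨c, hc⟩ := (IsGeneric.notMem (span_triple_ne_top e (paramDeriv γ 0 ![z, 1])
      (paramDeriv γ 1 ![z, 1]))).exists_mem
    have hev : ∀ x : Fin 2 × Fin 4 → ℂ, MvPolynomial.eval x
        (incidence (fun l => MvPolynomial.C (paramDeriv γ 0 ![z, 1] l))
          (fun l => MvPolynomial.C (paramDeriv γ 1 ![z, 1] l))
          (fun l => MvPolynomial.X (0, l)) (fun l => MvPolynomial.X (1, l))) =
        (incidencePoly γ (fun i => x (0, i)) (fun i => x (1, i))).eval z := by
      intro x
      rw [eval_incidencePoly]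
      refine (map_incidence (MvPolynomial.eval x) _ _ _ _).trans ?_
      simp only [MvPolynomial.eval_C, MvPolynomial.eval_X]
    refine IsGeneric.of_eval_ne_zero _ (x₀ := fun p => if p.1 = 0 then c p.2 else e p.2) ?_
      fun x hx => by rwa [hev] at hx
    rw [hev, eval_incidencePoly]
    simpa using incidence_ne_zero (hγ.exists_minor _ (chart_ne_zero z)) he hc
  refine (hγ.isGeneric_incidencePoly.and (IsGeneric.forall_mem_finite hE hEgen)).mono ?_
  rintro x ⟨hx, hxE⟩
  set c : Fin 4 → ℂ := fun i => x (0, i) with hc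
  set e : Fin 4 → ℂ := fun i => x (1, i) with he
  set f := incidencePoly γ c e with hf
  have hce : ∃ i j, minor c e i j ≠ 0 := by
    by_contra! h0
    apply hx.2.1
    rw [hγ.coeff_incidencePoly]
    simp [incidence, h0]
  have himage : {L : Submodule ℂ (Fin 4 → ℂ) |
      (∃ m, IsNonsingularPoint (curveImage γ) m ∧ L = tangentLine (curveImage γ) m) ∧
        L ⊓ Submodule.span ℂ {c, e} ≠ ⊥} =
      (fun z : ℂ => tangentSpan γ ![z, 1]) '' f.roots.toFinset := by
    ext L
    simp only [Set.mem_ofPred_eq, Set.mem_image, Finset.mem_coe, Multiset.mem_toFinset,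
      mem_roots hx.ne_zero, IsRoot.def]
    constructor
    · rintro ⟨⟨m, hm, rfl⟩, hL⟩
      obtain ⟨k, hk, ⟨z, hz⟩ | hz⟩ := hγ.exists_rep_of_mem hm.1
      · have hT := hγ.tangentLine_eq_of_isNonsingularPoint (chart_ne_zero z) hz hm
        refine ⟨z, ?_, hT.symm⟩
        by_contra h0
        rw [hf, eval_incidencePoly] at h0
        rw [hT] at hL
        exact hL (inf_span_eq_bot h0)
      · have hT := hγ.tangentLine_eq_of_isNonsingularPoint infty_ne_zero hz hm
        have h0 := hx.2.1
        rw [hγ.coeff_incidencePoly] at h0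
        rw [hT] at hL
        exact absurd (inf_span_eq_bot h0) hL
    · rintro ⟨z, hz, rfl⟩
      have hzE : z ∉ multiplePoints γ := fun h => hxE z (hE₁ h) hz
      obtain ⟨k, hk, hkz⟩ := hγ.exists_rep_point z
      have hm := hγ.isNonsingularPoint hzE hk hkz
      refine ⟨⟨_, hm, (hγ.tangentLine_eq_of_isNonsingularPoint (chart_ne_zero z) hkz hm).symm⟩, ?_⟩
      rw [hf, eval_incidencePoly] at hz
      exact inf_span_ne_bot hz (hγ.exists_minor _ (chart_ne_zero z)) hce
  rw [himage, Set.InjOn.encard_image, Set.encard_coe_eq_coe_finsetCard, hx.card_roots]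
  intro z hz t _ hzt
  by_contra hne
  have hzf : f.eval z = 0 := by simpa [hx.ne_zero] using hz
  -- For `d = 1` the polynomial `f` is a nonzero constant and has no zeros.
  have hd : 2 ≤ d := by
    by_contra hd
    have h1 := card_roots' f
    have h2 : z ∈ f.roots := by simpa using hz
    have h3 := Multiset.card_pos_iff_exists_mem.mpr ⟨z, h2⟩
    have h4 := hx.natDegree_eq
    omega
  exact hxE z (hE₂ hd ⟨_, chart_ne_zero t, chart_ne_smul (Ne.symm hne), hzt⟩) hzf

end Immersion

end Halphen

namespace Halphen

open Polynomial

/-! ### The bilinear form of a quadric -/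

section Bilinear

variable {R S : Type*} [CommRing R] [Algebra ℂ R] [CommRing S] [Algebra ℂ S]

/-- The symmetrized products of the coordinates of two vectors. -/
def symPair (x y : Fin 4 → R) : Sym2 (Fin 4) → R :=
  Sym2.lift ⟨fun a b => x a * y b + x b * y a, fun a b => by ring⟩

/-- The symmetric bilinear form with `bilin q x x = 2 Q(x)`, where `Q` is the quadratic form with
coefficients `q`. -/
noncomputable def bilin (q : Sym2 (Fin 4) → ℂ) (x y : Fin 4 → R) : R :=
  ∑ s, algebraMap ℂ R (q s) * symPair x y s

variable (q : Sym2 (Fin 4) → ℂ)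

theorem bilin_comm (x y : Fin 4 → R) : bilin q x y = bilin q y x := by
  refine Finset.sum_congr rfl fun s _ => ?_
  induction s using Sym2.ind with
  | _ a b =>
    simp only [symPair, Sym2.lift_mk]
    ring

theorem bilin_linear_right (x y z : Fin 4 → R) (a b : R) :
    bilin q x (fun i => a * y i + b * z i) = a * bilin q x y + b * bilin q x z := by
  simp only [bilin, Finset.mul_sum, ← Finset.sum_add_distrib]
  refine Finset.sum_congr rfl fun s _ => ?_
  induction s using Sym2.ind with
  | _ a b =>
    simp only [symPair, Sym2.lift_mk]
    ring

theorem bilin_linear_left (x y z : Fin 4 → R) (a b : R) :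
    bilin q (fun i => a * y i + b * z i) x = a * bilin q y x + b * bilin q z x := by
  rw [bilin_comm, bilin_linear_right, bilin_comm q x y, bilin_comm q x z]

theorem bilin_smul_left (x y : Fin 4 → ℂ) (a : ℂ) :
    bilin q (a • x) y = a * bilin q x y := by
  have h := bilin_linear_left q y x x a 0
  simp only [zero_mul, add_zero] at h
  exact h

theorem map_bilin (f : R →ₐ[ℂ] S) (x y : Fin 4 → R) :
    f (bilin q x y) = bilin q (fun i => f (x i)) (fun i => f (y i)) := by
  rw [bilin, map_sum]
  refine Finset.sum_congr rfl fun s _ => ?_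
  rw [map_mul, AlgHom.commutes]
  induction s using Sym2.ind with
  | _ a b => simp only [symPair, Sym2.lift_mk, map_add, map_mul]

theorem derivation_bilin (D : Derivation ℂ R R) (x y : Fin 4 → R) :
    D (bilin q x y) = bilin q (fun i => D (x i)) y + bilin q x (fun i => D (y i)) := by
  simp only [bilin, map_sum, ← Finset.sum_add_distrib]
  refine Finset.sum_congr rfl fun s _ => ?_
  rw [Derivation.leibniz, Derivation.map_algebraMap, smul_zero, add_zero, smul_eq_mul, ← mul_add]
  congr 1
  induction s using Sym2.ind with
  | _ a b =>
    simp only [symPair, Sym2.lift_mk, map_add, Derivation.leibniz, smul_eq_mul]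
    ring

theorem sum_mul_eval_pderiv_quadricForm (x y : Fin 4 → ℂ) :
    ∑ i, x i * MvPolynomial.eval y (MvPolynomial.pderiv i (quadricForm q)) = bilin q x y := by
  simp only [quadricForm, map_sum, Finset.mul_sum, bilin]
  rw [Finset.sum_comm]
  refine Finset.sum_congr rfl fun s _ => ?_
  induction s using Sym2.ind with
  | _ a b =>
    simp only [Sym2.map_mk, Sym2.mul_mk, symPair, Sym2.lift_mk, MvPolynomial.pderiv_mul,
      MvPolynomial.pderiv_C, zero_mul, zero_add, map_mul, map_add, MvPolynomial.eval_C,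
      MvPolynomial.pderiv_X, MvPolynomial.eval_X, Algebra.algebraMap_self, RingHom.id_apply]
    simp only [Pi.single_apply, apply_ite (MvPolynomial.eval y), map_one, map_zero]
    simp only [mul_add, mul_ite, ite_mul, mul_one, mul_zero, zero_mul, Finset.sum_add_distrib,
      Finset.sum_ite_eq, Finset.mem_univ, if_true]
    ring

theorem bilin_single (i j : Fin 4) (x y : Fin 4 → ℂ) :
    bilin (Pi.single s(i, i) 1 + Pi.single s(j, j) 1) x y = 2 * (x i * y i + x j * y j) := by
  simp only [bilin, Pi.add_apply, map_add, add_mul, Finset.sum_add_distrib]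
  rw [Finset.sum_eq_single s(i, i), Finset.sum_eq_single s(j, j)]
  · simp [symPair]
    ring
  all_goals simp +contextual

/-- A generic quadric is not tangent to a given line. -/
theorem IsGeneric.discr_ne_zero {a b : Fin 4 → ℂ} (hab : ∃ i j, minor a b i j ≠ 0) :
    IsGeneric fun q : Sym2 (Fin 4) → ℂ =>
      bilin q a a * bilin q b b - bilin q a b ^ 2 ≠ 0 := by
  obtain ⟨i, j, hij⟩ := hab
  have hev : ∀ (q : Sym2 (Fin 4) → ℂ) (x y : Fin 4 → ℂ), MvPolynomial.eval q
      (∑ s, MvPolynomial.X s * MvPolynomial.C (symPair x y s)) = bilin q x y := by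
    intro q x y
    simp [bilin]
  refine IsGeneric.of_eval_ne_zero
    ((∑ s, MvPolynomial.X s * MvPolynomial.C (symPair a a s)) *
      (∑ s, MvPolynomial.X s * MvPolynomial.C (symPair b b s)) -
      (∑ s, MvPolynomial.X s * MvPolynomial.C (symPair a b s)) ^ 2)
    (x₀ := Pi.single s(i, i) 1 + Pi.single s(j, j) 1) ?_ fun q hq => ?_
  · rw [map_sub, map_mul, map_pow, hev, hev, hev, bilin_single, bilin_single, bilin_single]
    have : (2 * (a i * a i + a j * a j)) * (2 * (b i * b i + b j * b j)) -
        (2 * (a i * b i + a j * b j)) ^ 2 = 4 * minor a b i j ^ 2 := by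
      rw [minor]
      ring
    rw [this]
    exact mul_ne_zero (by norm_num) (pow_ne_zero _ hij)
  · rwa [map_sub, map_mul, map_pow, hev, hev, hev] at hq

end Bilinear

variable {d : ℕ} {γ : Fin 4 → MvPolynomial (Fin 2) ℂ}

/-! ### Intersection of the curve with a quadric -/

namespace Immersion

/-- A generic quadric meets the curve in points with `2d` distinct parameters, so it is nowhere
tangent to the curve. -/
theorem isGeneric_transverse (hγ : Immersion d γ) :
    IsGeneric fun q : Sym2 (Fin 4) → ℂ => ∀ s : Fin 2 → ℂ, s ≠ 0 →
      bilin q (paramEval γ s) (paramDeriv γ 0 s) ≠ 0 ∨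
      bilin q (paramEval γ s) (paramDeriv γ 1 s) ≠ 0 := by
  have hg := hγ.affineImmersion
  set g : Fin 4 → ℂ[X] := fun i => dehom (γ i) with hgdef
  have hcoeff : ∀ s : Sym2 (Fin 4), 2 * ((s.map g).mul).coeff (d + d) =
      symPair (paramEval γ ![1, 0]) (paramEval γ ![1, 0]) s := by
    intro s
    induction s using Sym2.ind with
    | _ a b =>
      rw [Sym2.map_mk, Sym2.mul_mk, hγ.paramEval_infty,
        coeff_mul_add_eq_of_natDegree_le (hg.natDegree_le a) (hg.natDegree_le b)]
      simp only [symPair, Sym2.lift_mk]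
      ring
  have heval : ∀ (s : Sym2 (Fin 4)) (z : ℂ), 2 * ((s.map g).mul).eval z =
      symPair (paramEval γ ![z, 1]) (paramEval γ ![z, 1]) s := by
    intro s z
    induction s using Sym2.ind with
    | _ a b =>
      rw [Sym2.map_mk, Sym2.mul_mk, paramEval_chart, eval_mul]
      simp only [symPair, Sym2.lift_mk]
      ring
  have hderiv : ∀ (s : Sym2 (Fin 4)) (z : ℂ), (derivative (s.map g).mul).eval z =
      symPair (paramEval γ ![z, 1]) (paramDeriv γ 0 ![z, 1]) s := by
    intro s z
    induction s using Sym2.ind with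
    | _ a b =>
      rw [Sym2.map_mk, Sym2.mul_mk, paramEval_chart, paramDeriv_zero_chart, derivative_mul,
        eval_add, eval_mul, eval_mul]
      simp only [symPair, Sym2.lift_mk]
      ring
  refine (IsGeneric.separableOfDegree_sum (F := fun s : Sym2 (Fin 4) => (s.map g).mul)
    (e := d + d) ?_ ?_ ?_).mono ?_
  · intro s
    induction s using Sym2.ind with
    | _ a b =>
      rw [Sym2.map_mk, Sym2.mul_mk]
      exact natDegree_mul_le.trans (add_le_add (hg.natDegree_le a) (hg.natDegree_le b))
  · intro z
    obtain ⟨i, hi⟩ := hg.exists_eval_ne_zero z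
    exact ⟨s(i, i), by simpa using hi⟩
  · obtain ⟨i, hi⟩ := hg.exists_coeff_ne_zero
    refine ⟨s(i, i), ?_⟩
    rw [Sym2.map_mk, Sym2.mul_mk,
      coeff_mul_add_eq_of_natDegree_le (hg.natDegree_le i) (hg.natDegree_le i)]
    exact mul_ne_zero hi hi
  intro q hq
  have key : ∀ s : Fin 2 → ℂ, bilin q (paramEval γ s) (paramDeriv γ 0 s) = 0 →
      bilin q (paramEval γ s) (paramDeriv γ 1 s) = 0 →
      bilin q (paramEval γ s) (paramEval γ s) = 0 := by
    intro s h0 h1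
    have h := bilin_linear_right q (paramEval γ s) (paramDeriv γ 0 s) (paramDeriv γ 1 s) (s 0) (s 1)
    rw [h0, h1, funext (hγ.euler s)] at h
    have h' := bilin_linear_right q (paramEval γ s) (paramEval γ s) 0 d 0
    simp only [Pi.zero_apply, mul_zero, add_zero, zero_mul] at h'
    rw [h', mul_zero, mul_zero, add_zero] at h
    exact (mul_eq_zero.mp h).resolve_left hγ.cast_ne_zero
  intro s hs
  by_contra! h
  obtain ⟨l, hl, ⟨z, rfl⟩ | rfl⟩ := exists_smul_chart hs
  · rw [hγ.paramEval_smul, hγ.paramDeriv_smul, hγ.paramDeriv_smul, bilin_smul_left,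
      bilin_smul_left, bilin_comm q _ (_ • _), bilin_comm q _ (_ • _), bilin_smul_left,
      bilin_smul_left] at h
    simp only [mul_eq_zero, pow_eq_zero_iff', hl, false_and, false_or,
      bilin_comm q (paramDeriv _ _ _)] at h
    refine hq.eval_derivative_ne_zero (z := z) ?_ ?_
    · have h1 := key _ h.1 h.2
      refine (mul_eq_zero.mp (?_ : (2 : ℂ) * _ = 0)).resolve_left two_ne_zero
      rw [← h1, eval_finsetSum, bilin, Finset.mul_sum]
      refine Finset.sum_congr rfl fun s _ => ?_
      rw [eval_mul, eval_C, ← heval, Algebra.algebraMap_self, RingHom.id_apply]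
      ring
    · rw [← h.1, derivative_sum, eval_finsetSum, bilin]
      refine Finset.sum_congr rfl fun s _ => ?_
      rw [derivative_C_mul, eval_mul, eval_C, hderiv, Algebra.algebraMap_self, RingHom.id_apply]
  · rw [hγ.paramEval_smul, hγ.paramDeriv_smul, hγ.paramDeriv_smul, bilin_smul_left,
      bilin_smul_left, bilin_comm q _ (_ • _), bilin_comm q _ (_ • _), bilin_smul_left,
      bilin_smul_left] at h
    simp only [mul_eq_zero, pow_eq_zero_iff', hl, false_and, false_or,
      bilin_comm q (paramDeriv _ _ _)] at h
    refine hq.2.1 ?_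
    have h1 := key _ h.1 h.2
    refine (mul_eq_zero.mp (?_ : (2 : ℂ) * _ = 0)).resolve_left two_ne_zero
    rw [← h1, finsetSum_coeff, bilin, Finset.mul_sum]
    refine Finset.sum_congr rfl fun s _ => ?_
    rw [coeff_C_mul, ← hcoeff, Algebra.algebraMap_self, RingHom.id_apply]
    ring

end Immersion

end Halphen

namespace Halphen

open Polynomial

variable {d : ℕ} {γ : Fin 4 → MvPolynomial (Fin 2) ℂ} {q : Sym2 (Fin 4) → ℂ}

/-! ### The parametrization of the Halphen transform -/

/-- If `a, b, c` are the values of a parametrized curve and of its first two derivatives, and `B` is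
the bilinear form of a quadric, the two vectors are the value of `B(a, b) a - B(a, a) b` and of its
derivative. Away from the flexes they are independent as soon as the coefficients do not both
vanish; at a flex their bivector is `a ∧ b` times the discriminant of `B` on the tangent line. -/
theorem exists_minor_bilin_ne_zero {a b c : Fin 4 → ℂ} (hab : ∃ i j, minor a b i j ≠ 0)
    (hq : bilin q a a ≠ 0 ∨ bilin q a b ≠ 0)
    (hflex : (∀ i j k, minor₃ a b c i j k = 0) →
      bilin q a a * bilin q b b - bilin q a b ^ 2 ≠ 0) :
    ∃ i j, minor (fun l => bilin q a b * a l - bilin q a a * b l)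
      (fun l => (bilin q b b + bilin q a c) * a l - bilin q a b * b l - bilin q a a * c l) i j
        ≠ 0 := by
  by_contra! h
  obtain ⟨i, j, hij⟩ := hab
  have hA : bilin q a a ≠ 0 := by
    intro hA
    refine hq.elim (· hA) fun hB => mul_ne_zero (pow_ne_zero 2 hB) hij ?_
    have h1 := h i j
    rw [hA] at h1
    simp only [minor] at h1 ⊢
    linear_combination -h1
  have h3 : ∀ i j k, minor₃ a b c i j k = 0 := by
    intro i j k
    refine (mul_eq_zero.mp (?_ : bilin q a a ^ 2 * _ = 0)).resolve_left (pow_ne_zero 2 hA)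
    have h1 := h i j
    have h2 := h j k
    have h3 := h k i
    simp only [minor, minor₃] at h1 h2 h3 ⊢
    linear_combination a k * h1 + a i * h2 + a j * h3
  refine mul_ne_zero (hflex h3) hij ?_
  obtain ⟨x, y, hc⟩ := exists_eq_of_minor₃_eq_zero ⟨i, j, hij⟩ h3
  have hE : bilin q a c = x * bilin q a a + y * bilin q a b := by
    rw [funext hc, bilin_linear_right]
  have h1 := h i j
  simp only [minor, hc, hE] at h1 ⊢
  linear_combination h1

theorem eval_bilin (x y : Fin 4 → MvPolynomial (Fin 2) ℂ) (s : Fin 2 → ℂ) :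
    MvPolynomial.eval s (bilin q x y) = bilin q (paramEval x s) (paramEval y s) := by
  have h := map_bilin q (MvPolynomial.aeval s) x y
  simp only [MvPolynomial.aeval_eq_eval] at h
  exact h

/-- The parametrization `B(γ, γ_v) γ_u - B(γ, γ_u) γ_v` of the intersection of the tangent line at
`γ` with the polar plane of `γ`, where `B = bilin q`. -/
noncomputable def halphenParam (q : Sym2 (Fin 4) → ℂ) (γ : Fin 4 → MvPolynomial (Fin 2) ℂ) :
    Fin 4 → MvPolynomial (Fin 2) ℂ := fun i =>
  bilin q γ (fun l => MvPolynomial.pderiv 1 (γ l)) * MvPolynomial.pderiv 0 (γ i) -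
    bilin q γ (fun l => MvPolynomial.pderiv 0 (γ l)) * MvPolynomial.pderiv 1 (γ i)

/-- The quadruple `B(γ, γ') γ - B(γ, γ) γ'`, where `B = bilin q` and `'` is the derivative with
respect to the `k`-th variable. It is proportional to `halphenParam q γ`, with the advantage that
its own derivative with respect to the same variable is expressed by `γ`, `γ'` and `γ''`. -/
noncomputable def halphenChart (q : Sym2 (Fin 4) → ℂ) (γ : Fin 4 → MvPolynomial (Fin 2) ℂ)
    (k : Fin 2) : Fin 4 → MvPolynomial (Fin 2) ℂ := fun i =>
  bilin q γ (fun l => MvPolynomial.pderiv k (γ l)) * γ i -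
    bilin q γ γ * MvPolynomial.pderiv k (γ i)

theorem paramEval_pderiv (γ : Fin 4 → MvPolynomial (Fin 2) ℂ) (k : Fin 2) (s : Fin 2 → ℂ) :
    paramEval (fun l => MvPolynomial.pderiv k (γ l)) s = paramDeriv γ k s :=
  rfl

theorem paramEval_halphenParam (s : Fin 2 → ℂ) :
    paramEval (halphenParam q γ) s = bilin q (paramEval γ s) (paramDeriv γ 1 s) • paramDeriv γ 0 s -
      bilin q (paramEval γ s) (paramDeriv γ 0 s) • paramDeriv γ 1 s := by
  funext i
  simp only [paramEval, halphenParam, map_sub, map_mul, eval_bilin]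
  rfl

theorem paramEval_halphenChart (k : Fin 2) (s : Fin 2 → ℂ) :
    paramEval (halphenChart q γ k) s = fun l =>
      bilin q (paramEval γ s) (paramDeriv γ k s) * paramEval γ s l -
        bilin q (paramEval γ s) (paramEval γ s) * paramDeriv γ k s l := by
  funext i
  simp only [paramEval, halphenChart, map_sub, map_mul, eval_bilin]
  rfl

theorem paramDeriv_halphenChart (k : Fin 2) (s : Fin 2 → ℂ) :
    paramDeriv (halphenChart q γ k) k s = fun l =>
      (bilin q (paramDeriv γ k s) (paramDeriv γ k s) + bilin q (paramEval γ s)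
        (paramDeriv (fun i => MvPolynomial.pderiv k (γ i)) k s)) * paramEval γ s l -
      bilin q (paramEval γ s) (paramDeriv γ k s) * paramDeriv γ k s l -
        bilin q (paramEval γ s) (paramEval γ s) *
          paramDeriv (fun i => MvPolynomial.pderiv k (γ i)) k s l := by
  funext i
  rw [paramDeriv, halphenChart]
  simp only [map_sub, map_add, map_mul, MvPolynomial.pderiv_mul,
    derivation_bilin, eval_bilin, paramEval_pderiv, bilin_comm q (paramDeriv γ k s) (paramEval γ s)]
  simp only [paramEval, paramDeriv]
  ring

namespace Immersion

theorem sum_X_mul_pderiv (hγ : Immersion d γ) (i : Fin 4) :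
    MvPolynomial.X 0 * MvPolynomial.pderiv 0 (γ i) +
      MvPolynomial.X 1 * MvPolynomial.pderiv 1 (γ i) = (d : MvPolynomial (Fin 2) ℂ) * γ i := by
  have h := (hγ.isHomogeneous i).sum_X_mul_pderiv
  simpa [Fin.sum_univ_two] using h

theorem mul_bilin_self (hγ : Immersion d γ) :
    (d : MvPolynomial (Fin 2) ℂ) * bilin q γ γ =
      MvPolynomial.X 0 * bilin q γ (fun l => MvPolynomial.pderiv 0 (γ l)) +
      MvPolynomial.X 1 * bilin q γ (fun l => MvPolynomial.pderiv 1 (γ l)) := by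
  have h := bilin_linear_right q γ γ 0 (d : MvPolynomial (Fin 2) ℂ) 0
  simp only [Pi.zero_apply, mul_zero, add_zero, zero_mul] at h
  rw [← h, ← bilin_linear_right]
  simp only [hγ.sum_X_mul_pderiv]

theorem mul_halphenChart_zero (hγ : Immersion d γ) (i : Fin 4) :
    (d : MvPolynomial (Fin 2) ℂ) * halphenChart q γ 0 i =
      -MvPolynomial.X 1 * halphenParam q γ i := by
  have h1 := hγ.sum_X_mul_pderiv i
  have h2 := hγ.mul_bilin_self (q := q)
  simp only [halphenChart, halphenParam]
  linear_combination -bilin q γ (fun l => MvPolynomial.pderiv 0 (γ l)) * h1 -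
    MvPolynomial.pderiv 0 (γ i) * h2

theorem mul_halphenChart_one (hγ : Immersion d γ) (i : Fin 4) :
    (d : MvPolynomial (Fin 2) ℂ) * halphenChart q γ 1 i =
      MvPolynomial.X 0 * halphenParam q γ i := by
  have h1 := hγ.sum_X_mul_pderiv i
  have h2 := hγ.mul_bilin_self (q := q)
  simp only [halphenChart, halphenParam]
  linear_combination -bilin q γ (fun l => MvPolynomial.pderiv 1 (γ l)) * h1 -
    MvPolynomial.pderiv 1 (γ i) * h2

/-- The conditions under which `halphenParam q γ` is an immersion: the quadric is nowhere tangent to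
the curve, and not tangent to the inflectional tangent lines nor to the tangent at infinity. -/
structure GoodQuadric (q : Sym2 (Fin 4) → ℂ) (γ : Fin 4 → MvPolynomial (Fin 2) ℂ) : Prop where
  transverse : ∀ s : Fin 2 → ℂ, s ≠ 0 →
    bilin q (paramEval γ s) (paramDeriv γ 0 s) ≠ 0 ∨
    bilin q (paramEval γ s) (paramDeriv γ 1 s) ≠ 0
  flex : ∀ z : ℂ, (∀ i j k, minor₃ (paramEval γ ![z, 1]) (paramDeriv γ 0 ![z, 1])
      (paramDeriv (fun i => MvPolynomial.pderiv 0 (γ i)) 0 ![z, 1]) i j k = 0) →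
    bilin q (paramEval γ ![z, 1]) (paramEval γ ![z, 1]) *
      bilin q (paramDeriv γ 0 ![z, 1]) (paramDeriv γ 0 ![z, 1]) -
      bilin q (paramEval γ ![z, 1]) (paramDeriv γ 0 ![z, 1]) ^ 2 ≠ 0
  infty : bilin q (paramEval γ ![1, 0]) (paramEval γ ![1, 0]) *
      bilin q (paramDeriv γ 1 ![1, 0]) (paramDeriv γ 1 ![1, 0]) -
      bilin q (paramEval γ ![1, 0]) (paramDeriv γ 1 ![1, 0]) ^ 2 ≠ 0

theorem exists_minor_chart (hγ : Immersion d γ) (z : ℂ) :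
    ∃ i j, minor (paramEval γ ![z, 1]) (paramDeriv γ 0 ![z, 1]) i j ≠ 0 := by
  rw [paramEval_chart, paramDeriv_zero_chart]
  exact hγ.affineImmersion.exists_minor z

theorem exists_minor_infty (hγ : Immersion d γ) :
    ∃ i j, minor (paramEval γ ![1, 0]) (paramDeriv γ 1 ![1, 0]) i j ≠ 0 := by
  obtain ⟨i, j, hij⟩ := hγ.exists_minor _ infty_ne_zero
  refine ⟨i, j, fun h => hij ?_⟩
  have hi := hγ.euler ![1, 0] i
  have hj := hγ.euler ![1, 0] j
  simp only [Matrix.cons_val_zero, Matrix.cons_val_one, one_mul, zero_mul, add_zero] at hi hj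
  simp only [minor] at h ⊢
  rw [hi, hj]
  linear_combination (d : ℂ) * h

theorem isGeneric_goodQuadric (hγ : Immersion d γ) :
    IsGeneric fun q : Sym2 (Fin 4) → ℂ => GoodQuadric q γ := by
  have hflex : IsGeneric fun q : Sym2 (Fin 4) → ℂ =>
      ∀ z : ℂ, (∀ i j k, minor₃ (paramEval γ ![z, 1]) (paramDeriv γ 0 ![z, 1])
        (paramDeriv (fun i => MvPolynomial.pderiv 0 (γ i)) 0 ![z, 1]) i j k = 0) →
      bilin q (paramEval γ ![z, 1]) (paramEval γ ![z, 1]) *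
        bilin q (paramDeriv γ 0 ![z, 1]) (paramDeriv γ 0 ![z, 1]) -
        bilin q (paramEval γ ![z, 1]) (paramDeriv γ 0 ![z, 1]) ^ 2 ≠ 0 := by
    rcases hγ.one_le.eq_or_lt with rfl | hd
    · -- For a line, the discriminant does not depend on the point.
      refine (IsGeneric.discr_ne_zero (hγ.exists_minor 1 one_ne_zero)).mono fun q hq z _ h0 =>
        hq ?_
      have hconst : ∀ (k : Fin 2) (s : Fin 2 → ℂ), paramDeriv γ k s = paramDeriv γ k 0 := by
        intro k s
        have := hγ.paramDeriv_smul k 0 s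
        simpa using this.symm
      have hx : paramEval γ ![z, 1] =
          fun i => z * paramDeriv γ 0 0 i + 1 * paramDeriv γ 1 0 i := by
        funext i
        have h := hγ.euler ![z, 1] i
        simpa [hconst] using h.symm
      rw [hconst 0, hx, bilin_linear_right, bilin_linear_left, bilin_linear_left,
        bilin_comm q (paramDeriv γ 1 0) (paramDeriv γ 0 0)] at h0
      rw [hconst 0, hconst 1]
      linear_combination h0
    · refine (IsGeneric.forall_mem_finite (hγ.affineImmersion.finite_flexes hd) fun z _ =>
        IsGeneric.discr_ne_zero (hγ.exists_minor_chart z)).mono fun q hq z hz => hq z ?_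
      have h2 : paramDeriv (fun i => MvPolynomial.pderiv 0 (γ i)) 0 ![z, 1] =
          fun l => (derivative (derivative (dehom (γ l)))).eval z := by
        rw [paramDeriv_zero_chart]
        simp only [derivative_dehom]
      rwa [paramEval_chart, paramDeriv_zero_chart, h2] at hz
  exact ((hγ.isGeneric_transverse.and hflex).and
    (IsGeneric.discr_ne_zero hγ.exists_minor_infty)).mono fun q hq => ⟨hq.1.1, hq.1.2, hq.2⟩

theorem isHomogeneous_bilin (hγ : Immersion d γ) (k : Fin 2) :
    (bilin q γ (fun l => MvPolynomial.pderiv k (γ l))).IsHomogeneous (d + (d - 1)) := by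
  refine MvPolynomial.IsHomogeneous.sum _ _ _ fun s _ => ?_
  induction s using Sym2.ind with
  | _ a b =>
    exact (((hγ.isHomogeneous a).mul (hγ.isHomogeneous b).pderiv).add
      ((hγ.isHomogeneous b).mul (hγ.isHomogeneous a).pderiv)).C_mul _

theorem isHomogeneous_halphenParam (hγ : Immersion d γ) (i : Fin 4) :
    (halphenParam q γ i).IsHomogeneous (3 * d - 2) := by
  have h0 := (hγ.isHomogeneous_bilin (q := q) 1).mul ((hγ.isHomogeneous i).pderiv (i := 0))
  have h1 := (hγ.isHomogeneous_bilin (q := q) 0).mul ((hγ.isHomogeneous i).pderiv (i := 1))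
  have := hγ.one_le
  rw [show d + (d - 1) + (d - 1) = 3 * d - 2 by omega] at h0 h1
  exact h0.sub h1

theorem paramDeriv_halphenChart_zero (hγ : Immersion d γ) (s : Fin 2 → ℂ) (i : Fin 4) :
    d * paramDeriv (halphenChart q γ 0) 0 s i = -s 1 * paramDeriv (halphenParam q γ) 0 s i := by
  have h := congr_arg (fun F => MvPolynomial.eval s (MvPolynomial.pderiv 0 F))
    (hγ.mul_halphenChart_zero (q := q) i)
  simpa [MvPolynomial.pderiv_mul, MvPolynomial.pderiv_X, paramDeriv] using h

theorem paramDeriv_halphenChart_one (hγ : Immersion d γ) (s : Fin 2 → ℂ) (i : Fin 4) :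
    d * paramDeriv (halphenChart q γ 1) 1 s i = s 0 * paramDeriv (halphenParam q γ) 1 s i := by
  have h := congr_arg (fun F => MvPolynomial.eval s (MvPolynomial.pderiv 1 F))
    (hγ.mul_halphenChart_one (q := q) i)
  simpa [MvPolynomial.pderiv_mul, MvPolynomial.pderiv_X, paramDeriv] using h

theorem paramEval_halphenChart_zero (hγ : Immersion d γ) (s : Fin 2 → ℂ) (i : Fin 4) :
    d * paramEval (halphenChart q γ 0) s i = -s 1 * paramEval (halphenParam q γ) s i := by
  simpa [paramEval] using congr_arg (MvPolynomial.eval s) (hγ.mul_halphenChart_zero (q := q) i)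

theorem paramEval_halphenChart_one (hγ : Immersion d γ) (s : Fin 2 → ℂ) (i : Fin 4) :
    d * paramEval (halphenChart q γ 1) s i = s 0 * paramEval (halphenParam q γ) s i := by
  simpa [paramEval] using congr_arg (MvPolynomial.eval s) (hγ.mul_halphenChart_one (q := q) i)

theorem bilin_self_ne_zero_or_zero (hγ : Immersion d γ) (hq : GoodQuadric q γ) {s : Fin 2 → ℂ}
    (hs : s 1 ≠ 0) : bilin q (paramEval γ s) (paramEval γ s) ≠ 0 ∨
      bilin q (paramEval γ s) (paramDeriv γ 0 s) ≠ 0 := by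
  by_contra! h
  have h1 := congr_arg (MvPolynomial.eval s) (hγ.mul_bilin_self (q := q))
  simp only [map_mul, map_add, eval_bilin, MvPolynomial.eval_X, paramEval_pderiv, h.1, h.2,
    mul_zero, zero_add] at h1
  exact (hq.transverse s fun h => hs (by simp [h])).elim (· h.2) fun h2 => mul_ne_zero hs h2 h1.symm

theorem bilin_self_ne_zero_or_one (hγ : Immersion d γ) (hq : GoodQuadric q γ) {s : Fin 2 → ℂ}
    (hs : s 0 ≠ 0) : bilin q (paramEval γ s) (paramEval γ s) ≠ 0 ∨
      bilin q (paramEval γ s) (paramDeriv γ 1 s) ≠ 0 := by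
  by_contra! h
  have h1 := congr_arg (MvPolynomial.eval s) (hγ.mul_bilin_self (q := q))
  simp only [map_mul, map_add, eval_bilin, MvPolynomial.eval_X, paramEval_pderiv, h.1, h.2,
    mul_zero, add_zero] at h1
  exact (hq.transverse s fun h => hs (by simp [h])).elim (fun h2 => mul_ne_zero hs h2 h1.symm)
    (· h.2)

/-- The forms `halphenChart q γ k` are multiples of `halphenParam q γ` by factors that do not depend
on the `k`-th variable, so the bivectors of the derivatives of both are proportional; those of the
former are given by `exists_minor_bilin_ne_zero`, with `k = 0` in the affine chart and `k = 1` at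
infinity. -/
theorem halphenParam_immersion (hγ : Immersion d γ) (hq : GoodQuadric q γ) :
    Immersion (3 * d - 2) (halphenParam q γ) := by
  have hd := hγ.one_le
  have heuler : ∀ s i, s 0 * paramDeriv (halphenParam q γ) 0 s i +
      s 1 * paramDeriv (halphenParam q γ) 1 s i =
        (3 * d - 2 : ℕ) * paramEval (halphenParam q γ) s i :=
    fun s i => euler_eval (hγ.isHomogeneous_halphenParam i) s
  have he : ((3 * d - 2 : ℕ) : ℂ) ≠ 0 := by exact_mod_cast (by omega : 3 * d - 2 ≠ 0)
  have hchart : ∀ z : ℂ, ∃ i j, minor (paramDeriv (halphenParam q γ) 0 ![z, 1])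
      (paramDeriv (halphenParam q γ) 1 ![z, 1]) i j ≠ 0 := by
    intro z
    obtain ⟨i, j, hij⟩ := exists_minor_bilin_ne_zero (hγ.exists_minor_chart z)
      (hγ.bilin_self_ne_zero_or_zero hq (by simp)) (hq.flex z)
    rw [← paramEval_halphenChart, ← paramDeriv_halphenChart] at hij
    refine ⟨i, j, fun h => ?_⟩
    have hi := hγ.paramEval_halphenChart_zero (q := q) ![z, 1] i
    have hj := hγ.paramEval_halphenChart_zero (q := q) ![z, 1] j
    have hi' := hγ.paramDeriv_halphenChart_zero (q := q) ![z, 1] i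
    have hj' := hγ.paramDeriv_halphenChart_zero (q := q) ![z, 1] j
    have h3 := heuler ![z, 1]
    simp only [Matrix.cons_val_zero, Matrix.cons_val_one, one_mul, neg_mul] at hi hj hi' hj' h3
    refine hij ((mul_eq_zero.mp (?_ : (3 * d - 2 : ℕ) * ((d : ℂ) * d) * _ = 0)).resolve_left
      (mul_ne_zero he (mul_ne_zero hγ.cast_ne_zero hγ.cast_ne_zero)))
    have hmul : (3 * d - 2 : ℕ) * ((d : ℂ) * d) * minor (paramEval (halphenChart q γ 0) ![z, 1])
        (paramDeriv (halphenChart q γ 0) 0 ![z, 1]) i j = (3 * d - 2 : ℕ) *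
        ((d * paramEval (halphenChart q γ 0) ![z, 1] i) *
          (d * paramDeriv (halphenChart q γ 0) 0 ![z, 1] j) -
        (d * paramEval (halphenChart q γ 0) ![z, 1] j) *
          (d * paramDeriv (halphenChart q γ 0) 0 ![z, 1] i)) := by
      rw [minor]
      ring
    rw [hmul, hi, hj, hi', hj']
    rw [minor] at h
    linear_combination -h + paramDeriv (halphenParam q γ) 0 ![z, 1] i * h3 j -
      paramDeriv (halphenParam q γ) 0 ![z, 1] j * h3 i
  have hinfty : ∃ i j, minor (paramDeriv (halphenParam q γ) 0 ![1, 0])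
      (paramDeriv (halphenParam q γ) 1 ![1, 0]) i j ≠ 0 := by
    obtain ⟨i, j, hij⟩ := exists_minor_bilin_ne_zero hγ.exists_minor_infty
      (hγ.bilin_self_ne_zero_or_one hq (by simp)) fun _ => hq.infty
    rw [← paramEval_halphenChart, ← paramDeriv_halphenChart] at hij
    refine ⟨i, j, fun h => ?_⟩
    have hi := hγ.paramEval_halphenChart_one (q := q) ![1, 0] i
    have hj := hγ.paramEval_halphenChart_one (q := q) ![1, 0] j
    have hi' := hγ.paramDeriv_halphenChart_one (q := q) ![1, 0] i
    have hj' := hγ.paramDeriv_halphenChart_one (q := q) ![1, 0] j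
    have h3 := heuler ![1, 0]
    simp only [Matrix.cons_val_zero, Matrix.cons_val_one, one_mul, zero_mul, add_zero]
      at hi hj hi' hj' h3
    refine hij ((mul_eq_zero.mp (?_ : (3 * d - 2 : ℕ) * ((d : ℂ) * d) * _ = 0)).resolve_left
      (mul_ne_zero he (mul_ne_zero hγ.cast_ne_zero hγ.cast_ne_zero)))
    have hmul : (3 * d - 2 : ℕ) * ((d : ℂ) * d) * minor (paramEval (halphenChart q γ 1) ![1, 0])
        (paramDeriv (halphenChart q γ 1) 1 ![1, 0]) i j = (3 * d - 2 : ℕ) *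
        ((d * paramEval (halphenChart q γ 1) ![1, 0] i) *
          (d * paramDeriv (halphenChart q γ 1) 1 ![1, 0] j) -
        (d * paramEval (halphenChart q γ 1) ![1, 0] j) *
          (d * paramDeriv (halphenChart q γ 1) 1 ![1, 0] i)) := by
      rw [minor]
      ring
    rw [hmul, hi, hj, hi', hj']
    rw [minor] at h
    linear_combination h - paramDeriv (halphenParam q γ) 1 ![1, 0] j * h3 i +
      paramDeriv (halphenParam q γ) 1 ![1, 0] i * h3 j
  refine ⟨by omega, hγ.isHomogeneous_halphenParam, fun s hs => ?_⟩
  have hsmul : ∀ (k : Fin 2) (c : ℂ) (s : Fin 2 → ℂ), paramDeriv (halphenParam q γ) k (c • s) =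
      c ^ (3 * d - 2 - 1) • paramDeriv (halphenParam q γ) k s := by
    intro k c s
    funext i
    exact eval_smul_of_isHomogeneous (hγ.isHomogeneous_halphenParam i).pderiv c s
  have hminor : ∀ (c : ℂ) (s : Fin 2 → ℂ) (i j : Fin 4),
      minor (paramDeriv (halphenParam q γ) 0 (c • s))
      (paramDeriv (halphenParam q γ) 1 (c • s)) i j = (c ^ (3 * d - 2 - 1)) ^ 2 *
        minor (paramDeriv (halphenParam q γ) 0 s) (paramDeriv (halphenParam q γ) 1 s) i j := by
    intro c s i j
    simp only [hsmul, minor, Pi.smul_apply, smul_eq_mul]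
    ring
  obtain ⟨c, hc, ⟨z, rfl⟩ | rfl⟩ := exists_smul_chart hs
  · obtain ⟨i, j, hij⟩ := hchart z
    exact ⟨i, j, by rw [hminor]; exact mul_ne_zero (pow_ne_zero _ (pow_ne_zero _ hc)) hij⟩
  · obtain ⟨i, j, hij⟩ := hinfty
    exact ⟨i, j, by rw [hminor]; exact mul_ne_zero (pow_ne_zero _ (pow_ne_zero _ hc)) hij⟩

/-- The tangent line at `γ` meets the polar plane of `γ` exactly in the point `halphenParam q γ`. -/
theorem mem_tangentSpan_and_bilin_eq_zero_iff (hq : GoodQuadric q γ) {s : Fin 2 → ℂ} (hs : s ≠ 0)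
    {w : Fin 4 → ℂ} : w ∈ tangentSpan γ s ∧ bilin q (paramEval γ s) w = 0 ↔
      ∃ t : ℂ, w = t • paramEval (halphenParam q γ) s := by
  set U := bilin q (paramEval γ s) (paramDeriv γ 0 s) with hU
  set V := bilin q (paramEval γ s) (paramDeriv γ 1 s) with hV
  have hbil : ∀ x y : ℂ, bilin q (paramEval γ s) (x • paramDeriv γ 0 s + y • paramDeriv γ 1 s) =
      x * U + y * V := fun x y => bilin_linear_right q _ _ _ x y
  rw [paramEval_halphenParam, ← hU, ← hV]
  constructor
  · rintro ⟨hw, hbw⟩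
    obtain ⟨x, y, rfl⟩ := Submodule.mem_span_pair.mp hw
    rw [hbil] at hbw
    rcases hq.transverse s hs with (h : U ≠ 0) | (h : V ≠ 0)
    · refine ⟨-y / U, ?_⟩
      have hx : x = -y / U * V := by
        field_simp
        linear_combination hbw
      have hy : y = -(-y / U * U) := by field_simp
      rw [smul_sub, smul_smul, smul_smul, ← hx, sub_eq_add_neg, ← neg_smul, ← hy]
    · refine ⟨x / V, ?_⟩
      have hx : x = x / V * V := by field_simp
      have hy : y = -(x / V * U) := by
        field_simp
        linear_combination hbw
      rw [smul_sub, smul_smul, smul_smul, ← hx, sub_eq_add_neg, ← neg_smul, ← hy]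
  · rintro ⟨t, rfl⟩
    have h : t • (V • paramDeriv γ 0 s - U • paramDeriv γ 1 s) =
        (t * V) • paramDeriv γ 0 s + (-(t * U)) • paramDeriv γ 1 s := by module
    rw [h]
    refine ⟨Submodule.mem_span_pair.mpr ⟨_, _, rfl⟩, ?_⟩
    rw [hbil]
    ring

theorem mem_polar_iff {m n : P3} {s : Fin 2 → ℂ} {c : ℂ} (hc : c ≠ 0)
    (hm : m.rep = c • paramEval γ s) :
    n ∈ polar (quadricForm q) m ↔ bilin q (paramEval γ s) n.rep = 0 := by
  rw [polar, Set.mem_ofPred_eq, sum_mul_eval_pderiv_quadricForm, hm, bilin_smul_left,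
    mul_eq_zero, or_iff_right hc]

theorem mem_curveImage_of_halphenMap (hγ : Immersion d γ) (hq : GoodQuadric q γ) {m n : P3}
    (h : HalphenMap (curveImage γ) (quadricForm q) m n) : n ∈ curveImage (halphenParam q γ) := by
  obtain ⟨hm, hn⟩ := h
  obtain ⟨s, hs, c, hc, hmc⟩ := mem_curveImage_iff.mp hm.1
  have hmem : n ∈ {p : P3 | p.rep ∈ tangentLine (curveImage γ) m} ∩ polar (quadricForm q) m :=
    hn ▸ Set.mem_singleton n
  rw [Set.mem_inter_iff, Set.mem_ofPred_eq, hγ.tangentLine_eq_of_isNonsingularPoint hs hmc hm,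
    mem_polar_iff hc hmc, mem_tangentSpan_and_bilin_eq_zero_iff hq hs] at hmem
  obtain ⟨t, ht⟩ := hmem
  refine mem_curveImage_iff.mpr ⟨s, hs, t, ?_, ht⟩
  rintro rfl
  exact n.rep_nonzero (by rw [ht, zero_smul])

theorem halphenMap_point (hγ : Immersion d γ) (hq : GoodQuadric q γ)
    {z : ℂ} (hz : z ∉ multiplePoints γ) :
    HalphenMap (curveImage γ) (quadricForm q) (hγ.point z)
      ((hγ.halphenParam_immersion hq).point z) := by
  obtain ⟨k, hk, hkz⟩ := hγ.exists_rep_point z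
  have hns := hγ.isNonsingularPoint hz hk hkz
  refine ⟨hns, ?_⟩
  ext n
  rw [Set.mem_inter_iff, Set.mem_ofPred_eq, hγ.tangentLine_eq_of_isNonsingularPoint
    (chart_ne_zero z) hkz hns, mem_polar_iff hk hkz,
    mem_tangentSpan_and_bilin_eq_zero_iff hq (chart_ne_zero z), Set.mem_singleton_iff]
  constructor
  · rintro ⟨t, ht⟩
    exact eq_mk_of_rep_eq _ ht
  · rintro rfl
    obtain ⟨t, -, ht⟩ := (hγ.halphenParam_immersion hq).exists_rep_point z
    exact ⟨t, ht⟩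

/-- The Halphen transform is the curve parametrized by `halphenParam q γ`: this curve is closed, and
a form vanishing at all but finitely many of its parameters vanishes on it. -/
theorem halphenTransform_eq (hγ : Immersion d γ) (hq : GoodQuadric q γ) :
    halphenTransform (curveImage γ) (quadricForm q) = curveImage (halphenParam q γ) := by
  have hΦ := hγ.halphenParam_immersion hq
  apply Set.Subset.antisymm
  · intro p hp
    refine hΦ.zariskiClosure_curveImage_subset fun F hF => hp F ⟨hF.1, ?_⟩
    rintro n ⟨m, hmn⟩
    exact hF.2 n (hγ.mem_curveImage_of_halphenMap hq hmn)
  · intro p hp F hF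
    obtain ⟨s, hs, c, -, hpc⟩ := mem_curveImage_iff.mp hp
    have hzero : ∀ z ∉ multiplePoints γ,
        MvPolynomial.eval (paramEval (halphenParam q γ) ![z, 1]) F = 0 := fun z hz =>
      eval_paramEval_eq_zero hF (hΦ.paramEval_ne_zero (chart_ne_zero z))
        ⟨_, hγ.halphenMap_point hq hz⟩
    obtain ⟨⟨n, hn⟩, -⟩ := hF
    have hhom := hn.aeval (halphenParam q γ) hΦ.isHomogeneous
    have hdehom : dehom (MvPolynomial.aeval (halphenParam q γ) F) = 0 := by
      refine Polynomial.eq_zero_of_infinite_isRoot _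
        (hγ.finite_multiplePoints.infinite_compl.mono fun z hz => ?_)
      rw [Set.mem_ofPred_eq, IsRoot.def, eval_dehom, eval_aeval_param]
      exact hzero z hz
    rw [hpc, eval_smul_of_isHomogeneous hn, ← eval_aeval_param]
    obtain ⟨l, -, ⟨z, rfl⟩ | rfl⟩ := exists_smul_chart hs
    · rw [eval_smul_of_isHomogeneous hhom, ← eval_dehom, hdehom, eval_zero, mul_zero, mul_zero]
    · rw [eval_smul_of_isHomogeneous hhom, ← coeff_dehom hhom, hdehom, coeff_zero, mul_zero,
        mul_zero]

theorem isGeneric_hasDegree_halphenTransform (hγ : Immersion d γ) :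
    IsGeneric fun q : Sym2 (Fin 4) → ℂ =>
      HasDegree (halphenTransform (curveImage γ) (quadricForm q)) (3 * d - 2) :=
  hγ.isGeneric_goodQuadric.mono fun q hq => by
    rw [hγ.halphenTransform_eq hq]
    exact (hγ.halphenParam_immersion hq).hasDegree

end Immersion

end Halphen

namespace Halphen

open Polynomial

/-! ### Common zeros and common factors of binary forms -/

theorem eval_aeval_mul_X (F : MvPolynomial (Fin 2) ℂ) (s : Fin 2 → ℂ) (t : ℂ) :
    (MvPolynomial.aeval (fun i => C (s i) * X) F).eval t = MvPolynomial.eval (t • s) F := by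
  induction F using MvPolynomial.induction_on with
  | C a => simp
  | add p q hp hq => simp [hp, hq]
  | mul_X p i hp =>
    rw [map_mul, MvPolynomial.aeval_X, eval_mul, hp, map_mul, MvPolynomial.eval_X]
    simp only [eval_mul, eval_C, eval_X, Pi.smul_apply, smul_eq_mul]
    rw [mul_comm t]

/-- The linear form vanishing at `s` generates the kernel of the substitution `(u, v) = t s`, so it
is prime and divides every form vanishing at `s`. -/
theorem exists_prime_dvd_of_eval_eq_zero {s : Fin 2 → ℂ} (hs : s ≠ 0) :
    ∃ l : MvPolynomial (Fin 2) ℂ, Prime l ∧ ∀ (F : MvPolynomial (Fin 2) ℂ) (n : ℕ),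
      F.IsHomogeneous n → MvPolynomial.eval s F = 0 → l ∣ F := by
  obtain ⟨k, hk⟩ := Function.ne_iff.mp hs
  rw [Pi.zero_apply] at hk
  set l : MvPolynomial (Fin 2) ℂ :=
    MvPolynomial.C (s 1) * MvPolynomial.X 0 - MvPolynomial.C (s 0) * MvPolynomial.X 1 with hl
  set φ : MvPolynomial (Fin 2) ℂ →ₐ[ℂ] ℂ[X] := MvPolynomial.aeval fun i => C (s i) * X with hφ
  have hφl : φ l = 0 := by
    simp only [hφ, hl, map_sub, map_mul, MvPolynomial.aeval_X, MvPolynomial.aeval_C,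
      Polynomial.algebraMap_apply, Algebra.algebraMap_self, RingHom.id_apply]
    ring
  have hl0 : l ≠ 0 := by
    intro h0
    have h1 : s 1 = 0 := by simpa [hl] using congr_arg (MvPolynomial.eval ![1, 0]) h0
    have h2 : s 0 = 0 := by simpa [hl] using congr_arg (MvPolynomial.eval ![0, 1]) h0
    fin_cases k
    exacts [hk h2, hk h1]
  set ψ : ℂ[X] →ₐ[ℂ] MvPolynomial (Fin 2) ℂ :=
    Polynomial.aeval (MvPolynomial.C (s k)⁻¹ * MvPolynomial.X k) with hψ
  have hmk : (Ideal.Quotient.mkₐ ℂ (Ideal.span {l})).comp (ψ.comp φ) =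
      Ideal.Quotient.mkₐ ℂ (Ideal.span {l}) := by
    refine MvPolynomial.algHom_ext fun i => ?_
    simp only [AlgHom.comp_apply, Ideal.Quotient.mkₐ_eq_mk]
    rw [Ideal.Quotient.mk_eq_mk_iff_sub_mem, Ideal.mem_span_singleton]
    have hCk : (MvPolynomial.C (s k)⁻¹ * MvPolynomial.C (s k) : MvPolynomial (Fin 2) ℂ) = 1 := by
      rw [← MvPolynomial.C_mul, inv_mul_cancel₀ hk, MvPolynomial.C_1]
    have hi : ψ (φ (MvPolynomial.X i)) =
        MvPolynomial.C (s i) * (MvPolynomial.C (s k)⁻¹ * MvPolynomial.X k) := by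
      simp [hφ, hψ]
    rw [hi]
    fin_cases k <;> fin_cases i <;>
      simp only [Fin.zero_eta, Fin.mk_one, Fin.isValue] at hCk ⊢
    · exact ⟨0, by linear_combination MvPolynomial.X 0 * hCk⟩
    · exact ⟨MvPolynomial.C (s 0)⁻¹, by linear_combination MvPolynomial.X 1 * hCk⟩
    · exact ⟨-MvPolynomial.C (s 1)⁻¹, by linear_combination MvPolynomial.X 0 * hCk⟩
    · exact ⟨0, by linear_combination MvPolynomial.X 1 * hCk⟩
  have hker : ∀ F, φ F = 0 → l ∣ F := by
    intro F hF
    have h := AlgHom.congr_fun hmk F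
    rw [AlgHom.comp_apply, AlgHom.comp_apply, hF, map_zero, map_zero, eq_comm,
      Ideal.Quotient.mkₐ_eq_mk, Ideal.Quotient.eq_zero_iff_mem, Ideal.mem_span_singleton] at h
    exact h
  refine ⟨l, ⟨hl0, fun hu => ?_, fun F G hFG => ?_⟩, fun F n hF hs => hker F ?_⟩
  · exact not_isUnit_zero (hφl ▸ hu.map φ)
  · obtain ⟨H, hH⟩ := hFG
    have h : φ F * φ G = 0 := by rw [← map_mul, hH, map_mul, hφl, zero_mul]
    exact (mul_eq_zero.mp h).imp (hker F) (hker G)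
  · refine Polynomial.funext fun t => ?_
    rw [hφ, eval_aeval_mul_X, eval_smul_of_isHomogeneous hF, hs, mul_zero, eval_zero]

variable {d : ℕ} {γ : Fin 4 → MvPolynomial (Fin 2) ℂ}

theorem eq_C_of_isHomogeneous_zero {F : MvPolynomial (Fin 2) ℂ} (hF : F.IsHomogeneous 0) :
    F = MvPolynomial.C (MvPolynomial.eval 0 F) := by
  refine MvPolynomial.funext fun s => ?_
  have h := eval_smul_of_isHomogeneous hF 0 s
  rw [zero_smul, pow_zero, one_mul] at h
  rw [MvPolynomial.eval_C, h]

theorem immersion_of_wedgeCoprime (hγ : ∀ i, (γ i).IsHomogeneous d) (h : WedgeCoprime γ) :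
    Immersion d γ := by
  refine ⟨?_, hγ, fun s hs => ?_⟩
  · by_contra! hd
    obtain rfl : d = 0 := by omega
    obtain ⟨l, hl, -⟩ := exists_prime_dvd_of_eval_eq_zero infty_ne_zero
    refine h ⟨l, hl, fun i j _ => ?_⟩
    rw [wedgeCoord, eq_C_of_isHomogeneous_zero (hγ i), MvPolynomial.pderiv_C,
      MvPolynomial.pderiv_C, zero_mul, mul_zero, sub_zero]
    exact dvd_zero _
  · by_contra! h0
    obtain ⟨l, hl, hdvd⟩ := exists_prime_dvd_of_eval_eq_zero hs
    refine h ⟨l, hl, fun i j _ => hdvd _ _ (isHomogeneous_wedgeCoord hγ i j) ?_⟩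
    rw [eval_wedgeCoord, h0]

/-! ### Generic binary forms -/

theorem isHomogeneous_paramOfCoeffs (d : ℕ) (c : Fin 4 × Fin (d + 1) → ℂ) (i : Fin 4) :
    (paramOfCoeffs d c i).IsHomogeneous d := by
  refine MvPolynomial.IsHomogeneous.sum _ _ _ fun k _ => ?_
  have h := ((MvPolynomial.isHomogeneous_X_pow (R := ℂ) (0 : Fin 2) k).C_mul (c (i, k))).mul
    (MvPolynomial.isHomogeneous_X_pow (R := ℂ) (1 : Fin 2) (d - k))
  rwa [Nat.add_sub_cancel' (Nat.lt_succ_iff.mp k.2)] at h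

theorem dehom_paramOfCoeffs (d : ℕ) (c : Fin 4 × Fin (d + 1) → ℂ) (i : Fin 4) :
    dehom (paramOfCoeffs d c i) = ∑ k : Fin (d + 1), C (c (i, k)) * X ^ (k : ℕ) := by
  simp [paramOfCoeffs, dehom]

theorem dehom_wedgeCoord (hγ : ∀ i, (γ i).IsHomogeneous d) (i j : Fin 4) :
    dehom (wedgeCoord γ i j) =
      derivative (dehom (γ i)) * (C (d : ℂ) * dehom (γ j) - X * derivative (dehom (γ j))) -
      derivative (dehom (γ j)) * (C (d : ℂ) * dehom (γ i) - X * derivative (dehom (γ i))) := by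
  rw [wedgeCoord, map_sub, map_mul, map_mul, dehom_pderiv_one (hγ i), dehom_pderiv_one (hγ j),
    derivative_dehom, derivative_dehom]

/-- The dehomogenization of a quadruple of binary forms with indeterminate coefficients. -/
noncomputable def universalParam (d : ℕ) (i : Fin 4) : (MvPolynomial (Fin 4 × Fin (d + 1)) ℂ)[X] :=
  ∑ k : Fin (d + 1), C (MvPolynomial.X (i, k)) * X ^ (k : ℕ)

/-- The dehomogenization of `wedgeCoord` for forms with indeterminate coefficients. -/
noncomputable def universalWedge (d : ℕ) (i j : Fin 4) :
    (MvPolynomial (Fin 4 × Fin (d + 1)) ℂ)[X] :=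
  derivative (universalParam d i) *
      (C (MvPolynomial.C (d : ℂ)) * universalParam d j -
        X * derivative (universalParam d j)) -
    derivative (universalParam d j) *
      (C (MvPolynomial.C (d : ℂ)) * universalParam d i -
        X * derivative (universalParam d i))

theorem map_universalWedge (d : ℕ) (c : Fin 4 × Fin (d + 1) → ℂ) (i j : Fin 4) :
    (universalWedge d i j).map (MvPolynomial.eval c) =
      dehom (wedgeCoord (paramOfCoeffs d c) i j) := by
  have h : ∀ i, (universalParam d i).map (MvPolynomial.eval c) = dehom (paramOfCoeffs d c i) := by
    intro i
    simp [universalParam, dehom_paramOfCoeffs, Polynomial.map_sum]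
  rw [dehom_wedgeCoord (isHomogeneous_paramOfCoeffs d c)]
  simp only [universalWedge, Polynomial.map_sub, Polynomial.map_mul, ← derivative_map, h, map_X,
    Polynomial.map_C, MvPolynomial.eval_C]

/-- The coefficients of the forms `(u + i v) ^ d`. -/
def binomialCoeffs (d : ℕ) : Fin 4 × Fin (d + 1) → ℂ :=
  fun p => (p.1 : ℕ) ^ (d - (p.2 : ℕ)) * (d.choose p.2 : ℂ)

theorem dehom_binomialCoeffs (d : ℕ) (i : Fin 4) :
    dehom (paramOfCoeffs d (binomialCoeffs d) i) = (X + C ((i : ℕ) : ℂ)) ^ d := by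
  rw [dehom_paramOfCoeffs, add_pow, Finset.sum_range]
  refine Finset.sum_congr rfl fun k _ => ?_
  simp only [binomialCoeffs, map_mul, map_pow, map_natCast]
  ring

theorem wedge_binomialCoeffs (hd : 1 ≤ d) (i j : Fin 4) :
    dehom (wedgeCoord (paramOfCoeffs d (binomialCoeffs d)) i j) =
      C ((d : ℂ) ^ 2 * ((j : ℕ) - (i : ℕ))) *
        ((X + C ((i : ℕ) : ℂ)) ^ (d - 1) * (X + C ((j : ℕ) : ℂ)) ^ (d - 1)) := by
  rw [dehom_wedgeCoord (isHomogeneous_paramOfCoeffs d _), dehom_binomialCoeffs,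
    dehom_binomialCoeffs]
  obtain ⟨e, rfl⟩ := Nat.exists_eq_add_of_le' hd
  rw [derivative_X_add_C_pow, derivative_X_add_C_pow, Nat.add_sub_cancel]
  simp only [map_mul, map_sub, map_pow, pow_succ]
  ring

theorem wedge_binomialCoeffs_scalar_ne_zero (hd : 1 ≤ d) {i j : Fin 4} (hij : i ≠ j) :
    (d : ℂ) ^ 2 * ((j : ℕ) - (i : ℕ)) ≠ 0 := by
  have hd0 : (d : ℂ) ≠ 0 := by exact_mod_cast (by omega : d ≠ 0)
  refine mul_ne_zero (pow_ne_zero 2 hd0) (sub_ne_zero.mpr fun h => hij ?_)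
  exact (Fin.ext (by exact_mod_cast h)).symm

theorem isCoprime_wedge_binomialCoeffs (hd : 1 ≤ d) :
    IsCoprime (dehom (wedgeCoord (paramOfCoeffs d (binomialCoeffs d)) 0 1))
      (dehom (wedgeCoord (paramOfCoeffs d (binomialCoeffs d)) 2 3)) := by
  have hX : ∀ a b : ℂ, a ≠ b → IsCoprime ((X + C a) ^ (d - 1)) ((X + C b) ^ (d - 1)) := by
    intro a b hab
    have := isCoprime_X_sub_C_of_isUnit_sub (R := ℂ) (a := -a) (b := -b)
      (sub_ne_zero.mpr fun h => hab (neg_injective h)).isUnit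
    simp only [map_neg, sub_neg_eq_add] at this
    exact this.pow
  rw [wedge_binomialCoeffs hd, wedge_binomialCoeffs hd,
    isCoprime_mul_unit_left_left
      (isUnit_C.mpr (wedge_binomialCoeffs_scalar_ne_zero hd (by decide)).isUnit),
    isCoprime_mul_unit_left_right
      (isUnit_C.mpr (wedge_binomialCoeffs_scalar_ne_zero hd (by decide)).isUnit)]
  refine (((hX _ _ ?_).mul_right (hX _ _ ?_)).mul_left ((hX _ _ ?_).mul_right (hX _ _ ?_))) <;>
  norm_num

theorem natDegree_wedge_binomialCoeffs (hd : 1 ≤ d) {i j : Fin 4} (hij : i ≠ j) :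
    (dehom (wedgeCoord (paramOfCoeffs d (binomialCoeffs d)) i j)).natDegree = 2 * d - 2 := by
  rw [wedge_binomialCoeffs hd, natDegree_C_mul, Monic.natDegree_mul, natDegree_pow, natDegree_pow,
    natDegree_X_add_C, natDegree_X_add_C]
  · omega
  · exact (monic_X_add_C _).pow _
  · exact (monic_X_add_C _).pow _
  · exact wedge_binomialCoeffs_scalar_ne_zero hd hij

/-- Generically, the coordinates `0, 1` and `2, 3` of the bivector of the derivatives have no common
zero, since this is the case for the forms `(u + i v) ^ d`. -/
theorem isGeneric_immersion (hd : 1 ≤ d) :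
    IsGeneric fun c : Fin 4 × Fin (d + 1) → ℂ => Immersion d (paramOfCoeffs d c) := by
  have key : ∀ c, MvPolynomial.eval c ((universalWedge d 0 1).coeff (2 * d - 2) *
      resultant (universalWedge d 0 1) (universalWedge d 2 3) (2 * d - 2) (2 * d - 2)) =
      (dehom (wedgeCoord (paramOfCoeffs d c) 0 1)).coeff (2 * d - 2) *
        resultant (dehom (wedgeCoord (paramOfCoeffs d c) 0 1))
          (dehom (wedgeCoord (paramOfCoeffs d c) 2 3)) (2 * d - 2) (2 * d - 2) := by
    intro c
    rw [← map_universalWedge, ← map_universalWedge, map_mul, resultant_map_map, coeff_map]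
  refine IsGeneric.of_eval_ne_zero _ (x₀ := binomialCoeffs d) ((key _).trans_ne ?_) fun c hc => ?_
  · have h1 := natDegree_wedge_binomialCoeffs hd (i := 0) (j := 1) (by decide)
    have h2 := natDegree_wedge_binomialCoeffs hd (i := 2) (j := 3) (by decide)
    have h0 : dehom (wedgeCoord (paramOfCoeffs d (binomialCoeffs d)) 0 1) ≠ 0 := by
      rw [wedge_binomialCoeffs hd]
      exact mul_ne_zero (C_ne_zero.mpr (wedge_binomialCoeffs_scalar_ne_zero hd (by decide)))
        (((monic_X_add_C _).pow _).mul ((monic_X_add_C _).pow _)).ne_zero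
    refine mul_ne_zero ?_ fun h => ?_
    · rw [← h1]
      exact leadingCoeff_ne_zero.mpr h0
    · have := resultant_eq_zero_iff
        (f := dehom (wedgeCoord (paramOfCoeffs d (binomialCoeffs d)) 0 1))
        (g := dehom (wedgeCoord (paramOfCoeffs d (binomialCoeffs d)) 2 3))
      rw [h1, h2] at this
      have := this.mp h
      exact this.2 (isCoprime_wedge_binomialCoeffs hd)
  · rw [key] at hc
    have hhom := isHomogeneous_paramOfCoeffs d c
    have hwedge := fun i j => isHomogeneous_wedgeCoord hhom i j
    refine ⟨hd, hhom, fun s hs => ?_⟩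
    by_contra! h0
    simp only [← eval_wedgeCoord] at h0
    obtain ⟨l, hl, ⟨z, rfl⟩ | rfl⟩ := exists_smul_chart hs
    · have h1 : ∀ i j, (dehom (wedgeCoord (paramOfCoeffs d c) i j)).eval z = 0 := by
        intro i j
        have := h0 i j
        rw [eval_smul_of_isHomogeneous (hwedge i j), ← eval_dehom] at this
        exact (mul_eq_zero.mp this).resolve_left (pow_ne_zero _ hl)
      -- For `d = 1` both forms are constants, whose resultant is `1` even if they vanish.
      rcases hd.eq_or_lt with rfl | hd
      · have h2 := natDegree_dehom_le (hwedge 0 1)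
        rw [eq_C_of_natDegree_le_zero h2] at hc
        have h3 := h1 0 1
        rw [eq_C_of_natDegree_le_zero h2, eval_C] at h3
        exact left_ne_zero_of_mul hc (by simp [h3])
      · obtain ⟨P, Q, -, -, hPQ⟩ := exists_mul_add_mul_eq_C_resultant _ _
          (natDegree_dehom_le (hwedge 0 1)) (natDegree_dehom_le (hwedge 2 3)) (Or.inl (by omega))
        have h2 := congr_arg (eval z) hPQ
        rw [eval_add, eval_mul, eval_mul, h1, h1, zero_mul, zero_mul, add_zero, eval_C] at h2
        exact right_ne_zero_of_mul hc h2.symm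
    · have := h0 0 1
      rw [eval_smul_of_isHomogeneous (hwedge 0 1), ← coeff_dehom (hwedge 0 1)] at this
      exact mul_ne_zero (pow_ne_zero _ hl) (left_ne_zero_of_mul hc) this

end Halphen

theorem mainTheorem6 :
    (∀ d : ℕ, 1 ≤ d →
      Halphen.IsGeneric fun c : Fin 4 × Fin (d + 1) → ℂ =>
        Halphen.IsMorphismOfDegree d (Halphen.paramOfCoeffs d c) ∧
        Halphen.HasDegree (Halphen.curveImage (Halphen.paramOfCoeffs d c)) d ∧
        Halphen.HasRank (Halphen.curveImage (Halphen.paramOfCoeffs d c)) (2 * d - 2) ∧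
        Halphen.IsGeneric fun q : Sym2 (Fin 4) → ℂ =>
          Halphen.HasDegree
            (Halphen.halphenTransform (Halphen.curveImage (Halphen.paramOfCoeffs d c))
              (Halphen.quadricForm q)) (3 * d - 2)) ∧
    (∀ (d : ℕ) (γ : Fin 4 → MvPolynomial (Fin 2) ℂ),
      Halphen.IsMorphismOfDegree d γ → Halphen.WedgeCoprime γ →
        1 ≤ d ∧
        Halphen.HasDegree (Halphen.curveImage γ) d ∧
        Halphen.HasRank (Halphen.curveImage γ) (2 * d - 2) ∧
        Halphen.IsGeneric fun q : Sym2 (Fin 4) → ℂ =>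
          Halphen.HasDegree
            (Halphen.halphenTransform (Halphen.curveImage γ) (Halphen.quadricForm q))
            (3 * d - 2)) := by
  refine ⟨fun d hd => (Halphen.isGeneric_immersion hd).mono fun c hc =>
    ⟨hc.isMorphismOfDegree, hc.hasDegree, hc.hasRank, hc.isGeneric_hasDegree_halphenTransform⟩,
    fun d γ hγ hW => ?_⟩
  have h := Halphen.immersion_of_wedgeCoprime hγ.1 hW
  exact ⟨h.one_le, h.hasDegree, h.hasRank, h.isGeneric_hasDegree_halphenTransform⟩
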